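/- Let $\langle z\rangle=(1+|z|^2)^{1/2}$ and let $V:\mathbb R^4\to\mathbb R$ be measurable with $|V(z)|\le C\langle z\rangle^{-\delta}$ for all $z$, for some constants $C$ and $\delta>4$. Let $\psi_1,\dots,\psi_d$ be an orthonormal basis of the zero energy eigenspace $\{\psi\in L^2(\mathbb R^4):(-\Delta+V)\psi=0\}$ (the equation being understood in the sense of distributions), let $a_{jk}\in\mathbb R$ for $1\le j,k\le d$, and let $L_1$ be the finite rank operator with integral kernel $$L_1(x,y)=\sum_{j,k=1}^d a_{jk}\,V(x)\psi_j(x)\,V(y)\psi_k(y).$$ For $\lambda>0$ let $R_0^\pm(\lambda^2)=\lim_{\varepsilon\to0^+}(-\Delta-(\lambda\pm i\varepsilon)^2)^{-1}$ be the free resolvents on $\mathbb R^4$, that is, the integral operators with kernels $R_0^\pm(\lambda^2,|x-y|)$, where $$R_0^\pm(\lambda^2,r)=-\frac{\lambda}{8\pi r}\bigl[Y_1(\lambda r)\mp iJ_1(\lambda r)\bigr]$$ and $J_1,Y_1$ are the Bessel functions of order one of the first and second kind. Let $\tilde\Phi\in C_c^\infty(\mathbb R)$ be real-valued, and define $$W_{log}f=\frac1{\pi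 i}\int_0^\infty R_0^+(\lambda^2)\,L_1\,\bigl(R_0^+(\lambda^2)-R_0^-(\lambda^2)\bigr)f\;\tilde\Phi(\lambda)\,\lambda\log\lambda\,d\lambda .$$ Then for every $1\le p<\infty$ the operator $W_{log}$ is bounded on $L^p(\mathbb R^4)$: for every $f\in L^1(\mathbb R^4)\cap L^p(\mathbb R^4)$ all integrals in the formula for $(W_{log}f)(x)$ converge absolutely for almost every $x$, and there is a bounded linear operator $T$ on $L^p(\mathbb R^4)$ with $Tf=W_{log}f$ almost everywhere for all such $f$. -/

import Mathlib

open MeasureTheory Set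
open scoped ENNReal ContDiff Laplacian

noncomputable section

/-- Four-dimensional Euclidean space. -/
abbrev R4 : Type := EuclideanSpace ℝ (Fin 4)

/-- The Japanese bracket `⟨x⟩ = (1 + |x|²)^{1/2}`. -/
def japaneseBracket (x : R4) : ℝ := Real.sqrt (1 + ‖x‖ ^ 2)

/-- The Bessel function `J₁` of the first kind on `(0, ∞)`, by Poisson's integral
`J_ν(s) = 2 (s/2)^ν / (√π Γ(ν + 1/2)) ∫₀¹ (1 - t²)^{ν - 1/2} cos (s t) dt` for `ν = 1`. -/
def besselJ1 (s : ℝ) : ℝ :=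
  2 * s / Real.pi * ∫ t in (0 : ℝ)..1, Real.sqrt (1 - t ^ 2) * Real.cos (s * t)

/-- The Bessel function `Y₁` of the second kind on `(0, ∞)`, by the companion of Poisson's integral
`Y_ν(s) = 2 (s/2)^ν / (√π Γ(ν + 1/2))
  (∫₀¹ (1 - t²)^{ν - 1/2} sin (s t) dt - ∫₀^∞ e^{-s t} (1 + t²)^{ν - 1/2} dt)` for `ν = 1`. -/
def besselY1 (s : ℝ) : ℝ :=
  2 * s / Real.pi *
    ((∫ t in (0 : ℝ)..1, Real.sqrt (1 - t ^ 2) * Real.sin (s * t)) -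
      ∫ t in Ioi (0 : ℝ), Real.exp (-(s * t)) * Real.sqrt (1 + t ^ 2))

/-- The convolution kernel of the outgoing free resolvent
`R₀⁺(lam²) = lim_{ε → 0⁺} (-Δ - (lam + iε)²)⁻¹` on `ℝ⁴` at distance `r`:
`-(lam / (8 π r)) (Y₁(lam r) - i J₁(lam r))`. -/
def resolventKernelPlus (lam r : ℝ) : ℂ :=
  -((lam / (8 * Real.pi * r) : ℝ) : ℂ) *
    ((besselY1 (lam * r) : ℂ) - Complex.I * (besselJ1 (lam * r) : ℂ))

/-- The convolution kernel of the incoming free resolvent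
`R₀⁻(lam²) = lim_{ε → 0⁺} (-Δ - (lam - iε)²)⁻¹` on `ℝ⁴` at distance `r`:
`-(lam / (8 π r)) (Y₁(lam r) + i J₁(lam r))`. -/
def resolventKernelMinus (lam r : ℝ) : ℂ :=
  -((lam / (8 * Real.pi * r) : ℝ) : ℂ) *
    ((besselY1 (lam * r) : ℂ) + Complex.I * (besselJ1 (lam * r) : ℂ))

/-- The free resolvent `R₀⁺(lam²)` as an integral operator. -/
def freeResolventPlus (lam : ℝ) (f : R4 → ℂ) (x : R4) : ℂ :=
  ∫ y, resolventKernelPlus lam ‖x - y‖ * f y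

/-- The free resolvent `R₀⁻(lam²)` as an integral operator. -/
def freeResolventMinus (lam : ℝ) (f : R4 → ℂ) (x : R4) : ℂ :=
  ∫ y, resolventKernelMinus lam ‖x - y‖ * f y

/-- `u ∈ L²(ℝ⁴)` solves `(-Δ + V) u = 0` in the sense of distributions. -/
def IsZeroEnergySolution (V : R4 → ℝ) (u : Lp ℂ 2 (volume : Measure R4)) : Prop :=
  ∀ φ : R4 → ℂ, ContDiff ℝ ∞ φ → HasCompactSupport φ →
    ∫ x, u x * (-((Δ φ) x) + (V x : ℂ) * φ x) = 0

/-- `ψ₁, …, ψ_d` is an orthonormal basis of the zero energy eigenspace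
`{u ∈ L²(ℝ⁴) : (-Δ + V) u = 0}`. -/
def IsZeroEnergyEigenbasis (V : R4 → ℝ) {d : ℕ}
    (ψ : Fin d → Lp ℂ 2 (volume : Measure R4)) : Prop :=
  Orthonormal ℂ ψ ∧
    ∀ u : Lp ℂ 2 (volume : Measure R4),
      u ∈ Submodule.span ℂ (range ψ) ↔ IsZeroEnergySolution V u

/-- The kernel `L₁(x, y) = ∑_{j,k} a_{jk} (V ψ_j)(x) (V ψ_k)(y)`. -/
def kernelL1 (V : R4 → ℝ) {d : ℕ} (ψ : Fin d → Lp ℂ 2 (volume : Measure R4))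
    (a : Fin d → Fin d → ℝ) (x y : R4) : ℂ :=
  ∑ j, ∑ k, (a j k : ℂ) * ((V x : ℂ) * ψ j x) * ((V y : ℂ) * ψ k y)

/-- The finite rank operator `L₁`. -/
def operatorL1 (V : R4 → ℝ) {d : ℕ} (ψ : Fin d → Lp ℂ 2 (volume : Measure R4))
    (a : Fin d → Fin d → ℝ) (g : R4 → ℂ) (x : R4) : ℂ :=
  ∫ y, kernelL1 V ψ a x y * g y

/-- The function `(R₀⁺(lam²) - R₀⁻(lam²)) f`. -/
def resolventDiff (lam : ℝ) (f : R4 → ℂ) (x : R4) : ℂ :=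
  freeResolventPlus lam f x - freeResolventMinus lam f x

/-- The integrand
`(R₀⁺(lam²) L₁ (R₀⁺(lam²) - R₀⁻(lam²)) f)(x) · Φ(lam) · lam · log lam` of `W_log`. -/
def integrandWlog (V : R4 → ℝ) {d : ℕ} (ψ : Fin d → Lp ℂ 2 (volume : Measure R4))
    (a : Fin d → Fin d → ℝ) (Φ : ℝ → ℝ) (f : R4 → ℂ) (x : R4) (lam : ℝ) : ℂ :=
  freeResolventPlus lam (operatorL1 V ψ a (resolventDiff lam f)) x *
    ((Φ lam * lam * Real.log lam : ℝ) : ℂ)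

/-- `(W_log f)(x) = (1 / (π i)) ∫₀^∞ (R₀⁺ L₁ (R₀⁺ - R₀⁻) f)(x) Φ(lam) lam log lam d lam`. -/
def Wlog (V : R4 → ℝ) {d : ℕ} (ψ : Fin d → Lp ℂ 2 (volume : Measure R4))
    (a : Fin d → Fin d → ℝ) (Φ : ℝ → ℝ) (f : R4 → ℂ) (x : R4) : ℂ :=
  1 / ((Real.pi : ℂ) * Complex.I) *
    ∫ lam in Ioi (0 : ℝ), integrandWlog V ψ a Φ f x lam

/-- Every integral in the formula for `(W_log f)(x)` converges absolutely. -/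
structure WlogConvergesAt (V : R4 → ℝ) {d : ℕ} (ψ : Fin d → Lp ℂ 2 (volume : Measure R4))
    (a : Fin d → Fin d → ℝ) (Φ : ℝ → ℝ) (f : R4 → ℂ) (x : R4) : Prop where
  plus : ∀ lam > 0, ∀ᵐ w : R4, Integrable fun y => resolventKernelPlus lam ‖w - y‖ * f y
  minus : ∀ lam > 0, ∀ᵐ w : R4, Integrable fun y => resolventKernelMinus lam ‖w - y‖ * f y
  middle : ∀ lam > 0, ∀ z : R4, Integrable fun w => kernelL1 V ψ a z w * resolventDiff lam f w
  outer : ∀ lam > 0, Integrable fun z =>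
    resolventKernelPlus lam ‖x - z‖ * operatorL1 V ψ a (resolventDiff lam f) z
  spectral : IntegrableOn (integrandWlog V ψ a Φ f x) (Ioi 0)

end

/-! Integrate in `lam` first. Up to constants, `R₀⁺` has kernel `lam² B(lam r)` with `B(u)` a
multiple of `H₁⁽¹⁾(u)/u`, and `R₀⁺ - R₀⁻` has kernel `lam² j(lam s)` with `j = Im B`, a multiple of
`J₁(s)/s`. So `W_log` is the integral against `L₁(z, w)` of a kernel depending only on `r = |x - z|`
and `s = |w - y|`, namely a multiple of `∫ lam⁵ log lam · Φ(lam) B(lam r) j(lam s) d lam`.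

Rotating the contour in Poisson's integral writes `B(u)` as a superposition of the damped waves
`e^{iu(1+it)}`, `t > 0` (`hankelB_eq_integral`). The spectral integral becomes a superposition of
Laplace transforms of `x⁵ log x · Φ(x)` at points `ζ` of the closed upper half plane, and these are
`O((1 + |ζ|)^{-(6-ε)})` for every `ε > 0` (`norm_logTransform_le_one_add`): each power of `x` gains
a power of `|ζ|` and the logarithm costs `ε`.

With `q` the real exponent `p`, the choice `ε = 1/(2q)` gives the majorant of
`norm_besselProductIntegral_le`. On `s ≤ 2r` it contains `(1+r)⁻³ (1+|r-s|)⁻²`, which satisfies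
Schur's test because the factor `(1+r)⁻³` cancels the Jacobians `r³` and `s³` of `ℝ⁴`. The rest is a
product of a function of `r` and a function of `s`. The first, convolved with `V ψ_j ∈ L¹ ∩ L²`,
lies in `L^q`; the second lies in `L^{q'}`, so that Hölder applies
(`lintegral_kernelMajorant_rpow_le`).

It remains to justify the order of integration. For almost every `x` the integrand in `(lam, z, w,
y)` is absolutely integrable when `f ∈ L¹` (`integrable_fullIntegrand_mul`), and Fubini identifies
`W_log f` with the operator of that kernel (`wlog_converges_and_eq`). -/

/-! ### Laplace transforms of logarithmic amplitudes in the closed upper half plane. -/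

theorem abs_log_le_const_mul_rpow_neg {ε R : ℝ} (hε : 0 < ε) (hR : 0 ≤ R) :
    ∃ C, 0 ≤ C ∧ ∀ x, 0 < x → x ≤ R → |Real.log x| ≤ C * x ^ (-ε) := by
  refine ⟨(R ^ (2 * ε) + 1) / ε, by positivity, fun x hx hxR => ?_⟩
  · have h1 : Real.log x ≤ x ^ ε / ε := Real.log_le_rpow_div hx.le hε
    have h2 : Real.log x⁻¹ ≤ x⁻¹ ^ ε / ε := Real.log_le_rpow_div (by positivity) hε
    rw [Real.log_inv, Real.inv_rpow hx.le, ← Real.rpow_neg hx.le] at h2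
    have h3 : x ^ ε = x ^ (2 * ε) * x ^ (-ε) := by
      rw [← Real.rpow_add hx]; ring_nf
    have h4 : x ^ (2 * ε) ≤ R ^ (2 * ε) := by gcongr
    have h5 : 0 ≤ x ^ (-ε) := by positivity
    have h6 : x ^ ε ≤ R ^ (2 * ε) * x ^ (-ε) := by rw [h3]; gcongr
    have h7 : 0 ≤ x ^ ε := by positivity
    rw [show (R ^ (2 * ε) + 1) / ε * x ^ (-ε) = (R ^ (2 * ε) * x ^ (-ε)) / ε + x ^ (-ε) / ε by ring]
    have h8 : x ^ ε / ε ≤ R ^ (2 * ε) * x ^ (-ε) / ε := by gcongr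
    have h9 : 0 ≤ x ^ ε / ε := by positivity
    have h10 : 0 ≤ x ^ (-ε) / ε := by positivity
    rw [abs_le]
    constructor <;> linarith

theorem norm_exp_I_mul_le_one {x : ℝ} (hx : 0 ≤ x) {ζ : ℂ} (hζ : 0 ≤ ζ.im) :
    ‖Complex.exp (Complex.I * x * ζ)‖ ≤ 1 := by
  rw [Complex.norm_exp]
  simp
  positivity

theorem hasDerivAt_exp_I_mul (x : ℝ) (ζ : ℂ) :
    HasDerivAt (fun x : ℝ => Complex.exp (Complex.I * x * ζ))
      (Complex.exp (Complex.I * x * ζ) * (Complex.I * ζ)) x := by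
  have h : HasDerivAt (fun x : ℝ => Complex.I * x * ζ) (Complex.I * ζ) x := by
    simpa using ((Complex.ofRealCLM.hasDerivAt (x := x)).const_mul Complex.I).mul_const ζ
  exact h.cexp

/-- The logarithmic amplitude `x ^ n (log x · g x + k x)`. -/
noncomputable def logAmplitude (n : ℕ) (g k : ℝ → ℝ) (x : ℝ) : ℝ :=
  x ^ n * (Real.log x * g x + k x)

/-- Differentiation keeps the form of the amplitude and lowers the power by one. Differentiating the
logarithm moves `g` into the part without logarithm, which is why a second function `k` is carried
along. -/
theorem hasDerivAt_logAmplitude_succ {n : ℕ} {g k : ℝ → ℝ} (hg : Differentiable ℝ g)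
    (hk : Differentiable ℝ k) {x : ℝ} (hx : 0 < x) :
    HasDerivAt (logAmplitude (n + 1) g k)
      (logAmplitude n (fun x => (n + 1) * g x + x * deriv g x)
        (fun x => g x + ((n + 1) * k x + x * deriv k x)) x) x := by
  have h := (hasDerivAt_pow (n + 1) x).mul
    (((Real.hasDerivAt_log hx.ne').mul (hg x).hasDerivAt).add (hk x).hasDerivAt)
  refine h.congr_deriv ?_
  simp only [logAmplitude]
  push_cast
  field_simp
  simp
  ring

theorem continuous_logAmplitude_succ {n : ℕ} {g k : ℝ → ℝ} (hg : Continuous g)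
    (hk : Continuous k) : Continuous (logAmplitude (n + 1) g k) := by
  have : logAmplitude (n + 1) g k =
      fun x => x ^ n * ((x * Real.log x) * g x) + x ^ (n + 1) * k x := by
    ext x; simp only [logAmplitude]; ring
  rw [this]
  have := Real.continuous_mul_log
  fun_prop

theorem intervalIntegrable_logAmplitude {n : ℕ} {g k : ℝ → ℝ} (hg : Continuous g)
    (hk : Continuous k) (a b : ℝ) : IntervalIntegrable (logAmplitude n g k) volume a b := by
  have h : IntervalIntegrable (fun x => Real.log x * g x + k x) volume a b :=
    ((intervalIntegral.intervalIntegrable_log').mul_continuousOn hg.continuousOn).add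
      (hk.intervalIntegrable _ _)
  exact h.continuousOn_mul (f := fun x => Real.log x * g x + k x) (g := fun x => x ^ n)
    (by fun_prop)

/-- The half-line Fourier–Laplace transform of a logarithmic amplitude on `[0, R]`. -/
noncomputable def logTransform (n : ℕ) (g k : ℝ → ℝ) (R : ℝ) (ζ : ℂ) : ℂ :=
  ∫ x in (0 : ℝ)..R, (logAmplitude n g k x : ℂ) * Complex.exp (Complex.I * x * ζ)

theorem intervalIntegrable_logAmplitude_mul_exp {n : ℕ} {g k : ℝ → ℝ} (hg : Continuous g)
    (hk : Continuous k) (a b : ℝ) (ζ : ℂ) :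
    IntervalIntegrable (fun x => (logAmplitude n g k x : ℂ) * Complex.exp (Complex.I * x * ζ))
      volume a b :=
  have h := intervalIntegrable_logAmplitude (n := n) hg hk a b
  IntervalIntegrable.mul_continuousOn
    (f := fun x => (logAmplitude n g k x : ℂ)) ⟨h.1.ofReal, h.2.ofReal⟩ (by fun_prop)

/-- Integration by parts. The boundary term at `0` dies because of the positive power of `x` (with
`log 0 = 0` in the formal value), the one at `R` because `g` and `k` vanish there. -/
theorem logTransform_succ {n : ℕ} {g k : ℝ → ℝ} (hg : ContDiff ℝ ∞ g) (hk : ContDiff ℝ ∞ k)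
    {R : ℝ} (hR : 0 ≤ R) (hgR : g R = 0) (hkR : k R = 0) (ζ : ℂ) :
    (Complex.I * ζ) * logTransform (n + 1) g k R ζ =
      -logTransform n (fun x => (n + 1) * g x + x * deriv g x)
        (fun x => g x + ((n + 1) * k x + x * deriv k x)) R ζ := by
  have hg' : Continuous (deriv g) := hg.continuous_deriv (by simp)
  have hk' : Continuous (deriv k) := hk.continuous_deriv (by simp)
  have hgc := hg.continuous
  have hkc := hk.continuous
  have i1 := intervalIntegrable_logAmplitude_mul_exp (n := n + 1) hgc hkc 0 R ζ
  have i2 := intervalIntegrable_logAmplitude_mul_exp (n := n)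
    (g := fun x => (n + 1) * g x + x * deriv g x)
    (k := fun x => g x + ((n + 1) * k x + x * deriv k x)) (by fun_prop) (by fun_prop) 0 R ζ
  have hd := intervalIntegral.integral_eq_sub_of_hasDerivAt_of_le hR
    (f := fun x => (logAmplitude (n + 1) g k x : ℂ) * Complex.exp (Complex.I * x * ζ))
    (f' := fun x => (logAmplitude n (fun x => (n + 1) * g x + x * deriv g x)
        (fun x => g x + ((n + 1) * k x + x * deriv k x)) x : ℂ) * Complex.exp (Complex.I * x * ζ) +
        (Complex.I * ζ) *
          ((logAmplitude (n + 1) g k x : ℂ) * Complex.exp (Complex.I * x * ζ)))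
    (by
      have := continuous_logAmplitude_succ (n := n) hgc hkc
      fun_prop)
    (fun x hx => by
      refine ((hasDerivAt_logAmplitude_succ (n := n) (hg.differentiable (by simp))
        (hk.differentiable (by simp)) hx.1).ofReal_comp.mul
        (hasDerivAt_exp_I_mul x ζ)).congr_deriv ?_
      ring)
    (i2.add (i1.const_mul _))
  rw [intervalIntegral.integral_add i2 (i1.const_mul _),
    intervalIntegral.integral_const_mul] at hd
  simp only [logAmplitude, hgR, hkR] at hd
  simp only [logTransform, logAmplitude]
  simp at hd
  push_cast at hd ⊢
  linear_combination hd

theorem exists_bound_on_Icc {g : ℝ → ℝ} (hg : Continuous g) (R : ℝ) :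
    ∃ C, 0 ≤ C ∧ ∀ x ∈ Icc 0 R, |g x| ≤ C := by
  obtain ⟨C, hC⟩ := (isCompact_Icc (a := 0) (b := R)).exists_bound_of_continuousOn hg.continuousOn
  exact ⟨|C|, abs_nonneg _, fun x hx => (hC x hx).trans (le_abs_self C)⟩

/-- For `n = 0` the derivative of the amplitude has size `1/x` at the origin, so the integral is cut
at `η = 1/|ζ|`. Below the cut the amplitude is `O(x^{-ε})`, contributing `η^{1-ε}`; above it one
integration by parts, with derivative `O(x^{-1-ε})`, gives `η · η^{-ε}`. -/
theorem norm_logTransform_zero_le {ε : ℝ} (hε : 0 < ε) (hε1 : ε < 1) {g k : ℝ → ℝ}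
    (hg : ContDiff ℝ ∞ g) (hk : ContDiff ℝ ∞ k) {R : ℝ} (hR : 1 ≤ R) (hgR : g R = 0)
    (hkR : k R = 0) :
    ∃ C, ∀ ζ : ℂ, 0 ≤ ζ.im → 1 ≤ ‖ζ‖ → ‖logTransform 0 g k R ζ‖ ≤ C * ‖ζ‖ ^ (-(1 - ε)) := by
  have hg' : Continuous (deriv g) := hg.continuous_deriv (by simp)
  have hk' : Continuous (deriv k) := hk.continuous_deriv (by simp)
  have hgc := hg.continuous
  have hkc := hk.continuous
  obtain ⟨L, hL0, hL⟩ := abs_log_le_const_mul_rpow_neg (R := R) hε (by linarith)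
  obtain ⟨G, hG0, hG⟩ := exists_bound_on_Icc hgc R
  obtain ⟨G', hG'0, hG'⟩ := exists_bound_on_Icc hg' R
  obtain ⟨H, hH0, hH⟩ := exists_bound_on_Icc hkc R
  obtain ⟨H', hH'0, hH'⟩ := exists_bound_on_Icc hk' R
  have hamp : ∀ x, 0 < x → x ≤ R →
      |logAmplitude 0 g k x| ≤ (L * G + H * R ^ ε) * x ^ (-ε) := by
    intro x hx hxR
    have e1 : 1 ≤ R ^ ε * x ^ (-ε) := by
      rw [Real.rpow_neg hx.le, ← div_eq_mul_inv, one_le_div (by positivity)]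
      gcongr
    simp only [logAmplitude, pow_zero, one_mul]
    calc |Real.log x * g x + k x| ≤ |Real.log x| * |g x| + |k x| := by
          rw [← abs_mul]; exact abs_add_le _ _
      _ ≤ (L * x ^ (-ε)) * G + H * (R ^ ε * x ^ (-ε)) := by
          gcongr
          · exact hL x hx hxR
          · exact hG x ⟨hx.le, hxR⟩
          · exact (hH x ⟨hx.le, hxR⟩).trans (le_mul_of_one_le_right hH0 e1)
      _ = _ := by ring
  set A := L * G + H * R ^ ε with hA
  have hA0 : 0 ≤ A := by positivity
  set dA : ℝ → ℝ := fun x => x⁻¹ * g x + Real.log x * deriv g x + deriv k x with hdA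
  set A' := (G + L * R * G' + H' * R) * R ^ ε + L * R * G' with hA'
  have hA'0 : 0 ≤ A' := by positivity
  have hder : ∀ x, 0 < x → x ≤ R → |dA x| ≤ A' * x ^ (-1 - ε) := by
    intro x hx hxR
    have e1 : 1 ≤ R ^ ε * x ^ (-ε) := by
      rw [Real.rpow_neg hx.le, ← div_eq_mul_inv, one_le_div (by positivity)]
      gcongr
    have e2 : 1 ≤ R * x⁻¹ := by
      rw [← div_eq_mul_inv, one_le_div (by positivity)]; exact hxR
    have e3 : x ^ (-1 - ε) = x⁻¹ * x ^ (-ε) := by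
      rw [sub_eq_add_neg, Real.rpow_add hx, Real.rpow_neg_one]
    have hx0 : 0 ≤ x ^ (-ε) := by positivity
    calc |dA x| ≤ |x⁻¹ * g x| + |Real.log x * deriv g x| + |deriv k x| := abs_add_three _ _ _
      _ ≤ x⁻¹ * G * (R ^ ε * x ^ (-ε)) + (L * x ^ (-ε)) * G' * (R * x⁻¹)
            + H' * (R * x⁻¹) * (R ^ ε * x ^ (-ε)) := by
          have m : x ∈ Icc 0 R := ⟨hx.le, hxR⟩
          gcongr
          · rw [abs_mul, abs_of_pos (inv_pos.2 hx)]
            refine le_trans ?_ (le_mul_of_one_le_right (by positivity) e1)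
            gcongr; exact hG x m
          · rw [abs_mul]
            refine le_trans ?_ (le_mul_of_one_le_right (by positivity) e2)
            gcongr
            · exact hL x hx hxR
            · exact hG' x m
          · refine le_trans ?_ (le_mul_of_one_le_right (by positivity) e1)
            exact (hH' x m).trans (le_mul_of_one_le_right (by positivity) e2)
      _ = ((G + H' * R) * R ^ ε + L * R * G') * (x⁻¹ * x ^ (-ε)) := by ring
      _ ≤ A' * (x⁻¹ * x ^ (-ε)) := by
          have : 0 ≤ L * R * G' * R ^ ε := by positivity
          gcongr
          rw [hA']; nlinarith
      _ = _ := by rw [e3]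
  -- The three terms come from `[0, η]`, from the boundary term at `η`, and from the integral of the
  -- derivative over `[η, R]`.
  refine ⟨A / (1 - ε) + (A + A' / ε), fun ζ hζ hζ1 => ?_⟩
  have hζ0 : 0 < ‖ζ‖ := by linarith
  set η := ‖ζ‖⁻¹ with hη
  have hη0 : 0 < η := by positivity
  have hη1 : η ≤ 1 := inv_le_one_of_one_le₀ hζ1
  have hηR : η ≤ R := hη1.trans hR
  have hpow : ‖ζ‖ ^ (-(1 - ε)) = η ^ (1 - ε) := by
    rw [hη, Real.inv_rpow hζ0.le, Real.rpow_neg hζ0.le]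
  have hsplit : logTransform 0 g k R ζ =
      (∫ x in (0 : ℝ)..η, (logAmplitude 0 g k x : ℂ) * Complex.exp (Complex.I * x * ζ)) +
      ∫ x in η..R, (logAmplitude 0 g k x : ℂ) * Complex.exp (Complex.I * x * ζ) :=
    (intervalIntegral.integral_add_adjacent_intervals
      (intervalIntegrable_logAmplitude_mul_exp hgc hkc _ _ _)
      (intervalIntegrable_logAmplitude_mul_exp hgc hkc _ _ _)).symm
  have hlow : ‖∫ x in (0 : ℝ)..η, (logAmplitude 0 g k x : ℂ) *
      Complex.exp (Complex.I * x * ζ)‖ ≤ A / (1 - ε) * η ^ (1 - ε) := by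
    calc _ ≤ ∫ x in (0 : ℝ)..η, A * x ^ (-ε) := by
          refine intervalIntegral.norm_integral_le_of_norm_le hη0.le ?_ ?_
          · refine Filter.Eventually.of_forall fun x hx => ?_
            rw [norm_mul, Complex.norm_real]
            calc _ ≤ (A * x ^ (-ε)) * 1 :=
                  mul_le_mul (hamp x hx.1 (hx.2.trans hηR)) (norm_exp_I_mul_le_one hx.1.le hζ)
                    (norm_nonneg _) (mul_nonneg hA0 (Real.rpow_nonneg hx.1.le _))
              _ = _ := mul_one _
          · exact (intervalIntegral.intervalIntegrable_rpow' (by linarith)).const_mul _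
      _ = _ := by
          rw [intervalIntegral.integral_const_mul, integral_rpow (Or.inl (by linarith)),
            Real.zero_rpow (by linarith), show -ε + 1 = 1 - ε by ring]
          ring
  have hcont : ContinuousOn dA (Icc η R) := by
    have h1 : ContinuousOn (fun x : ℝ => x⁻¹) (Icc η R) :=
      continuousOn_inv₀.mono fun x hx => (hη0.trans_le hx.1).ne'
    have h2 : ContinuousOn Real.log (Icc η R) :=
      Real.continuousOn_log.mono fun x hx => (hη0.trans_le hx.1).ne'
    exact ((h1.mul hgc.continuousOn).add (h2.mul hg'.continuousOn)).add hk'.continuousOn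
  have i1 := intervalIntegrable_logAmplitude_mul_exp (n := 0) hgc hkc η R ζ
  have i2 : IntervalIntegrable (fun x => (dA x : ℂ) * Complex.exp (Complex.I * x * ζ))
      volume η R := by
    refine ContinuousOn.intervalIntegrable ?_
    rw [uIcc_of_le hηR]
    exact (Complex.continuous_ofReal.comp_continuousOn hcont).mul (by fun_prop)
  have hd := intervalIntegral.integral_eq_sub_of_hasDerivAt
    (f := fun x => (logAmplitude 0 g k x : ℂ) * Complex.exp (Complex.I * x * ζ))
    (f' := fun x => (dA x : ℂ) * Complex.exp (Complex.I * x * ζ) + (Complex.I * ζ) *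
          ((logAmplitude 0 g k x : ℂ) * Complex.exp (Complex.I * x * ζ))) (a := η) (b := R)
    (fun x hx => by
      rw [uIcc_of_le hηR] at hx
      have hx0 : 0 < x := hη0.trans_le hx.1
      have h : HasDerivAt (logAmplitude 0 g k) (dA x) x := by
        have := ((Real.hasDerivAt_log hx0.ne').mul
          ((hg.differentiable (by simp)) x).hasDerivAt).add
          ((hk.differentiable (by simp)) x).hasDerivAt
        refine HasDerivAt.congr_of_eventuallyEq this (Filter.Eventually.of_forall fun y => ?_)
        simp [logAmplitude]
      refine (h.ofReal_comp.mul (hasDerivAt_exp_I_mul x ζ)).congr_deriv ?_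
      ring)
    (i2.add (i1.const_mul _))
  rw [intervalIntegral.integral_add i2 (i1.const_mul _),
    intervalIntegral.integral_const_mul] at hd
  have hRz : logAmplitude 0 g k R = 0 := by simp [logAmplitude, hgR, hkR]
  rw [hRz] at hd
  have hd2 : ‖∫ x in η..R, (dA x : ℂ) * Complex.exp (Complex.I * x * ζ)‖ ≤ A' / ε * η ^ (-ε) := by
    calc _ ≤ ∫ x in η..R, A' * x ^ (-1 - ε) := by
          refine intervalIntegral.norm_integral_le_of_norm_le hηR ?_ ?_
          · refine Filter.Eventually.of_forall fun x hx => ?_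
            have hx0 : 0 < x := hη0.trans hx.1
            rw [norm_mul, Complex.norm_real]
            calc _ ≤ (A' * x ^ (-1 - ε)) * 1 :=
                  mul_le_mul (hder x hx0 hx.2) (norm_exp_I_mul_le_one hx0.le hζ)
                    (norm_nonneg _) (mul_nonneg hA'0 (Real.rpow_nonneg hx0.le _))
              _ = _ := mul_one _
          · refine (ContinuousOn.intervalIntegrable ?_).const_mul _
            rw [uIcc_of_le hηR]
            exact fun x hx => (Real.continuousAt_rpow_const _ _
              (Or.inl (hη0.trans_le hx.1).ne')).continuousWithinAt
      _ = A' / ε * (η ^ (-ε) - R ^ (-ε)) := by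
          rw [intervalIntegral.integral_const_mul, integral_rpow (Or.inr ⟨by linarith, by
            rw [uIcc_of_le hηR]; exact fun h => absurd h.1 (by linarith)⟩),
            show -1 - ε + 1 = -ε by ring]
          field_simp
          ring
      _ ≤ A' / ε * η ^ (-ε) := by
          have : 0 ≤ R ^ (-ε) := by positivity
          gcongr
          linarith
  have hbd : ‖(logAmplitude 0 g k η : ℂ) * Complex.exp (Complex.I * η * ζ)‖ ≤ A * η ^ (-ε) := by
    rw [norm_mul, Complex.norm_real]
    calc _ ≤ (A * η ^ (-ε)) * 1 := mul_le_mul (hamp η hη0 hηR)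
          (norm_exp_I_mul_le_one hη0.le hζ) (norm_nonneg _) (by positivity)
      _ = _ := mul_one _
  have hhigh : ‖∫ x in η..R, (logAmplitude 0 g k x : ℂ) * Complex.exp (Complex.I * x * ζ)‖ ≤
      (A + A' / ε) * η ^ (1 - ε) := by
    set X := ∫ x in η..R, (logAmplitude 0 g k x : ℂ) * Complex.exp (Complex.I * x * ζ)
    have e : Complex.I * ζ * X = -((logAmplitude 0 g k η : ℂ) * Complex.exp (Complex.I * η * ζ))
        - ∫ x in η..R, (dA x : ℂ) * Complex.exp (Complex.I * x * ζ) := by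
      simp only [Complex.ofReal_zero, zero_mul, zero_sub] at hd
      linear_combination hd
    have e2 : ‖ζ‖ * ‖X‖ ≤ (A + A' / ε) * η ^ (-ε) := by
      have : ‖ζ‖ * ‖X‖ = ‖Complex.I * ζ * X‖ := by simp
      rw [this, e]
      refine (norm_sub_le _ _).trans ?_
      rw [norm_neg]
      linarith
    have e3 : ‖X‖ = η * (‖ζ‖ * ‖X‖) := by rw [hη]; field_simp
    rw [e3, sub_eq_add_neg, Real.rpow_add hη0, Real.rpow_one]
    nlinarith
  rw [hsplit, hpow]
  refine (norm_add_le _ _).trans ?_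
  linarith

/-- Each integration by parts gains a factor `1/|ζ|`. Vanishing in a neighbourhood of `R`, rather
than at `R`, is what passes to the derivatives in the induction. -/
theorem norm_logTransform_le {ε : ℝ} (hε : 0 < ε) (hε1 : ε < 1) {R : ℝ} (hR : 1 ≤ R) (n : ℕ) :
    ∀ {g k : ℝ → ℝ}, ContDiff ℝ ∞ g → ContDiff ℝ ∞ k → g =ᶠ[nhds R] 0 → k =ᶠ[nhds R] 0 →
    ∃ C, ∀ ζ : ℂ, 0 ≤ ζ.im → 1 ≤ ‖ζ‖ →
      ‖logTransform n g k R ζ‖ ≤ C * ‖ζ‖ ^ (-(n + 1 - ε)) := by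
  induction n with
  | zero =>
    intro g k hg hk hgR hkR
    simpa using norm_logTransform_zero_le hε hε1 hg hk hR hgR.eq_of_nhds hkR.eq_of_nhds
  | succ n ih =>
    intro g k hg hk hgR hkR
    have hg' : ContDiff ℝ ∞ (deriv g) := (contDiff_infty_iff_deriv.1 hg).2
    have hk' : ContDiff ℝ ∞ (deriv k) := (contDiff_infty_iff_deriv.1 hk).2
    have hgR' : deriv g =ᶠ[nhds R] 0 := by simpa using hgR.deriv
    have hkR' : deriv k =ᶠ[nhds R] 0 := by simpa using hkR.deriv
    obtain ⟨C, hC⟩ := ih (g := fun x => (n + 1) * g x + x * deriv g x)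
      (k := fun x => g x + ((n + 1) * k x + x * deriv k x)) (by fun_prop) (by fun_prop)
      (by filter_upwards [hgR, hgR'] with x h1 h2; simp [h1, h2])
      (by filter_upwards [hgR, hkR, hkR'] with x h1 h2 h3; simp [h1, h2, h3])
    refine ⟨C, fun ζ hζ hζ1 => ?_⟩
    have hζ0 : 0 < ‖ζ‖ := by linarith
    have h := congrArg norm (logTransform_succ (n := n) hg hk (by linarith : (0 : ℝ) ≤ R)
      hgR.eq_of_nhds hkR.eq_of_nhds ζ)
    rw [norm_neg, norm_mul, norm_mul, Complex.norm_I, one_mul] at h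
    have h2 := hC ζ hζ hζ1
    rw [← h] at h2
    have e : ‖ζ‖ ^ (-((n + 1 : ℕ) + 1 - ε : ℝ)) = ‖ζ‖⁻¹ * ‖ζ‖ ^ (-(n + 1 - ε : ℝ)) := by
      rw [← Real.rpow_neg_one, ← Real.rpow_add hζ0]
      congr 1; push_cast; ring
    rw [e]
    calc _ = ‖ζ‖⁻¹ * (‖ζ‖ * ‖logTransform (n + 1) g k R ζ‖) := by field_simp
      _ ≤ ‖ζ‖⁻¹ * (C * ‖ζ‖ ^ (-(n + 1 - ε : ℝ))) := by gcongr
      _ = _ := by ring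

/-- Decay of the Fourier–Laplace transform of `x ^ n log x · g x` in the closed upper half plane. -/
theorem norm_logTransform_le_one_add {ε : ℝ} (hε : 0 < ε) (hε1 : ε < 1) {R : ℝ} (hR : 1 ≤ R)
    (n : ℕ) {g k : ℝ → ℝ} (hg : ContDiff ℝ ∞ g) (hk : ContDiff ℝ ∞ k) (hgR : g =ᶠ[nhds R] 0)
    (hkR : k =ᶠ[nhds R] 0) :
    ∃ C, 0 ≤ C ∧ ∀ ζ : ℂ, 0 ≤ ζ.im →
      ‖logTransform n g k R ζ‖ ≤ C * (1 + ‖ζ‖) ^ (-(n + 1 - ε)) := by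
  obtain ⟨C, hC⟩ := norm_logTransform_le hε hε1 hR n hg hk hgR hkR
  have hN : (0 : ℝ) ≤ n + 1 - ε := by
    have : (0 : ℝ) ≤ n := n.cast_nonneg
    linarith
  set N : ℝ := n + 1 - ε
  set I0 := ∫ x in (0 : ℝ)..R, |logAmplitude n g k x| with hI0
  have hI0n : 0 ≤ I0 := intervalIntegral.integral_nonneg (by linarith) fun _ _ => abs_nonneg _
  -- `C` serves `|ζ| ≥ 1` and the trivial bound `I0` serves `|ζ| ≤ 1`; the factor `2 ^ N` comes from
  -- `1 + |ζ| ≤ 2 max(1, |ζ|)`.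
  refine ⟨(|C| + I0) * 2 ^ N, by positivity, fun ζ hζ => ?_⟩
  have hb : ‖logTransform n g k R ζ‖ ≤ I0 := by
    refine intervalIntegral.norm_integral_le_of_norm_le (by linarith) ?_
      (intervalIntegrable_logAmplitude hg.continuous hk.continuous _ _).abs
    refine Filter.Eventually.of_forall fun x hx => ?_
    rw [norm_mul, Complex.norm_real]
    exact mul_le_of_le_one_right (norm_nonneg _) (norm_exp_I_mul_le_one hx.1.le hζ)
  have key : ∀ a : ℝ, 0 < a → 1 + ‖ζ‖ ≤ 2 * a → a ^ (-N) ≤ 2 ^ N * (1 + ‖ζ‖) ^ (-N) := by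
    intro a ha h2
    rw [Real.rpow_neg ha.le, Real.rpow_neg (by positivity), ← div_eq_mul_inv,
      le_div_iff₀ (by positivity), inv_mul_le_iff₀ (by positivity), ← Real.mul_rpow ha.le (by simp)]
    gcongr
    linarith
  rcases le_total 1 ‖ζ‖ with h | h
  · have h1 := key ‖ζ‖ (by linarith) (by linarith)
    calc _ ≤ C * ‖ζ‖ ^ (-N) := hC ζ hζ h
      _ ≤ (|C| + I0) * (2 ^ N * (1 + ‖ζ‖) ^ (-N)) := by
          gcongr
          linarith [le_abs_self C]
      _ = _ := by ring
  · have h1 := key 1 one_pos (by linarith)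
    rw [Real.one_rpow] at h1
    calc _ ≤ (|C| + I0) * 1 := by linarith [abs_nonneg C]
      _ ≤ (|C| + I0) * (2 ^ N * (1 + ‖ζ‖) ^ (-N)) := by gcongr
      _ = _ := by ring

/-! ### Contour rotation for the Hankel profile. -/

theorem integral_mul_exp_neg_mul_Ioi {u : ℝ} (hu : 0 < u) :
    ∫ t in Ioi (0 : ℝ), t * Real.exp (-(u * t)) = (u ^ 2)⁻¹ := by
  have h := Real.integral_rpow_mul_exp_neg_mul_Ioi (a := 2) (by norm_num) hu
  rw [show (2 : ℝ) - 1 = 1 by norm_num] at h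
  simpa using h

theorem integral_exp_neg_mul_Ioi_zero {u : ℝ} (hu : 0 < u) :
    ∫ t in Ioi (0 : ℝ), Real.exp (-(u * t)) = u⁻¹ := by
  have h := Real.integral_rpow_mul_exp_neg_mul_Ioi (a := 1) (by norm_num) hu
  simpa using h

theorem integrableOn_mul_exp_neg_mul_Ioi {u : ℝ} (hu : 0 < u) :
    IntegrableOn (fun t => t * Real.exp (-(u * t))) (Ioi 0) := by
  -- A non-integrable function has integral `0` by convention, which contradicts the computed
  -- positive value.
  by_contra h
  have := integral_mul_exp_neg_mul_Ioi hu
  rw [integral_undef h] at this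
  exact (inv_pos.2 (pow_pos hu 2)).ne this

theorem integrableOn_exp_neg_mul_Ioi_zero {u : ℝ} (hu : 0 < u) :
    IntegrableOn (fun t => Real.exp (-(u * t))) (Ioi 0) := by
  by_contra h
  have := integral_exp_neg_mul_Ioi_zero hu
  rw [integral_undef h] at this
  exact (inv_pos.2 hu).ne this

theorem integrableOn_affine_mul_exp_neg_mul_Ioi (c : ℝ) {u : ℝ} (hu : 0 < u) :
    IntegrableOn (fun t => (c + t) * Real.exp (-(u * t))) (Ioi 0) := by
  simp only [add_mul]
  exact ((integrableOn_exp_neg_mul_Ioi_zero hu).const_mul c).add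
    (integrableOn_mul_exp_neg_mul_Ioi hu)

theorem integral_affine_mul_exp_neg_mul_Ioi (c : ℝ) {u : ℝ} (hu : 0 < u) :
    ∫ t in Ioi (0 : ℝ), (c + t) * Real.exp (-(u * t)) = c * u⁻¹ + (u ^ 2)⁻¹ := by
  simp only [add_mul]
  rw [integral_add ((integrableOn_exp_neg_mul_Ioi_zero hu).const_mul c)
    (integrableOn_mul_exp_neg_mul_Ioi hu), integral_const_mul, integral_mul_exp_neg_mul_Ioi hu,
    integral_exp_neg_mul_Ioi_zero hu]

/-- The principal square root. -/
noncomputable def csqrt (z : ℂ) : ℂ := z ^ ((1 / 2 : ℝ) : ℂ)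

theorem norm_csqrt (z : ℂ) : ‖csqrt z‖ = Real.sqrt ‖z‖ := by
  rw [csqrt, Complex.norm_cpow_real, Real.sqrt_eq_rpow]

/-- The closed right half plane meets the branch cut only at `0`, where the positive exponent gives
continuity. The rotated contour passes through this branch point. -/
theorem continuousAt_csqrt {z : ℂ} (hz : 0 ≤ z.re) : ContinuousAt csqrt z :=
  Complex.continuousAt_cpow_const_of_re_pos (Or.inl hz) (by simp)

theorem measurable_csqrt : Measurable csqrt := measurable_id.pow_const _

theorem csqrt_ofReal {x : ℝ} (hx : 0 ≤ x) : csqrt x = Real.sqrt x := by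
  rw [csqrt, ← Complex.ofReal_cpow hx, Real.sqrt_eq_rpow]

theorem csqrt_conj {z : ℂ} (hz : 0 < z.re) :
    csqrt ((starRingEnd ℂ) z) = (starRingEnd ℂ) (csqrt z) := by
  rw [csqrt, csqrt, Complex.conj_cpow _ _ (by
    intro h
    rw [Complex.arg_eq_pi_iff] at h
    linarith [h.1]), Complex.conj_ofReal]

/-- The weight `√(t² - 2 i t)`, the value of `√(1 - z²)` at `z = 1 + i t`. -/
noncomputable def hankelWeight (t : ℝ) : ℂ :=
  csqrt (-(t * Complex.I)) * csqrt (2 + t * Complex.I)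

theorem measurable_hankelWeight : Measurable hankelWeight := by
  unfold hankelWeight
  have := measurable_csqrt
  fun_prop

theorem norm_csqrt_mul_csqrt_le {z w : ℂ} {a : ℝ} (ha : 0 ≤ a) (hz : ‖z‖ ≤ a) (hw : ‖w‖ ≤ a) :
    ‖csqrt z * csqrt w‖ ≤ a := by
  rw [norm_mul, norm_csqrt, norm_csqrt]
  calc _ ≤ Real.sqrt a * Real.sqrt a := by gcongr
    _ = a := Real.mul_self_sqrt ha

theorem norm_hankelWeight_le {t : ℝ} (ht : 0 ≤ t) :
    ‖hankelWeight t‖ ≤ 2 * (Real.sqrt t + t) := by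
  have h1 : ‖-(t * Complex.I)‖ = t := by simp [abs_of_nonneg ht]
  have h2 : ‖2 + t * Complex.I‖ ≤ 2 + t := by
    refine (norm_add_le _ _).trans ?_
    simp [abs_of_nonneg ht]
  rw [hankelWeight, norm_mul, norm_csqrt, norm_csqrt, h1]
  have h3 : Real.sqrt ‖2 + t * Complex.I‖ ≤ 2 + Real.sqrt t := by
    rw [Real.sqrt_le_left (by positivity)]
    nlinarith [Real.sq_sqrt ht, Real.sqrt_nonneg t]
  calc _ ≤ Real.sqrt t * (2 + Real.sqrt t) := by gcongr
    _ = 2 * Real.sqrt t + t := by rw [mul_add, Real.mul_self_sqrt ht]; ring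
    _ ≤ _ := by linarith

theorem norm_hankelWeight_le_affine {t : ℝ} (ht : 0 ≤ t) :
    ‖hankelWeight t‖ ≤ 4 * (1 + t) := by
  refine (norm_hankelWeight_le ht).trans ?_
  nlinarith [Real.sq_sqrt ht, sq_nonneg (Real.sqrt t - 1)]

/-- The function `i ∫₀¹ √(1-t²) e^{iut} dt + ∫₀^∞ √(1+t²) e^{-ut} dt`, a multiple of
`H₁⁽¹⁾(u) / u`. -/
noncomputable def hankelB (u : ℝ) : ℂ :=
  Complex.I * (∫ t in (0 : ℝ)..1, (Real.sqrt (1 - t ^ 2) : ℂ) * Complex.exp (Complex.I * u * t)) +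
    ((∫ t in Ioi (0 : ℝ), Real.exp (-(u * t)) * Real.sqrt (1 + t ^ 2) : ℝ) : ℂ)

/-- Rotating the contour in Poisson's integral. -/
theorem hankelB_eq_integral {u : ℝ} (hu : 0 < u) :
    hankelB u = ∫ t in Ioi (0 : ℝ), hankelWeight t *
      Complex.exp (Complex.I * u * (1 + t * Complex.I)) := by
  -- In the strip `0 ≤ Re z ≤ 1` both `1 - z` and `1 + z` have nonnegative real part. With the root
  -- split in this way, `F` is holomorphic inside and continuous up to the edges, the corner `z = 1`
  -- included.
  set F : ℂ → ℂ := fun z => csqrt (1 - z) * csqrt (1 + z) * Complex.exp (Complex.I * u * z)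
    with hF
  have hFc : ∀ z : ℂ, 0 ≤ z.re → z.re ≤ 1 → ContinuousAt F z := by
    intro z h0 h1
    have c1 : ContinuousAt (fun z => csqrt (1 - z)) z :=
      ContinuousAt.comp (f := fun z : ℂ => 1 - z) (continuousAt_csqrt (by simpa using h1))
        (by fun_prop)
    have c2 : ContinuousAt (fun z => csqrt (1 + z)) z :=
      ContinuousAt.comp (f := fun z : ℂ => 1 + z)
        (continuousAt_csqrt (by simp; linarith)) (by fun_prop)
    exact (c1.mul c2).mul (by fun_prop)
  have hFd : ∀ z : ℂ, 0 < z.re → z.re < 1 → DifferentiableAt ℂ F z := by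
    intro z h0 h1
    have c1 : DifferentiableAt ℂ (fun z => csqrt (1 - z)) z :=
      DifferentiableAt.cpow_const (by fun_prop) (Or.inl (by simpa using h1))
    have c2 : DifferentiableAt ℂ (fun z => csqrt (1 + z)) z :=
      DifferentiableAt.cpow_const (by fun_prop) (Or.inl (by simp; linarith))
    exact (c1.mul c2).mul (by fun_prop)
  -- Cauchy's theorem on `[0, 1] × [0, Y]`. As `Y → ∞` the top edge is `O((2 + Y) e^{-uY})` and
  -- disappears.
  have hrect : ∀ Y : ℝ, 0 ≤ Y →
      (∫ x in (0 : ℝ)..1, F x) - (∫ x in (0 : ℝ)..1, F (x + Y * Complex.I)) +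
        Complex.I * (∫ y in (0 : ℝ)..Y, F (1 + y * Complex.I)) -
        Complex.I * (∫ y in (0 : ℝ)..Y, F (y * Complex.I)) = 0 := by
    intro Y hY
    have h := Complex.integral_boundary_rect_eq_zero_of_continuousOn_of_differentiableOn F 0
      (1 + Y * Complex.I) (fun z hz => by
        have := hz.1
        simp at this
        exact (hFc z this.1 this.2).continuousWithinAt)
      (fun z hz => by
        have := hz.1
        simp at this
        exact (hFd z this.1 this.2).differentiableWithinAt)
    simpa using h
  have hnormF : ∀ x y : ℝ, 0 ≤ x → x ≤ 1 → 0 ≤ y →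
      ‖F (x + y * Complex.I)‖ ≤ (2 + y) * Real.exp (-(u * y)) := by
    intro x y hx0 hx1 hy
    have e : ‖Complex.exp (Complex.I * u * (x + y * Complex.I))‖ = Real.exp (-(u * y)) := by
      rw [Complex.norm_exp]; congr 1; simp
    have a1 : ‖(x : ℂ) + y * Complex.I‖ ≤ 1 + y := by
      refine (norm_add_le _ _).trans ?_
      simp [abs_of_nonneg hx0, abs_of_nonneg hy, hx1]
    rw [hF]
    simp only
    rw [norm_mul, e]
    gcongr
    refine norm_csqrt_mul_csqrt_le (by positivity) ?_ ?_
    · refine (norm_sub_le _ _).trans ?_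
      simp only [norm_one]; linarith
    · refine (norm_add_le _ _).trans ?_
      simp only [norm_one]; linarith
  have hInt : ∀ x : ℝ, 0 ≤ x → x ≤ 1 →
      IntegrableOn (fun y : ℝ => F (x + y * Complex.I)) (Ioi 0) := by
    intro x hx0 hx1
    refine Integrable.mono' (integrableOn_affine_mul_exp_neg_mul_Ioi 2 hu) ?_ ?_
    · refine (ContinuousOn.aestronglyMeasurable ?_ measurableSet_Ioi)
      intro y hy
      exact (ContinuousAt.comp (f := fun y : ℝ => (x : ℂ) + y * Complex.I)
        (hFc _ (by simpa using hx0) (by simpa using hx1)) (by fun_prop)).continuousWithinAt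
    · refine (ae_restrict_mem measurableSet_Ioi).mono fun y hy => hnormF x y hx0 hx1 (le_of_lt hy)
  have hlim1 : Filter.Tendsto (fun Y : ℝ => ∫ y in (0 : ℝ)..Y, F (1 + y * Complex.I)) Filter.atTop
      (nhds (∫ y in Ioi (0 : ℝ), F (1 + y * Complex.I))) :=
    intervalIntegral_tendsto_integral_Ioi 0 (by simpa using hInt 1 zero_le_one le_rfl)
      Filter.tendsto_id
  have hlim0 : Filter.Tendsto (fun Y : ℝ => ∫ y in (0 : ℝ)..Y, F (y * Complex.I)) Filter.atTop
      (nhds (∫ y in Ioi (0 : ℝ), F (y * Complex.I))) :=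
    intervalIntegral_tendsto_integral_Ioi 0 (by simpa using hInt 0 le_rfl zero_le_one)
      Filter.tendsto_id
  have htop : Filter.Tendsto (fun Y : ℝ => ∫ x in (0 : ℝ)..1, F (x + Y * Complex.I)) Filter.atTop
      (nhds 0) := by
    have hz : Filter.Tendsto (fun Y : ℝ => (2 + Y) * Real.exp (-(u * Y))) Filter.atTop
        (nhds 0) := by
      have t1 : Filter.Tendsto (fun Y : ℝ => u * Y) Filter.atTop Filter.atTop :=
        Filter.tendsto_id.const_mul_atTop hu
      have t2 := (Real.tendsto_pow_mul_exp_neg_atTop_nhds_zero 1).comp t1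
      have t3 := (Real.tendsto_pow_mul_exp_neg_atTop_nhds_zero 0).comp t1
      have t4 := (t3.const_mul 2).add (t2.const_mul u⁻¹)
      simp only [mul_zero, add_zero] at t4
      refine t4.congr fun Y => ?_
      simp only [Function.comp]
      field_simp
    refine squeeze_zero_norm' ?_ hz
    filter_upwards [Filter.eventually_ge_atTop 0] with Y hY
    have := intervalIntegral.norm_integral_le_of_norm_le_const (a := (0 : ℝ)) (b := 1)
      (f := fun x : ℝ => F (x + Y * Complex.I)) (C := (2 + Y) * Real.exp (-(u * Y)))
      (fun x hx => by
        rw [uIoc_of_le zero_le_one] at hx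
        exact hnormF x Y hx.1.le hx.2 hY)
    simpa using this
  have hfin : (∫ x in (0 : ℝ)..1, F x) - 0 +
        Complex.I * (∫ y in Ioi (0 : ℝ), F (1 + y * Complex.I)) -
        Complex.I * (∫ y in Ioi (0 : ℝ), F (y * Complex.I)) = 0 := by
    refine tendsto_nhds_unique (((tendsto_const_nhds.sub htop).add (hlim1.const_mul _)).sub
      (hlim0.const_mul _)) ?_
    refine tendsto_const_nhds.congr' ?_
    filter_upwards [Filter.eventually_ge_atTop 0] with Y hY
    exact (hrect Y hY).symm
  have e1 : ∫ x in (0 : ℝ)..1, F x =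
      ∫ t in (0 : ℝ)..1, (Real.sqrt (1 - t ^ 2) : ℂ) * Complex.exp (Complex.I * u * t) := by
    refine intervalIntegral.integral_congr fun t ht => ?_
    rw [uIcc_of_le zero_le_one] at ht
    have h1 : (0 : ℝ) ≤ 1 - t := by linarith [ht.2]
    have h2 : (0 : ℝ) ≤ 1 + t := by linarith [ht.1]
    simp only [hF]
    have a1 := csqrt_ofReal h1
    have a2 := csqrt_ofReal h2
    push_cast at a1 a2
    rw [a1, a2, ← Complex.ofReal_mul, ← Real.sqrt_mul h1]
    congr 4; ring
  -- On the imaginary axis the two square roots are conjugate, so their product is `|1 + it| = √(1 +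
  -- t²)`.
  have e2 : ∫ y in Ioi (0 : ℝ), F (y * Complex.I) =
      ((∫ t in Ioi (0 : ℝ), Real.exp (-(u * t)) * Real.sqrt (1 + t ^ 2) : ℝ) : ℂ) := by
    rw [← integral_complex_ofReal]
    refine setIntegral_congr_fun measurableSet_Ioi fun t _ => ?_
    simp only [hF]
    have a1 : (1 : ℂ) - t * Complex.I = (starRingEnd ℂ) (1 + t * Complex.I) := by
      simp [sub_eq_add_neg]
    rw [a1, csqrt_conj (by simp), ← Complex.normSq_eq_conj_mul_self, Complex.normSq_eq_norm_sq,
      norm_csqrt, Real.sq_sqrt (norm_nonneg _)]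
    have a2 : ‖(1 : ℂ) + t * Complex.I‖ = Real.sqrt (1 + t ^ 2) := by
      rw [Complex.norm_eq_sqrt_sq_add_sq]; simp
    have a3 : Complex.I * u * (t * Complex.I) = ((-(u * t) : ℝ) : ℂ) := by
      push_cast; linear_combination (u * t : ℂ) * Complex.I_mul_I
    rw [a2, a3]
    push_cast; ring
  have e3 : ∫ y in Ioi (0 : ℝ), F (1 + y * Complex.I) = ∫ t in Ioi (0 : ℝ), hankelWeight t *
      Complex.exp (Complex.I * u * (1 + t * Complex.I)) := by
    refine setIntegral_congr_fun measurableSet_Ioi fun t _ => ?_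
    simp only [hF, hankelWeight]
    congr 3 <;> ring_nf
  rw [hankelB, ← e1, ← e2, ← e3]
  linear_combination Complex.I * hfin - (∫ y in Ioi (0 : ℝ), F (1 + y * Complex.I)) *
    Complex.I_mul_I + (∫ y in Ioi (0 : ℝ), F (y * Complex.I)) * Complex.I_mul_I

/-- Poisson's integral `∫₀¹ √(1-t²) cos (u t) dt`. -/
noncomputable def poissonJ (u : ℝ) : ℝ :=
  ∫ t in (0 : ℝ)..1, Real.sqrt (1 - t ^ 2) * Real.cos (u * t)

/-- The integrals for `Y₁` and `J₁` combine into one exponential. At `r = 0` the left side is `0` by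
the convention for division, whereas `hankelB 0` is not. -/
theorem resolventKernelPlus_eq {lam r : ℝ} (hr : r ≠ 0) :
    resolventKernelPlus lam r = (lam ^ 2 / (4 * Real.pi ^ 2) : ℝ) * hankelB (lam * r) := by
  have hexp : ∫ t in (0 : ℝ)..1, (Real.sqrt (1 - t ^ 2) : ℂ) *
      Complex.exp (Complex.I * (lam * r : ℝ) * t) =
      ((∫ t in (0 : ℝ)..1, Real.sqrt (1 - t ^ 2) * Real.cos (lam * r * t) : ℝ) : ℂ) +
      ((∫ t in (0 : ℝ)..1, Real.sqrt (1 - t ^ 2) * Real.sin (lam * r * t) : ℝ) : ℂ) *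
        Complex.I := by
    rw [← intervalIntegral.integral_ofReal, ← intervalIntegral.integral_ofReal,
      ← intervalIntegral.integral_mul_const, ← intervalIntegral.integral_add]
    · refine intervalIntegral.integral_congr fun t _ => ?_
      rw [show Complex.I * (lam * r : ℝ) * t = ((lam * r * t : ℝ) : ℂ) * Complex.I by
        push_cast; ring, Complex.exp_mul_I, ← Complex.ofReal_cos, ← Complex.ofReal_sin]
      push_cast; ring
    · exact Continuous.intervalIntegrable (by fun_prop) _ _
    · exact Continuous.intervalIntegrable (by fun_prop) _ _
  rw [resolventKernelPlus, hankelB, hexp, besselY1, besselJ1]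
  generalize (∫ t in (0 : ℝ)..1, Real.sqrt (1 - t ^ 2) * Real.cos (lam * r * t)) = c
  generalize (∫ t in (0 : ℝ)..1, Real.sqrt (1 - t ^ 2) * Real.sin (lam * r * t)) = s
  generalize (∫ t in Ioi (0 : ℝ), Real.exp (-(lam * r * t)) * Real.sqrt (1 + t ^ 2)) = e
  have hr' : (r : ℂ) ≠ 0 := by exact_mod_cast hr
  have hpi : (Real.pi : ℂ) ≠ 0 := by exact_mod_cast Real.pi_ne_zero
  push_cast
  field_simp
  ring_nf
  simp only [Complex.I_sq]
  ring

theorem resolventKernelPlus_sub_minus {lam r : ℝ} (hr : r ≠ 0) :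
    resolventKernelPlus lam r - resolventKernelMinus lam r =
      Complex.I * (lam ^ 2 / (2 * Real.pi ^ 2) * poissonJ (lam * r) : ℝ) := by
  rw [resolventKernelPlus, resolventKernelMinus, besselJ1, poissonJ]
  generalize (∫ t in (0 : ℝ)..1, Real.sqrt (1 - t ^ 2) * Real.cos (lam * r * t)) = c
  have hr' : (r : ℂ) ≠ 0 := by exact_mod_cast hr
  have hpi : (Real.pi : ℂ) ≠ 0 := by exact_mod_cast Real.pi_ne_zero
  push_cast
  field_simp
  ring

/-! ### Interchanging the spectral integral with superpositions of exponentials. -/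

theorem measurable_logAmplitude {n : ℕ} {g k : ℝ → ℝ} (hg : Continuous g) (hk : Continuous k) :
    Measurable (logAmplitude n g k) := by
  unfold logAmplitude
  exact (measurable_id.pow_const n).mul ((Real.measurable_log.mul hg.measurable).add hk.measurable)

/-- Exchanging the spectral integral with two superpositions of exponentials. -/
theorem enorm_integral_logAmplitude_mul_mul_le {g k : ℝ → ℝ} (hg : Continuous g)
    (hk : Continuous k) {R : ℝ} (hR : 0 ≤ R) {A B : Set ℝ} (hA : MeasurableSet A)
    (hB : MeasurableSet B) {q₁ q₂ ζ₁ ζ₂ : ℝ → ℂ} (hq₁ : Measurable q₁) (hq₂ : Measurable q₂)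
    (hζ₁ : Measurable ζ₁) (hζ₂ : Measurable ζ₂) {C₁ C₂ : ℝ}
    (h₁ : ∀ x ∈ Ioc 0 R, ∫⁻ a in A, ‖q₁ a * Complex.exp (Complex.I * x * ζ₁ a)‖ₑ ≤
      ENNReal.ofReal (C₁ * (x ^ 2)⁻¹))
    (h₂ : ∀ x ∈ Ioc 0 R, ∫⁻ b in B, ‖q₂ b * Complex.exp (Complex.I * x * ζ₂ b)‖ₑ ≤
      ENNReal.ofReal (C₂ * (x ^ 2)⁻¹))
    {F G : ℝ → ℝ≥0∞} (hF : Measurable F) (hG : Measurable G)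
    (hFG : ∀ a ∈ A, ∀ b ∈ B,
      ‖q₁ a‖ₑ * ‖q₂ b‖ₑ * ‖logTransform 5 g k R (ζ₁ a + ζ₂ b)‖ₑ ≤ F a * G b) :
    ‖∫ x in (0 : ℝ)..R, (logAmplitude 5 g k x : ℂ) *
      ((∫ a in A, q₁ a * Complex.exp (Complex.I * x * ζ₁ a)) *
        ∫ b in B, q₂ b * Complex.exp (Complex.I * x * ζ₂ b))‖ₑ ≤
      (∫⁻ a in A, F a) * ∫⁻ b in B, G b := by
  have hamp := measurable_logAmplitude (n := 5) hg hk
  set Ω := (volume.restrict A).prod (volume.restrict B) with hΩ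
  set J : ℝ → ℝ × ℝ → ℂ := fun x p => (logAmplitude 5 g k x : ℂ) *
    ((q₁ p.1 * Complex.exp (Complex.I * x * ζ₁ p.1)) *
      (q₂ p.2 * Complex.exp (Complex.I * x * ζ₂ p.2))) with hJ
  have hJm : Measurable (Function.uncurry J) := by
    simp only [hJ, Function.uncurry_def]
    fun_prop
  have hprod : ∀ x : ℝ, (logAmplitude 5 g k x : ℂ) *
      ((∫ a in A, q₁ a * Complex.exp (Complex.I * x * ζ₁ a)) *
        ∫ b in B, q₂ b * Complex.exp (Complex.I * x * ζ₂ b)) = ∫ p, J x p ∂Ω := by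
    intro x
    simp only [hJ]
    rw [integral_const_mul, hΩ, integral_prod_mul
      (fun a => q₁ a * Complex.exp (Complex.I * x * ζ₁ a))
      (fun b => q₂ b * Complex.exp (Complex.I * x * ζ₂ b))]
  have hInt : Integrable (Function.uncurry J) ((volume.restrict (Ioc 0 R)).prod Ω) := by
    refine ⟨hJm.aestronglyMeasurable, ?_⟩
    rw [hasFiniteIntegral_iff_enorm, lintegral_prod _ hJm.enorm.aemeasurable]
    -- Each superposition costs `x⁻²`; the power `x⁵` absorbs both and leaves an integrable
    -- amplitude of order one.
    have hle : ∀ x ∈ Ioc 0 R, ∫⁻ p, ‖Function.uncurry J (x, p)‖ₑ ∂Ω ≤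
        ENNReal.ofReal (|C₁| * |C₂|) * ‖logAmplitude 1 g k x‖ₑ := by
      intro x hx
      have hx0 : 0 < x := hx.1
      have e : ∀ p : ℝ × ℝ, ‖Function.uncurry J (x, p)‖ₑ = ‖(logAmplitude 5 g k x : ℂ)‖ₑ *
          (‖q₁ p.1 * Complex.exp (Complex.I * x * ζ₁ p.1)‖ₑ *
            ‖q₂ p.2 * Complex.exp (Complex.I * x * ζ₂ p.2)‖ₑ) := by
        intro p
        simp only [hJ, Function.uncurry_apply_pair]
        rw [enorm_mul, enorm_mul (q₁ p.1 * _)]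
      simp_rw [e]
      rw [lintegral_const_mul _ (by fun_prop), hΩ, lintegral_prod_mul
        (f := fun a => ‖q₁ a * Complex.exp (Complex.I * x * ζ₁ a)‖ₑ)
        (g := fun b => ‖q₂ b * Complex.exp (Complex.I * x * ζ₂ b)‖ₑ) (by fun_prop) (by fun_prop)]
      calc _ ≤ ‖(logAmplitude 5 g k x : ℂ)‖ₑ * (ENNReal.ofReal (C₁ * (x ^ 2)⁻¹) *
            ENNReal.ofReal (C₂ * (x ^ 2)⁻¹)) := by
            gcongr
            · exact h₁ x hx
            · exact h₂ x hx
        _ ≤ ‖(logAmplitude 5 g k x : ℂ)‖ₑ * (ENNReal.ofReal (|C₁| * (x ^ 2)⁻¹) *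
            ENNReal.ofReal (|C₂| * (x ^ 2)⁻¹)) := by
            gcongr <;> exact le_abs_self _
        _ = _ := by
            rw [← ENNReal.ofReal_mul (by positivity), ← ofReal_norm, ← ofReal_norm,
              ← ENNReal.ofReal_mul (norm_nonneg _), ← ENNReal.ofReal_mul (by positivity),
              Complex.norm_real]
            congr 1
            simp only [logAmplitude, norm_mul, norm_pow, Real.norm_of_nonneg hx0.le]
            field_simp
    calc _ ≤ ∫⁻ x in Ioc 0 R, ENNReal.ofReal (|C₁| * |C₂|) * ‖logAmplitude 1 g k x‖ₑ :=
          lintegral_mono_ae ((ae_restrict_mem measurableSet_Ioc).mono hle)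
      _ < ⊤ := by
          rw [lintegral_const_mul _ (measurable_logAmplitude hg hk).enorm]
          exact ENNReal.mul_lt_top ENNReal.ofReal_lt_top
            (intervalIntegrable_logAmplitude hg hk 0 R).1.2
  rw [intervalIntegral.integral_of_le hR]
  simp_rw [hprod]
  rw [integral_integral_swap hInt]
  -- The two exponentials multiply, so the inner integral is the transform at the sum of the
  -- frequencies.
  have hinner : ∀ p : ℝ × ℝ, ∫ x in Ioc 0 R, J x p = (q₁ p.1 * q₂ p.2) *
      logTransform 5 g k R (ζ₁ p.1 + ζ₂ p.2) := by
    intro p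
    rw [logTransform, intervalIntegral.integral_of_le hR, ← integral_const_mul]
    congr 1
    ext x
    simp only [hJ]
    rw [mul_add, Complex.exp_add]
    ring
  simp_rw [hinner]
  refine (enorm_integral_le_lintegral_enorm _).trans ?_
  rw [← lintegral_prod_mul hF.aemeasurable hG.aemeasurable]
  refine lintegral_mono_ae ?_
  rw [hΩ, Measure.prod_restrict]
  filter_upwards [ae_restrict_mem (hA.prod hB)] with p hp
  rw [enorm_mul, enorm_mul]
  exact hFG p.1 hp.1 p.2 hp.2

/-- The phase `σ` does not affect absolute values and the damping is `e^{-xrt}`. The bound `x ≤ R`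
turns the resulting `x⁻¹` into `R x⁻²`, the form required by
`enorm_integral_logAmplitude_mul_mul_le`. -/
theorem lintegral_enorm_hankel_exp_le {q : ℝ → ℂ} (hq : ∀ t, 0 < t → ‖q t‖ ≤ 4 * (1 + t))
    {σ r R : ℝ} (hr : 0 < r) {x : ℝ} (hx : x ∈ Ioc 0 R) :
    ∫⁻ t in Ioi (0 : ℝ), ‖q t * Complex.exp (Complex.I * x * (σ + r * t * Complex.I))‖ₑ ≤
      ENNReal.ofReal (4 * (R * r⁻¹ + (r ^ 2)⁻¹) * (x ^ 2)⁻¹) := by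
  have hxr : 0 < x * r := mul_pos hx.1 hr
  have hx0 := hx.1
  calc _ ≤ ∫⁻ t in Ioi (0 : ℝ), ENNReal.ofReal (4 * ((1 + t) * Real.exp (-(x * r * t)))) := by
        refine setLIntegral_mono' measurableSet_Ioi fun t ht => ?_
        rw [← ofReal_norm, norm_mul, Complex.norm_exp]
        refine ENNReal.ofReal_le_ofReal ?_
        rw [← mul_assoc]
        have : (Complex.I * x * (σ + r * t * Complex.I)).re = -(x * r * t) := by
          simp; ring
        rw [this]
        gcongr
        exact hq t ht
    _ = ENNReal.ofReal (4 * ((x * r)⁻¹ + ((x * r) ^ 2)⁻¹)) := by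
        rw [← ofReal_integral_eq_lintegral_ofReal
          ((integrableOn_affine_mul_exp_neg_mul_Ioi 1 hxr).const_mul 4), integral_const_mul,
          integral_affine_mul_exp_neg_mul_Ioi 1 hxr, one_mul]
        refine (ae_restrict_mem measurableSet_Ioi).mono fun t ht => ?_
        have : (0 : ℝ) < t := ht
        show (0 : ℝ) ≤ _
        positivity
    _ ≤ _ := by
        refine ENNReal.ofReal_le_ofReal ?_
        rw [mul_assoc]
        gcongr
        rw [add_mul]
        gcongr
        · rw [mul_inv, pow_two, mul_inv]
          have : 1 ≤ R * x⁻¹ := by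
            rw [← div_eq_mul_inv, one_le_div hx0]; exact hx.2
          calc x⁻¹ * r⁻¹ ≤ (R * x⁻¹) * (x⁻¹ * r⁻¹) := le_mul_of_one_le_left (by positivity) this
            _ = _ := by ring
        · rw [mul_pow, mul_inv, mul_comm]

theorem integrableOn_one_add_rpow_Ioi {c : ℝ} (hc : c < -1) :
    IntegrableOn (fun t : ℝ => (1 + t) ^ c) (Ioi 0) := by
  have h := integrableOn_add_rpow_Ioi_of_lt (m := 1) (c := 0) hc (by norm_num)
  simpa [add_comm] using h

theorem lintegral_one_add_rpow_Ioi_lt_top {c : ℝ} (hc : c < -1) :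
    ∫⁻ t in Ioi (0 : ℝ), ENNReal.ofReal ((1 + t) ^ c) < ⊤ :=
  (integrableOn_one_add_rpow_Ioi hc).lintegral_lt_top

/-- Scaling bound for the profile `√t + t` against `(1 + t / a) ^ (-5/2)`. -/
theorem lintegral_sqrt_add_mul_rpow_le :
    ∃ C : ℝ, 0 ≤ C ∧ ∀ a : ℝ, 0 < a →
      ∫⁻ t in Ioi (0 : ℝ), ENNReal.ofReal ((Real.sqrt t + t) * (1 + t / a) ^ (-(5 / 2) : ℝ)) ≤
        ENNReal.ofReal (C * (a * (Real.sqrt a + a))) := by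
  have hi : IntegrableOn (fun t : ℝ => (1 + t) ^ (-(3 / 2) : ℝ)) (Ioi 0) :=
    integrableOn_one_add_rpow_Ioi (by norm_num)
  have hpos : ∀ t ∈ Ioi (0 : ℝ), 0 ≤ (1 + t) ^ (-(3 / 2) : ℝ) := fun t ht => by
    have : (0 : ℝ) < t := ht
    positivity
  refine ⟨2 * ∫ t in Ioi (0 : ℝ), (1 + t) ^ (-(3 / 2) : ℝ),
    mul_nonneg zero_le_two (setIntegral_nonneg measurableSet_Ioi hpos), fun a ha => ?_⟩
  have hi2 : IntegrableOn (fun t : ℝ => (1 + a⁻¹ * t) ^ (-(3 / 2) : ℝ)) (Ioi 0) := by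
    have := (integrableOn_Ioi_comp_mul_left_iff (fun t : ℝ => (1 + t) ^ (-(3 / 2) : ℝ)) 0
      (inv_pos.2 ha)).2 (by simpa using hi)
    simpa using this
  have he : ∫ t in Ioi (0 : ℝ), (1 + a⁻¹ * t) ^ (-(3 / 2) : ℝ) =
      a * ∫ t in Ioi (0 : ℝ), (1 + t) ^ (-(3 / 2) : ℝ) := by
    have := integral_comp_mul_left_Ioi (fun t : ℝ => (1 + t) ^ (-(3 / 2) : ℝ)) 0 (inv_pos.2 ha)
    simpa using this
  calc _ ≤ ∫⁻ t in Ioi (0 : ℝ), ENNReal.ofReal (2 * (Real.sqrt a + a) *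
        (1 + a⁻¹ * t) ^ (-(3 / 2) : ℝ)) := by
        refine setLIntegral_mono' measurableSet_Ioi fun t ht => ENNReal.ofReal_le_ofReal ?_
        have ht0 : (0 : ℝ) < t := ht
        set y := a⁻¹ * t with hy
        have hy0 : 0 < y := by positivity
        have hty : t = a * y := by rw [hy]; field_simp
        have e1 : t / a = y := by rw [hy]; field_simp
        have e2 : (1 + y) ^ (-(3 / 2) : ℝ) = (1 + y) * (1 + y) ^ (-(5 / 2) : ℝ) := by
          rw [← Real.rpow_one_add' (by positivity) (by norm_num)]; norm_num
        -- With `t = a y` the profile costs one power of `1 + y`; the exponent `-3/2` that is left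
        -- is still integrable.
        have e3 : Real.sqrt t + t ≤ 2 * (Real.sqrt a + a) * (1 + y) := by
          rw [hty, Real.sqrt_mul ha.le]
          have h1 : Real.sqrt y ≤ 1 + y := by
            rw [Real.sqrt_le_left (by positivity)]; nlinarith
          have h2 := Real.sqrt_nonneg a
          nlinarith [mul_le_mul_of_nonneg_left h1 h2, mul_nonneg h2 hy0.le]
        rw [e1, e2, ← mul_assoc]
        gcongr
    _ = ENNReal.ofReal (2 * (Real.sqrt a + a) *
          (a * ∫ t in Ioi (0 : ℝ), (1 + t) ^ (-(3 / 2) : ℝ))) := by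
        rw [← ofReal_integral_eq_lintegral_ofReal (hi2.const_mul _), integral_const_mul, he]
        refine (ae_restrict_mem measurableSet_Ioi).mono fun t ht => ?_
        have : (0 : ℝ) < t := ht
        show (0 : ℝ) ≤ _
        positivity
    _ = _ := by congr 1; ring

/-! ### Exponential representations and pointwise bounds of the Bessel profiles. -/

theorem poissonJ_eq_integral (u : ℝ) :
    (poissonJ u : ℂ) = ∫ t in Ioc (-1 : ℝ) 1,
      ((Real.sqrt (1 - t ^ 2) / 2 : ℝ) : ℂ) * Complex.exp (Complex.I * u * t) := by
  set f : ℝ → ℂ := fun t => ((Real.sqrt (1 - t ^ 2) / 2 : ℝ) : ℂ) *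
    Complex.exp (Complex.I * u * t) with hf
  have hfc : Continuous f := by fun_prop
  rw [← intervalIntegral.integral_of_le (by norm_num),
    ← intervalIntegral.integral_add_adjacent_intervals (b := 0) (hfc.intervalIntegrable _ _)
      (hfc.intervalIntegrable _ _)]
  have h := intervalIntegral.integral_comp_neg (a := 0) (b := 1) f
  rw [neg_zero] at h
  rw [← h, poissonJ, ← intervalIntegral.integral_ofReal, ← intervalIntegral.integral_add]
  · refine intervalIntegral.integral_congr fun t _ => ?_
    simp only [hf]
    rw [show Complex.I * u * ((-t : ℝ) : ℂ) = -((u * t : ℝ) : ℂ) * Complex.I by push_cast; ring,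
      show Complex.I * u * t = ((u * t : ℝ) : ℂ) * Complex.I by push_cast; ring, neg_sq]
    push_cast
    rw [Complex.cos]
    ring
  · exact Continuous.intervalIntegrable (by fun_prop) _ _
  · exact Continuous.intervalIntegrable (by fun_prop) _ _

/-- Counterpart of `J₁ = Re H₁⁽¹⁾`. It splits `j` into an outgoing wave `B` and an incoming wave,
its conjugate, when `s` is large enough for both to be controlled. -/
theorem hankelB_im (u : ℝ) : (hankelB u).im = poissonJ u := by
  have h : (∫ t in (0 : ℝ)..1, (Real.sqrt (1 - t ^ 2) : ℂ) *
      Complex.exp (Complex.I * u * t)).re = poissonJ u := by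
    have h1 := intervalIntegral.intervalIntegral_re (𝕜 := ℂ) (μ := volume) (a := 0) (b := 1)
      (f := fun t : ℝ => (Real.sqrt (1 - t ^ 2) : ℂ) * Complex.exp (Complex.I * u * t))
      (Continuous.intervalIntegrable (by fun_prop) _ _)
    refine h1.symm.trans ?_
    rw [poissonJ]
    refine intervalIntegral.integral_congr fun t _ => ?_
    rw [show Complex.I * u * t = ((u * t : ℝ) : ℂ) * Complex.I by push_cast; ring]
    exact (Complex.re_ofReal_mul _ _).trans (congrArg _ (Complex.exp_ofReal_mul_I_re _))
  rw [hankelB, Complex.add_im, Complex.ofReal_im, add_zero, Complex.mul_im]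
  simp [h]

theorem conj_hankelB_eq_integral {u : ℝ} (hu : 0 < u) :
    (starRingEnd ℂ) (hankelB u) = ∫ t in Ioi (0 : ℝ), (starRingEnd ℂ) (hankelWeight t) *
      Complex.exp (Complex.I * u * (-1 + t * Complex.I)) := by
  rw [hankelB_eq_integral hu, ← integral_conj]
  congr 1
  ext t
  rw [map_mul, ← Complex.exp_conj]
  congr 2
  simp
  ring

/-- The size `u⁻²` at the origin is the true one; `u⁻¹` at infinity is weaker than the actual
`u^{-3/2}` but is enough for absolute convergence. -/
theorem norm_hankelB_le {u : ℝ} (hu : 0 < u) : ‖hankelB u‖ ≤ 4 * (u⁻¹ + (u ^ 2)⁻¹) := by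
  rw [hankelB_eq_integral hu]
  have hb := integral_affine_mul_exp_neg_mul_Ioi 1 hu
  rw [one_mul] at hb
  rw [← hb, ← integral_const_mul]
  refine norm_integral_le_of_norm_le ((integrableOn_affine_mul_exp_neg_mul_Ioi 1 hu).const_mul 4) ?_
  refine (ae_restrict_mem measurableSet_Ioi).mono fun t ht => ?_
  rw [norm_mul, Complex.norm_exp, ← mul_assoc]
  have : (Complex.I * u * (1 + t * Complex.I)).re = -(u * t) := by simp
  rw [this]
  gcongr
  exact norm_hankelWeight_le_affine (le_of_lt ht)

theorem measurable_hankelB : Measurable hankelB := by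
  refine (Continuous.measurable ?_).add (Complex.measurable_ofReal.comp ?_)
  · refine continuous_const.mul ?_
    exact intervalIntegral.continuous_parametric_intervalIntegral_of_continuous'
      (f := fun (u : ℝ) (t : ℝ) => (Real.sqrt (1 - t ^ 2) : ℂ) * Complex.exp (Complex.I * u * t))
      (by fun_prop) 0 1
  · have h : Measurable (Function.uncurry fun u t : ℝ =>
        Real.exp (-(u * t)) * Real.sqrt (1 + t ^ 2)) := by fun_prop
    exact h.stronglyMeasurable.integral_prod_right.measurable

theorem abs_poissonJ_le (u : ℝ) : |poissonJ u| ≤ 1 := by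
  have := intervalIntegral.norm_integral_le_of_norm_le_const (a := (0 : ℝ)) (b := 1)
    (f := fun t : ℝ => Real.sqrt (1 - t ^ 2) * Real.cos (u * t)) (C := 1) (fun t _ => by
      rw [norm_mul, Real.norm_eq_abs, Real.norm_eq_abs, abs_of_nonneg (Real.sqrt_nonneg _)]
      exact mul_le_one₀ (Real.sqrt_le_one.2 (by nlinarith)) (abs_nonneg _) (Real.abs_cos_le_one _))
  simpa [poissonJ] using this

theorem rpow_neg_one_add_norm_le {N : ℝ} (hN : 0 ≤ N) {ζ : ℂ} {d : ℝ} (hd : 0 < d)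
    (h : d ≤ 1 + ‖ζ‖) : (1 + ‖ζ‖) ^ (-N) ≤ d ^ (-N) :=
  Real.rpow_le_rpow_of_nonpos hd h (by linarith)

theorem half_abs_re_add_abs_im_le_norm (ζ : ℂ) : (|ζ.re| + |ζ.im|) / 2 ≤ ‖ζ‖ := by
  linarith [Complex.abs_re_le_norm ζ, Complex.abs_im_le_norm ζ]

/-! ### Bounds for the oscillatory integral in the different regions of `(r, s)`. -/

section KernelBounds

variable {g : ℝ → ℝ} {R N : ℝ}

/-- The oscillatory integral `∫₀ᴿ x⁵ log x · g x · B(x r) j(x s) dx`. -/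
noncomputable def besselProductIntegral (g : ℝ → ℝ) (R r s : ℝ) : ℂ :=
  ∫ x in (0 : ℝ)..R, (logAmplitude 5 g (fun _ => 0) x : ℂ) *
    (hankelB (x * r) * (poissonJ (x * s) : ℂ))

/-- No oscillation is used: `|j| ≤ 1`, and two powers of `x` absorb the singularity of `B(x r)`. The
estimate serves bounded `r` and `s`. -/
theorem norm_besselProductIntegral_le_crude (hg : Continuous g) (hR : 0 ≤ R) :
    ∃ C, 0 ≤ C ∧ ∀ r s, 0 < r → r ≤ 2 → ‖besselProductIntegral g R r s‖ ≤ C * (r ^ 2)⁻¹ := by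
  have hInt := (intervalIntegrable_logAmplitude (n := 3) hg (k := fun _ => 0)
    continuous_const 0 R).abs
  refine ⟨4 * (R * 2 + 1) * ∫ x in (0 : ℝ)..R, |logAmplitude 3 g (fun _ => 0) x|,
    mul_nonneg (by positivity) (intervalIntegral.integral_nonneg hR fun _ _ => abs_nonneg _),
    fun r s hr hr2 => ?_⟩
  rw [mul_right_comm, ← intervalIntegral.integral_const_mul]
  refine intervalIntegral.norm_integral_le_of_norm_le hR ?_ (hInt.const_mul _)
  refine Filter.Eventually.of_forall fun x hx => ?_
  have hx0 := hx.1
  have hb := norm_hankelB_le (mul_pos hx0 hr)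
  have hj := abs_poissonJ_le (x * s)
  have e : |logAmplitude 5 g (fun _ => 0) x| = x ^ 2 * |logAmplitude 3 g (fun _ => 0) x| := by
    simp only [logAmplitude, abs_mul, abs_pow, abs_of_pos hx0]; ring
  rw [norm_mul, norm_mul, Complex.norm_real, Complex.norm_real, Real.norm_eq_abs,
    Real.norm_eq_abs, e]
  have h1 : x ^ 2 * (x * r)⁻¹ ≤ R * 2 * (r ^ 2)⁻¹ := by
    have : x ^ 2 * (x * r)⁻¹ = x * r * (r ^ 2)⁻¹ := by field_simp
    rw [this]
    gcongr
    exact hx.2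
  have h2 : x ^ 2 * ((x * r) ^ 2)⁻¹ = (r ^ 2)⁻¹ := by field_simp
  calc _ ≤ x ^ 2 * |logAmplitude 3 g (fun _ => 0) x| *
        ((4 * ((x * r)⁻¹ + ((x * r) ^ 2)⁻¹)) * 1) := by gcongr
    _ = 4 * (x ^ 2 * (x * r)⁻¹ + x ^ 2 * ((x * r) ^ 2)⁻¹) *
        |logAmplitude 3 g (fun _ => 0) x| := by ring
    _ ≤ 4 * (R * 2 * (r ^ 2)⁻¹ + (r ^ 2)⁻¹) * |logAmplitude 3 g (fun _ => 0) x| := by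
        gcongr
        exact h2.le
    _ = _ := by ring

theorem intervalIntegrable_logAmplitude_mul_hankelB_mul_hankelB (hg : Continuous g) (hR : 0 ≤ R)
    {r s : ℝ} (hr : 0 < r) (hs : 0 < s) {T : ℂ → ℂ} (hT : Measurable T)
    (hTn : ∀ z, ‖T z‖ = ‖z‖) :
    IntervalIntegrable (fun x => (logAmplitude 5 g (fun _ => 0) x : ℂ) *
      (hankelB (x * r) * T (hankelB (x * s)))) volume 0 R := by
  have hB := measurable_hankelB
  have hm := measurable_logAmplitude (n := 5) hg (k := fun _ => 0) continuous_const
  rw [intervalIntegrable_iff_integrableOn_Ioc_of_le hR]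
  have hInt := (intervalIntegrable_logAmplitude (n := 1) hg (k := fun _ => 0)
    continuous_const 0 R).abs.1
  refine Integrable.mono' (hInt.const_mul ((4 * (R * r⁻¹ + (r ^ 2)⁻¹)) *
    (4 * (R * s⁻¹ + (s ^ 2)⁻¹)))) (Measurable.aestronglyMeasurable (by fun_prop)) ?_
  refine (ae_restrict_mem measurableSet_Ioc).mono fun x hx => ?_
  have hx0 := hx.1
  have key : ∀ ρ : ℝ, 0 < ρ → x ^ 2 * ‖hankelB (x * ρ)‖ ≤ 4 * (R * ρ⁻¹ + (ρ ^ 2)⁻¹) := by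
    intro ρ hρ
    calc _ ≤ x ^ 2 * (4 * ((x * ρ)⁻¹ + ((x * ρ) ^ 2)⁻¹)) := by
          gcongr; exact norm_hankelB_le (mul_pos hx0 hρ)
      _ = 4 * (x * ρ⁻¹ + (ρ ^ 2)⁻¹) := by field_simp
      _ ≤ _ := by gcongr; exact hx.2
  have e : |logAmplitude 5 g (fun _ => 0) x| =
      x ^ 2 * x ^ 2 * |logAmplitude 1 g (fun _ => 0) x| := by
    simp only [logAmplitude, abs_mul, abs_pow, abs_of_pos hx0]; ring
  rw [norm_mul, norm_mul, hTn, Complex.norm_real, Real.norm_eq_abs, e]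
  calc _ = (x ^ 2 * ‖hankelB (x * r)‖) * (x ^ 2 * ‖hankelB (x * s)‖) *
        |logAmplitude 1 g (fun _ => 0) x| := by ring
    _ ≤ _ := mul_le_mul_of_nonneg_right
        (mul_le_mul (key r hr) (key s hs) (by positivity) (by positivity)) (abs_nonneg _)

theorem hankelB_mul_eq_integral {x r : ℝ} (h : 0 < x * r) :
    hankelB (x * r) = ∫ t in Ioi (0 : ℝ), hankelWeight t *
      Complex.exp (Complex.I * x * (r + r * t * Complex.I)) := by
  rw [hankelB_eq_integral h]
  congr 1; ext t
  congr 2; push_cast; ring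

theorem conj_hankelB_mul_eq_integral {x r : ℝ} (h : 0 < x * r) :
    (starRingEnd ℂ) (hankelB (x * r)) = ∫ t in Ioi (0 : ℝ), (starRingEnd ℂ) (hankelWeight t) *
      Complex.exp (Complex.I * x * ((-r : ℝ) + r * t * Complex.I)) := by
  rw [conj_hankelB_eq_integral h]
  congr 1; ext t
  congr 2; push_cast; ring

theorem toReal_bound_of_enorm_le {z : ℂ} {a : ℝ} (ha : 0 ≤ a) (h : ‖z‖ₑ ≤ ENNReal.ofReal a) :
    ‖z‖ ≤ a := by
  rw [← ofReal_norm] at h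
  exact (ENNReal.ofReal_le_ofReal_iff ha).1 h

/-- For `2s ≤ r` the oscillation of `j`, a superposition of `e^{ixsb}` with `|b| ≤ 1`, cannot cancel
that of `B`. The total frequency has real part at least `r/2` and imaginary part `r a`, hence size
at least of order `r(1 + a)`. Keeping `j` in this form avoids any singularity as `s → 0`. -/
theorem norm_besselProductIntegral_le_far (hg : Continuous g) (hR : 0 ≤ R) (hN : 5 ≤ N)
    {C₀ : ℝ} (hC₀ : 0 ≤ C₀) (hM : ∀ ζ : ℂ, 0 ≤ ζ.im →
      ‖logTransform 5 g (fun _ => 0) R ζ‖ ≤ C₀ * (1 + ‖ζ‖) ^ (-N)) :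
    ∃ C, 0 ≤ C ∧ ∀ r s, 0 < r → 0 ≤ s → 2 * s ≤ r →
      ‖besselProductIntegral g R r s‖ ≤ C * r ^ (-N) := by
  have hfin := lintegral_one_add_rpow_Ioi_lt_top (c := 1 - N) (by linarith)
  set L := ∫⁻ t in Ioi (0 : ℝ), ENNReal.ofReal ((1 + t) ^ (1 - N)) with hL
  -- `2` is the length of `(-1, 1]`, `4` bounds the Hankel weight, and `4 ^ N` comes from the lower
  -- bound `r(1 + a)/4` for `1 + |ζ|`.
  refine ⟨2 * 4 * C₀ * 4 ^ N * L.toReal, by positivity, fun r s hr hs hrs => ?_⟩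
  refine toReal_bound_of_enorm_le (by positivity) ?_
  have hcongr : besselProductIntegral g R r s = ∫ x in (0 : ℝ)..R,
      (logAmplitude 5 g (fun _ => 0) x : ℂ) *
      ((∫ a in Ioi (0 : ℝ), hankelWeight a *
          Complex.exp (Complex.I * x * (r + r * a * Complex.I))) *
        ∫ b in Ioc (-1 : ℝ) 1, ((Real.sqrt (1 - b ^ 2) / 2 : ℝ) : ℂ) *
          Complex.exp (Complex.I * x * (s * b))) := by
    refine intervalIntegral.integral_congr_ae (Filter.Eventually.of_forall fun x hx => ?_)
    rw [uIoc_of_le hR] at hx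
    rw [hankelB_mul_eq_integral (mul_pos hx.1 hr), poissonJ_eq_integral]
    congr 2
    congr 1; ext t
    congr 2; push_cast; ring
  rw [hcongr]
  refine (enorm_integral_logAmplitude_mul_mul_le hg continuous_const hR measurableSet_Ioi
    measurableSet_Ioc measurable_hankelWeight (by fun_prop)
    (ζ₁ := fun t => r + r * t * Complex.I) (ζ₂ := fun t => s * t) (by fun_prop) (by fun_prop)
    (C₁ := 4 * (R * r⁻¹ + (r ^ 2)⁻¹)) (C₂ := R ^ 2)
    (fun x hx => lintegral_enorm_hankel_exp_le
      (fun t ht => norm_hankelWeight_le_affine ht.le) hr hx) ?_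
    (F := fun t => ENNReal.ofReal (4 * C₀ * 4 ^ N * r ^ (-N)) * ENNReal.ofReal ((1 + t) ^ (1 - N)))
    (G := fun _ => 1) (by fun_prop) measurable_const ?_).trans ?_
  · intro x hx
    have hx0 := hx.1
    calc _ ≤ ∫⁻ b in Ioc (-1 : ℝ) 1, ENNReal.ofReal (1 / 2) := by
          refine setLIntegral_mono' measurableSet_Ioc fun b hb => ?_
          rw [← ofReal_norm, norm_mul, Complex.norm_exp, Complex.norm_real]
          refine ENNReal.ofReal_le_ofReal ?_
          have : (Complex.I * x * (s * b)).re = 0 := by simp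
          rw [this, Real.exp_zero, mul_one, Real.norm_of_nonneg (by positivity)]
          have := Real.sqrt_le_one.2 (by nlinarith : 1 - b ^ 2 ≤ 1)
          linarith
      _ = ENNReal.ofReal 1 := by
          rw [setLIntegral_const, Real.volume_Ioc, ← ENNReal.ofReal_mul (by norm_num)]
          norm_num
      _ ≤ _ := by
          refine ENNReal.ofReal_le_ofReal ?_
          rw [← div_eq_mul_inv, one_le_div (by positivity)]
          gcongr
          exact hx.2
  · intro a ha b hb
    have ha0 : (0 : ℝ) < a := ha
    rw [mul_one, ← ENNReal.ofReal_mul (by positivity), ← ofReal_norm, ← ofReal_norm, ← ofReal_norm,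
      ← ENNReal.ofReal_mul (norm_nonneg _), ← ENNReal.ofReal_mul (by positivity)]
    refine ENNReal.ofReal_le_ofReal ?_
    have him : (r + r * a * Complex.I + s * b : ℂ).im = r * a := by simp
    have hre : (r + r * a * Complex.I + s * b : ℂ).re = r + s * b := by simp
    have hlow : r * (1 + a) / 4 ≤ 1 + ‖(r + r * a * Complex.I + s * b : ℂ)‖ := by
      have h := half_abs_re_add_abs_im_le_norm (r + r * a * Complex.I + s * b : ℂ)
      rw [him, hre] at h
      have h1 := le_abs_self (r + s * b)
      have h2 := le_abs_self (r * a)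
      have h3 : -s ≤ s * b := by nlinarith [hb.1]
      have : 0 < r * a := by positivity
      nlinarith
    have hq : ‖((Real.sqrt (1 - b ^ 2) / 2 : ℝ) : ℂ)‖ ≤ 1 := by
      rw [Complex.norm_real, Real.norm_of_nonneg (by positivity)]
      have := Real.sqrt_le_one.2 (by nlinarith : 1 - b ^ 2 ≤ 1)
      linarith
    have hM' := hM (r + r * a * Complex.I + s * b) (by rw [him]; positivity)
    have hpw := rpow_neg_one_add_norm_le (N := N) (by linarith) (by positivity) hlow
    have hexp : (r * (1 + a) / 4) ^ (-N) = 4 ^ N * r ^ (-N) * (1 + a) ^ (-N) := by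
      rw [Real.div_rpow (by positivity) (by norm_num), Real.mul_rpow hr.le (by positivity),
        Real.rpow_neg (by norm_num : (0 : ℝ) ≤ 4)]
      field_simp
    have hexp2 : (1 + a) ^ (1 - N) = (1 + a) * (1 + a) ^ (-N) := by
      rw [sub_eq_add_neg, Real.rpow_add (by positivity), Real.rpow_one]
    calc _ ≤ (4 * (1 + a)) * 1 * (C₀ * (4 ^ N * r ^ (-N) * (1 + a) ^ (-N))) := by
          gcongr
          · exact norm_hankelWeight_le_affine ha0.le
          · refine hM'.trans ?_
            rw [← hexp]
            gcongr
      _ = _ := by rw [hexp2]; ring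
  · rw [lintegral_const_mul _ (by fun_prop), ← hL, setLIntegral_const, Real.volume_Ioc,
      ← ENNReal.ofReal_toReal hfin.ne, ← ENNReal.ofReal_mul (by positivity), one_mul,
      ← ENNReal.ofReal_mul (by positivity)]
    refine ENNReal.ofReal_le_ofReal (le_of_eq ?_)
    rw [ENNReal.toReal_ofReal ENNReal.toReal_nonneg]
    ring

/-- The combined frequency is `(r + σ) + i(r a + s b)`, so `1 + |ζ|` is at least half of `D + r a +
s b = D(1 + a/(D/r) + b/(D/s))`. Since `N ≥ 5`, the decay can be shared as two factors of exponent
`-5/2`. The integrals in `a` and `b` then separate, each with its own scale `D/r` or `D/s`. -/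
theorem norm_hankelProduct_le (hg : Continuous g) (hR : 0 ≤ R) (hN : 5 ≤ N)
    {C₀ : ℝ} (hC₀ : 0 ≤ C₀) (hM : ∀ ζ : ℂ, 0 ≤ ζ.im →
      ‖logTransform 5 g (fun _ => 0) R ζ‖ ≤ C₀ * (1 + ‖ζ‖) ^ (-N)) :
    ∃ C, 0 ≤ C ∧ ∀ r s σ D : ℝ, 0 < r → 0 < s → 1 ≤ D → D ≤ 1 + |r + σ| → ∀ q : ℝ → ℂ,
      Measurable q → (∀ t, 0 < t → ‖q t‖ ≤ 2 * (Real.sqrt t + t)) →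
      ‖∫ x in (0 : ℝ)..R, (logAmplitude 5 g (fun _ => 0) x : ℂ) *
        ((∫ a in Ioi (0 : ℝ), hankelWeight a *
          Complex.exp (Complex.I * x * (r + r * a * Complex.I))) *
        ∫ b in Ioi (0 : ℝ), q b *
          Complex.exp (Complex.I * x * (σ + s * b * Complex.I)))‖ ≤
      C * D ^ (-N) * ((D / r) * (Real.sqrt (D / r) + D / r)) *
        ((D / s) * (Real.sqrt (D / s) + D / s)) := by
  obtain ⟨L, hL0, hL⟩ := lintegral_sqrt_add_mul_rpow_le
  refine ⟨4 * C₀ * 2 ^ N * L ^ 2, by positivity, fun r s σ D hr hs hD1 hD q hqm hq => ?_⟩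
  have hD0 : 0 < D := by linarith
  refine toReal_bound_of_enorm_le (by positivity) ?_
  have hq' : ∀ t, 0 < t → ‖q t‖ ≤ 4 * (1 + t) := fun t ht => (hq t ht).trans (by
    nlinarith [Real.sq_sqrt ht.le, sq_nonneg (Real.sqrt t - 1)])
  set w : ℝ → ℝ → ℝ := fun a t => (Real.sqrt t + t) * (1 + t / a) ^ (-(5 / 2) : ℝ) with hw
  refine (enorm_integral_logAmplitude_mul_mul_le hg continuous_const hR measurableSet_Ioi
    measurableSet_Ioi measurable_hankelWeight hqm
    (ζ₁ := fun t => r + r * t * Complex.I) (ζ₂ := fun t => σ + s * t * Complex.I)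
    (by fun_prop) (by fun_prop)
    (C₁ := 4 * (R * r⁻¹ + (r ^ 2)⁻¹)) (C₂ := 4 * (R * s⁻¹ + (s ^ 2)⁻¹))
    (fun x hx => lintegral_enorm_hankel_exp_le
      (fun t ht => norm_hankelWeight_le_affine ht.le) hr hx)
    (fun x hx => lintegral_enorm_hankel_exp_le hq' hs hx)
    (F := fun t => ENNReal.ofReal (4 * C₀ * 2 ^ N * D ^ (-N)) * ENNReal.ofReal (w (D / r) t))
    (G := fun t => ENNReal.ofReal (w (D / s) t)) (by fun_prop) (by fun_prop) ?_).trans ?_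
  · intro a ha b hb
    have ha0 : (0 : ℝ) < a := ha
    have hb0 : (0 : ℝ) < b := hb
    have hwpos : ∀ c t : ℝ, 0 < c → 0 < t → 0 ≤ w c t := by
      intro c t hc ht; simp only [hw]; positivity
    rw [← ENNReal.ofReal_mul (by positivity), ← ofReal_norm, ← ofReal_norm, ← ofReal_norm,
      ← ENNReal.ofReal_mul (norm_nonneg _), ← ENNReal.ofReal_mul (by positivity),
      ← ENNReal.ofReal_mul (mul_nonneg (by positivity) (hwpos _ _ (by positivity) ha0))]
    refine ENNReal.ofReal_le_ofReal ?_
    set ζ : ℂ := r + r * a * Complex.I + (σ + s * b * Complex.I) with hζ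
    have him : ζ.im = r * a + s * b := by simp [hζ]
    have hre : ζ.re = r + σ := by simp [hζ]
    have hlow : (D * (1 + (a / (D / r) + b / (D / s)))) / 2 ≤ 1 + ‖ζ‖ := by
      have h := half_abs_re_add_abs_im_le_norm ζ
      rw [him, hre] at h
      have h2 := le_abs_self (r * a + s * b)
      have e : D * (1 + (a / (D / r) + b / (D / s))) = D + (r * a + s * b) := by
        field_simp
      rw [e]
      linarith
    have hM' := hM ζ (by rw [him]; positivity)
    have hpw := rpow_neg_one_add_norm_le (N := N) (by linarith) (by positivity) hlow
    set α := a / (D / r) with hα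
    set β := b / (D / s) with hβ
    have hα0 : 0 < α := by positivity
    have hβ0 : 0 < β := by positivity
    have hexp : (D * (1 + (α + β)) / 2) ^ (-N) ≤
        2 ^ N * D ^ (-N) * ((1 + α) ^ (-(5 / 2) : ℝ) * (1 + β) ^ (-(5 / 2) : ℝ)) := by
      have e1 : (D * (1 + (α + β)) / 2) ^ (-N) = 2 ^ N * D ^ (-N) * (1 + (α + β)) ^ (-N) := by
        rw [Real.div_rpow (by positivity) (by norm_num), Real.mul_rpow hD0.le (by positivity),
          Real.rpow_neg (by norm_num : (0 : ℝ) ≤ 2)]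
        field_simp
      have e2 : (1 + (α + β)) ^ (-N) ≤ (1 + (α + β)) ^ (-5 : ℝ) :=
        Real.rpow_le_rpow_of_exponent_le (by linarith) (by linarith)
      have e3 : (1 + (α + β)) ^ (-5 : ℝ) =
          (1 + (α + β)) ^ (-(5 / 2) : ℝ) * (1 + (α + β)) ^ (-(5 / 2) : ℝ) := by
        rw [← Real.rpow_add (by positivity)]; norm_num
      have e4 : (1 + (α + β)) ^ (-(5 / 2) : ℝ) ≤ (1 + α) ^ (-(5 / 2) : ℝ) :=
        Real.rpow_le_rpow_of_nonpos (by positivity) (by linarith) (by norm_num)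
      have e5 : (1 + (α + β)) ^ (-(5 / 2) : ℝ) ≤ (1 + β) ^ (-(5 / 2) : ℝ) :=
        Real.rpow_le_rpow_of_nonpos (by positivity) (by linarith) (by norm_num)
      rw [e1]
      gcongr
      refine e2.trans ?_
      rw [e3]
      gcongr
    calc _ ≤ (2 * (Real.sqrt a + a)) * (2 * (Real.sqrt b + b)) * (C₀ * (2 ^ N * D ^ (-N) *
            ((1 + α) ^ (-(5 / 2) : ℝ) * (1 + β) ^ (-(5 / 2) : ℝ)))) := by
          gcongr
          · exact norm_hankelWeight_le ha0.le
          · exact hq b hb0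
          · refine hM'.trans ?_
            gcongr
            exact hpw.trans hexp
      _ = _ := by simp only [hw, ← hα, ← hβ]; ring
  · rw [lintegral_const_mul _ (by fun_prop)]
    calc _ ≤ ENNReal.ofReal (4 * C₀ * 2 ^ N * D ^ (-N)) *
          ENNReal.ofReal (L * ((D / r) * (Real.sqrt (D / r) + D / r))) *
          ENNReal.ofReal (L * ((D / s) * (Real.sqrt (D / s) + D / s))) := by
          gcongr
          · exact hL _ (by positivity)
          · exact hL _ (by positivity)
      _ = _ := by
          rw [← ENNReal.ofReal_mul (by positivity), ← ENNReal.ofReal_mul (by positivity)]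
          congr 1; ring

/-- Here `j = (B - B̄)/(2i)` yields the phases `r + s` and `r - s`; `1 + |r - s|` is a lower bound
for `1 + |phase|` in both cases. -/
theorem norm_besselProductIntegral_le_near (hg : Continuous g) (hR : 0 ≤ R) (hN : 5 ≤ N)
    {C₀ : ℝ} (hC₀ : 0 ≤ C₀) (hM : ∀ ζ : ℂ, 0 ≤ ζ.im →
      ‖logTransform 5 g (fun _ => 0) R ζ‖ ≤ C₀ * (1 + ‖ζ‖) ^ (-N)) :
    ∃ C, 0 ≤ C ∧ ∀ r s D : ℝ, 0 < r → 0 < s → D = 1 + |r - s| →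
      ‖besselProductIntegral g R r s‖ ≤
      C * D ^ (-N) * ((D / r) * (Real.sqrt (D / r) + D / r)) *
        ((D / s) * (Real.sqrt (D / s) + D / s)) := by
  obtain ⟨C, hC0, hC⟩ := norm_hankelProduct_le hg hR hN hC₀ hM
  refine ⟨C, hC0, fun r s D hr hs hD => ?_⟩
  have hD1 : 1 ≤ D := by rw [hD]; linarith [abs_nonneg (r - s)]
  have hD2 : D ≤ 1 + |r + s| := by
    have : |r - s| ≤ |r + s| := by
      rw [abs_of_pos (by positivity : 0 < r + s), abs_le]
      constructor <;> linarith
    linarith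
  have hD3 : D ≤ 1 + |r + -s| := by rw [hD, sub_eq_add_neg]
  have h1 := hC r s s D hr hs hD1 hD2 hankelWeight measurable_hankelWeight
    fun t ht => norm_hankelWeight_le ht.le
  have h2 := hC r s (-s) D hr hs hD1 hD3 (fun t => (starRingEnd ℂ) (hankelWeight t))
    (Complex.continuous_conj.measurable.comp measurable_hankelWeight)
    fun t ht => by rw [RCLike.norm_conj]; exact norm_hankelWeight_le ht.le
  have i1 := intervalIntegrable_logAmplitude_mul_hankelB_mul_hankelB hg hR hr hs (T := id)
    measurable_id fun _ => rfl
  have i2 := intervalIntegrable_logAmplitude_mul_hankelB_mul_hankelB hg hR hr hs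
    (T := starRingEnd ℂ) Complex.continuous_conj.measurable fun z => RCLike.norm_conj z
  have e : besselProductIntegral g R r s =
      (2 * Complex.I)⁻¹ * ((∫ x in (0 : ℝ)..R, (logAmplitude 5 g (fun _ => 0) x : ℂ) *
        (hankelB (x * r) * id (hankelB (x * s)))) -
        ∫ x in (0 : ℝ)..R, (logAmplitude 5 g (fun _ => 0) x : ℂ) *
        (hankelB (x * r) * (starRingEnd ℂ) (hankelB (x * s)))) := by
    rw [← intervalIntegral.integral_sub i1 i2, ← intervalIntegral.integral_const_mul,
      besselProductIntegral]
    congr 1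
    ext x
    have := Complex.sub_conj (hankelB (x * s))
    rw [hankelB_im] at this
    have hJ : (poissonJ (x * s) : ℂ) = (2 * Complex.I)⁻¹ *
        (hankelB (x * s) - (starRingEnd ℂ) (hankelB (x * s))) := by
      rw [this]
      push_cast
      field_simp
    rw [hJ, id]
    ring
  have c1 : ∫ x in (0 : ℝ)..R, (logAmplitude 5 g (fun _ => 0) x : ℂ) *
        (hankelB (x * r) * id (hankelB (x * s))) =
      ∫ x in (0 : ℝ)..R, (logAmplitude 5 g (fun _ => 0) x : ℂ) *
        ((∫ a in Ioi (0 : ℝ), hankelWeight a *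
          Complex.exp (Complex.I * x * (r + r * a * Complex.I))) *
        ∫ b in Ioi (0 : ℝ), hankelWeight b *
          Complex.exp (Complex.I * x * (s + s * b * Complex.I))) := by
    refine intervalIntegral.integral_congr_ae (Filter.Eventually.of_forall fun x hx => ?_)
    rw [uIoc_of_le hR] at hx
    rw [id, hankelB_mul_eq_integral (mul_pos hx.1 hr), hankelB_mul_eq_integral (mul_pos hx.1 hs)]
  have c2 : ∫ x in (0 : ℝ)..R, (logAmplitude 5 g (fun _ => 0) x : ℂ) *
        (hankelB (x * r) * (starRingEnd ℂ) (hankelB (x * s))) =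
      ∫ x in (0 : ℝ)..R, (logAmplitude 5 g (fun _ => 0) x : ℂ) *
        ((∫ a in Ioi (0 : ℝ), hankelWeight a *
          Complex.exp (Complex.I * x * (r + r * a * Complex.I))) *
        ∫ b in Ioi (0 : ℝ), (starRingEnd ℂ) (hankelWeight b) *
          Complex.exp (Complex.I * x * ((-s : ℝ) + s * b * Complex.I))) := by
    refine intervalIntegral.integral_congr_ae (Filter.Eventually.of_forall fun x hx => ?_)
    rw [uIoc_of_le hR] at hx
    rw [hankelB_mul_eq_integral (mul_pos hx.1 hr), conj_hankelB_mul_eq_integral (mul_pos hx.1 hs)]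
  rw [e, c1, c2, norm_mul]
  have hI : ‖(2 * Complex.I)⁻¹‖ = 1 / 2 := by simp
  rw [hI]
  refine (mul_le_mul_of_nonneg_left (norm_sub_le _ _) (by norm_num)).trans ?_
  linarith

end KernelBounds

/-! ### Splitting the kernel bound into a Schur part and a rank one part. -/

/-- The part of the kernel majorant to which Schur's test applies. -/
noncomputable def schurMajorant (r s : ℝ) : ℝ :=
  if s ≤ 2 * r then ((1 + r) ^ 3)⁻¹ * ((1 + |r - s|) ^ 2)⁻¹ else 0

/-- The left factor of the rank one part of the kernel majorant. -/
noncomputable def leftMajorant (q r : ℝ) : ℝ := (r ^ 2)⁻¹ * (1 + r) ^ (-(3 / q))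

/-- The right factor of the rank one part of the kernel majorant. -/
noncomputable def rightMajorant (q s : ℝ) : ℝ := (1 + s) ^ (-(4 - 7 / (2 * q)))

theorem schurMajorant_nonneg {r : ℝ} (hr : 0 ≤ r) (s : ℝ) : 0 ≤ schurMajorant r s := by
  unfold schurMajorant
  split_ifs
  · positivity
  · rfl

theorem leftMajorant_nonneg (q : ℝ) {r : ℝ} (hr : 0 ≤ r) : 0 ≤ leftMajorant q r := by
  unfold leftMajorant; positivity

theorem rightMajorant_nonneg (q : ℝ) {s : ℝ} (hs : 0 ≤ s) : 0 ≤ rightMajorant q s := by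
  unfold rightMajorant; positivity

/-- On this bounded region the weights are bounded below: `1 + r ≤ 3` with exponent at most `3`, and
`1 + s ≤ 2` with exponent at most `4`, whence `432 = 27 · 16`. -/
theorem inv_sq_le_rankOne {q r s : ℝ} (hq : 1 ≤ q) (hr : 0 < r) (hs : 0 < s) (hr2 : r ≤ 2)
    (hs1 : s ≤ 1) : (r ^ 2)⁻¹ ≤ 432 * (leftMajorant q r * rightMajorant q s) := by
  have h1 : (27 : ℝ)⁻¹ ≤ (1 + r) ^ (-(3 / q)) := by
    have e : (27 : ℝ)⁻¹ = 3 ^ (-3 : ℝ) := by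
      rw [Real.rpow_neg (by norm_num)]; norm_num
    rw [e]
    calc (3 : ℝ) ^ (-3 : ℝ) ≤ 3 ^ (-(3 / q)) := by
          refine Real.rpow_le_rpow_of_exponent_le (by norm_num) (neg_le_neg ?_)
          exact div_le_self (by norm_num) hq
      _ ≤ _ := Real.rpow_le_rpow_of_nonpos (by positivity) (by linarith)
          (by rw [neg_nonpos]; positivity)
  have h2 : (16 : ℝ)⁻¹ ≤ (1 + s) ^ (-(4 - 7 / (2 * q))) := by
    have e : (16 : ℝ)⁻¹ = 2 ^ (-4 : ℝ) := by
      rw [Real.rpow_neg (by norm_num)]; norm_num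
    have hq' : 7 / (2 * q) ≤ 4 := by
      rw [div_le_iff₀ (by positivity)]; linarith
    rw [e]
    calc (2 : ℝ) ^ (-4 : ℝ) ≤ 2 ^ (-(4 - 7 / (2 * q))) := by
          refine Real.rpow_le_rpow_of_exponent_le (by norm_num) (neg_le_neg ?_)
          have : 0 ≤ 7 / (2 * q) := by positivity
          linarith
      _ ≤ _ := Real.rpow_le_rpow_of_nonpos (by positivity) (by linarith) (by linarith)
  unfold leftMajorant rightMajorant
  calc (r ^ 2)⁻¹ = 432 * ((r ^ 2)⁻¹ * (27 : ℝ)⁻¹ * (16 : ℝ)⁻¹) := by ring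
    _ ≤ _ := by gcongr

theorem far_le_schurMajorant {N r s : ℝ} (hN : 5 ≤ N) (hr : 1 ≤ r) (hs : 0 < s)
    (hrs : 2 * s ≤ r) : r ^ (-N) ≤ 32 * schurMajorant r s := by
  have hr0 : 0 < r := by linarith
  rw [schurMajorant, if_pos (by linarith), abs_of_pos (by linarith)]
  calc r ^ (-N) ≤ r ^ (-5 : ℝ) := Real.rpow_le_rpow_of_exponent_le hr (by linarith)
    _ = (r ^ 5)⁻¹ := by
        rw [Real.rpow_neg hr0.le]; norm_num
    _ = 32 * (((2 * r) ^ 3)⁻¹ * ((2 * r) ^ 2)⁻¹) := by field_simp; norm_num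
    _ ≤ _ := by
        have : 0 < 1 + (r - s) := by linarith
        gcongr <;> linarith

/-- With `α² = D/r` and `β² = D/s` the product equals `D^{-N} (αβ)³ (1+α)(1+β)`. When `r` and `s`
are comparable, `αβ` is of order `D/r` and `α, β ≤ 2`. Three powers of `D` are thus spent, leaving
`D⁻²` because `N ≥ 5`, in exchange for `r⁻³`. -/
theorem near_le_schurMajorant {N r s D : ℝ} (hN : 5 ≤ N) (hD : D = 1 + |r - s|) (hr : 1 ≤ 2 * r)
    (hs : 1 ≤ s) (h1 : r ≤ 2 * s) (h2 : s ≤ 2 * r) :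
    D ^ (-N) * ((D / r) * (Real.sqrt (D / r) + D / r)) *
        ((D / s) * (Real.sqrt (D / s) + D / s)) ≤ 1944 * schurMajorant r s := by
  have hr0 : 0 < r := by linarith
  have hs0 : 0 < s := by linarith
  have habs : |r - s| ≤ r ∧ |r - s| ≤ s := by
    constructor <;> rw [abs_le] <;> constructor <;> linarith
  have hD1 : 1 ≤ D := by rw [hD]; linarith [abs_nonneg (r - s)]
  have hD0 : 0 < D := by linarith
  have ha : D / r ≤ 4 := by rw [div_le_iff₀ hr0]; linarith
  have hb : D / s ≤ 4 := by rw [div_le_iff₀ hs0]; linarith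
  set α := Real.sqrt (D / r) with hα
  set β := Real.sqrt (D / s) with hβ
  have hα0 : 0 ≤ α := Real.sqrt_nonneg _
  have hβ0 : 0 ≤ β := Real.sqrt_nonneg _
  have eα : D / r = α ^ 2 := (Real.sq_sqrt (by positivity)).symm
  have eβ : D / s = β ^ 2 := (Real.sq_sqrt (by positivity)).symm
  have hα2 : α ≤ 2 := by rw [eα] at ha; nlinarith
  have hβ2 : β ≤ 2 := by rw [eβ] at hb; nlinarith
  have hαβ : α * β ≤ 2 * D / r := by
    refine abs_le_of_sq_le_sq' ?_ (by positivity) |>.2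
    rw [mul_pow, ← eα, ← eβ, div_mul_div_comm, div_pow, div_le_div_iff₀ (by positivity)
      (by positivity)]
    have : D ^ 2 * r * r ≤ D ^ 2 * r * (2 * s) := by gcongr
    have : 0 ≤ D ^ 2 * r * s := by positivity
    nlinarith
  have hDp : D ^ (-N) * D ^ 3 ≤ (D ^ 2)⁻¹ := by
    rw [← Real.rpow_natCast, ← Real.rpow_add hD0, ← Real.rpow_natCast D 2, ← Real.rpow_neg hD0.le]
    refine Real.rpow_le_rpow_of_exponent_le hD1 ?_
    push_cast; linarith
  have hr3 : (r ^ 3)⁻¹ ≤ 27 * ((1 + r) ^ 3)⁻¹ := by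
    rw [← div_eq_mul_inv, le_div_iff₀ (by positivity), inv_mul_le_iff₀ (by positivity)]
    calc (1 + r) ^ 3 ≤ (3 * r) ^ 3 := by gcongr; linarith
      _ = _ := by ring
  rw [schurMajorant, if_pos h2, ← hD]
  rw [eα, eβ]
  calc D ^ (-N) * (α ^ 2 * (α + α ^ 2)) * (β ^ 2 * (β + β ^ 2))
      = D ^ (-N) * (α * β) ^ 3 * ((1 + α) * (1 + β)) := by ring
    _ ≤ D ^ (-N) * (2 * D / r) ^ 3 * ((1 + 2) * (1 + 2)) := by gcongr
    _ = 72 * (D ^ (-N) * D ^ 3) * (r ^ 3)⁻¹ := by field_simp; norm_num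
    _ ≤ 72 * (D ^ 2)⁻¹ * (27 * ((1 + r) ^ 3)⁻¹) := by gcongr
    _ = _ := by ring

/-- For `s > 2r`, `D` is comparable to `1 + s`, so the product is of order `r⁻²
(1+s)^{-(4-1/(2q))}`. The exponent is divided as `3/q + (4 - 7/(2q))`, and the first share is handed
to `1 + r ≤ 1 + s`. It makes the left factor `L^q` at infinity, while the remainder keeps the right
factor in `L^{q'}`. -/
theorem near_le_rankOne {q r s D : ℝ} (hq : 1 ≤ q) (hD : D = 1 + |r - s|) (hr : 0 < r)
    (hs : 1 ≤ s) (h2 : 2 * r < s) :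
    D ^ (-(6 - 1 / (2 * q))) * ((D / r) * (Real.sqrt (D / r) + D / r)) *
        ((D / s) * (Real.sqrt (D / s) + D / s)) ≤
      256 * (leftMajorant q r * rightMajorant q s) := by
  have hs0 : 0 < s := by linarith
  have hDe : D = 1 + (s - r) := by rw [hD, abs_sub_comm, abs_of_pos (by linarith)]
  have hD0 : 0 < D := by linarith
  have hε : 1 / (2 * q) ≤ 1 / 2 := by gcongr; linarith
  have hε0 : 0 < 1 / (2 * q) := by positivity
  set ε := 1 / (2 * q) with hεd
  have ha : 1 ≤ D / r := by rw [one_le_div hr]; linarith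
  have hb : D / s ≤ 2 := by rw [div_le_iff₀ hs0]; linarith
  have hsa : Real.sqrt (D / r) ≤ D / r := by
    rw [Real.sqrt_le_left (by positivity)]; nlinarith
  have hsb : Real.sqrt (D / s) ≤ 2 := by
    rw [Real.sqrt_le_left (by positivity)]; linarith
  have hDp : D ^ (-(6 - ε)) * D ^ 2 ≤ 16 * (1 + s) ^ (-(4 - ε)) := by
    rw [← Real.rpow_natCast, ← Real.rpow_add hD0,
      show -(6 - ε) + ((2 : ℕ) : ℝ) = -(4 - ε) by push_cast; ring]
    calc D ^ (-(4 - ε)) ≤ ((1 + s) / 2) ^ (-(4 - ε)) :=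
          Real.rpow_le_rpow_of_nonpos (by positivity) (by linarith) (by linarith)
      _ = 2 ^ (4 - ε) * (1 + s) ^ (-(4 - ε)) := by
          rw [Real.div_rpow (by positivity) (by norm_num),
            Real.rpow_neg (by norm_num : (0 : ℝ) ≤ 2)]
          field_simp
      _ ≤ 2 ^ (4 : ℝ) * (1 + s) ^ (-(4 - ε)) := by
          gcongr
          · norm_num
          · linarith
      _ = _ := by norm_num
  have hsplit : (1 + s) ^ (-(4 - ε)) ≤ (1 + r) ^ (-(3 / q)) * (1 + s) ^ (-(4 - 7 / (2 * q))) := by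
    have e : -(4 - ε) = -(3 / q) + -(4 - 7 / (2 * q)) := by
      rw [hεd]; field_simp; ring
    rw [e, Real.rpow_add (by positivity)]
    refine mul_le_mul_of_nonneg_right ?_ (by positivity)
    exact Real.rpow_le_rpow_of_nonpos (by positivity) (by linarith)
      (by rw [neg_nonpos]; positivity)
  unfold leftMajorant rightMajorant
  calc _ ≤ D ^ (-(6 - ε)) * ((D / r) * (D / r + D / r)) * (2 * (2 + 2)) := by gcongr
    _ = 16 * (D ^ (-(6 - ε)) * D ^ 2) * (r ^ 2)⁻¹ := by field_simp; norm_num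
    _ ≤ 16 * (16 * ((1 + r) ^ (-(3 / q)) * (1 + s) ^ (-(4 - 7 / (2 * q))))) * (r ^ 2)⁻¹ := by
        have := hDp.trans (mul_le_mul_of_nonneg_left hsplit (by norm_num : (0 : ℝ) ≤ 16))
        exact mul_le_mul_of_nonneg_right (mul_le_mul_of_nonneg_left this (by norm_num))
          (by positivity)
    _ = _ := by ring

theorem norm_besselProductIntegral_le {g : ℝ → ℝ} {R q : ℝ} (hg : ContDiff ℝ ∞ g) (hR : 1 ≤ R)
    (hgR : g =ᶠ[nhds R] 0) (hq : 1 ≤ q) :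
    ∃ C, 0 ≤ C ∧ ∀ r s, 0 < r → 0 < s → ‖besselProductIntegral g R r s‖ ≤
      C * (schurMajorant r s + leftMajorant q r * rightMajorant q s) := by
  have hR0 : 0 ≤ R := by linarith
  have hε : 1 / (2 * q) ≤ 1 / 2 := by gcongr; linarith
  have hε0 : 0 < 1 / (2 * q) := by positivity
  obtain ⟨C₀, hC₀, hM⟩ := norm_logTransform_le_one_add hε0 (by linarith) hR 5 hg
    (contDiff_const (c := (0 : ℝ))) hgR (Filter.EventuallyEq.refl _ _)
  have hM' : ∀ ζ : ℂ, 0 ≤ ζ.im → ‖logTransform 5 g (fun _ => 0) R ζ‖ ≤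
      C₀ * (1 + ‖ζ‖) ^ (-(6 - 1 / (2 * q))) := fun ζ hζ => by
    have := hM ζ hζ
    norm_num at this ⊢
    exact this
  -- The decay exponent is `n + 1 - ε` with `n = 5` and `ε = 1/(2q) ≤ 1/2`.
  have hN : 5 ≤ 6 - 1 / (2 * q) := by linarith
  obtain ⟨C₁, h₁, H₁⟩ := norm_besselProductIntegral_le_crude hg.continuous hR0
  obtain ⟨C₂, h₂, H₂⟩ := norm_besselProductIntegral_le_far hg.continuous hR0 hN hC₀ hM'
  obtain ⟨C₃, h₃, H₃⟩ := norm_besselProductIntegral_le_near hg.continuous hR0 hN hC₀ hM'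
  refine ⟨432 * C₁ + 32 * C₂ + 1944 * C₃, by positivity, fun r s hr hs => ?_⟩
  have p1 := schurMajorant_nonneg hr.le s
  have p2 := mul_nonneg (leftMajorant_nonneg q hr.le) (rightMajorant_nonneg q hs.le)
  have combine : ∀ c X Y : ℝ, 0 ≤ Y → c ≤ 432 * C₁ + 32 * C₂ + 1944 * C₃ →
      X ≤ c * Y → X ≤ (432 * C₁ + 32 * C₂ + 1944 * C₃) * Y := fun c X Y hY hc hX =>
    hX.trans (mul_le_mul_of_nonneg_right hc hY)
  -- Outside this bounded region, `2s ≤ r` forces `r ≥ 1` and `r < 2s` forces `s ≥ 1`. The last case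
  -- is then divided according to whether `s ≤ 2r`.
  by_cases hA : r ≤ 2 ∧ s ≤ 1
  · refine combine (432 * C₁) _ _ (by positivity) (by linarith) ((H₁ r s hr hA.1).trans ?_)
    have := inv_sq_le_rankOne hq hr hs hA.1 hA.2
    calc _ ≤ C₁ * (432 * (leftMajorant q r * rightMajorant q s)) := by gcongr
      _ ≤ _ := by nlinarith
  by_cases hB : 2 * s ≤ r
  · have hr1 : 1 ≤ r := by
      by_contra h
      exact hA ⟨by linarith, by linarith⟩
    refine combine (32 * C₂) _ _ (by positivity) (by linarith) ((H₂ r s hr hs.le hB).trans ?_)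
    have := far_le_schurMajorant hN hr1 hs hB
    calc _ ≤ C₂ * (32 * schurMajorant r s) := by gcongr
      _ ≤ _ := by nlinarith
  push Not at hB
  have hs1 : 1 ≤ s := by
    by_contra h
    exact hA ⟨by linarith, by linarith⟩
  have h := H₃ r s (1 + |r - s|) hr hs rfl
  refine combine (1944 * C₃) _ _ (by positivity) (by linarith) (h.trans ?_)
  rw [mul_assoc C₃, mul_assoc C₃]
  by_cases hc : s ≤ 2 * r
  · have := near_le_schurMajorant hN (r := r) (s := s) rfl (by linarith) hs1 (by linarith) hc
    calc _ ≤ C₃ * (1944 * schurMajorant r s) := by gcongr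
      _ ≤ _ := by nlinarith
  · push Not at hc
    have := near_le_rankOne hq (r := r) (s := s) rfl hr hs1 hc
    calc _ ≤ C₃ * (256 * (leftMajorant q r * rightMajorant q s)) := by gcongr
      _ ≤ _ := by nlinarith [mul_nonneg h₃ p1, mul_nonneg h₃ p2]

/-- The kernel obtained by carrying out the spectral integration first. -/
noncomputable def spectralKernel (Φ : ℝ → ℝ) (r s : ℝ) : ℂ :=
  ∫ lam in Ioi (0 : ℝ), resolventKernelPlus lam r *
    (resolventKernelPlus lam s - resolventKernelMinus lam s) * ((Φ lam * lam * Real.log lam : ℝ) : ℂ)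

/-- The two resolvent kernels supply `lam⁴ / (8 π⁴)`; with the factor `lam` of the measure this is
the fifth power in the amplitude. -/
theorem spectralKernel_eq {Φ : ℝ → ℝ} {R : ℝ} (hR : 0 ≤ R) (hΦ : ∀ x, R ≤ x → Φ x = 0) {r s : ℝ}
    (hr : 0 < r) (hs : 0 < s) :
    spectralKernel Φ r s =
      Complex.I * ((8 * Real.pi ^ 4)⁻¹ : ℝ) * besselProductIntegral Φ R r s := by
  rw [besselProductIntegral, intervalIntegral.integral_of_le hR, ← integral_const_mul,
    spectralKernel]
  have hpi : (Real.pi : ℂ) ≠ 0 := by exact_mod_cast Real.pi_ne_zero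
  have hsub : ∀ x ∈ Ioi (0 : ℝ) \ Ioc 0 R, resolventKernelPlus x r *
      (resolventKernelPlus x s - resolventKernelMinus x s) *
        ((Φ x * x * Real.log x : ℝ) : ℂ) = 0 := by
    intro x hx
    have : R ≤ x := by
      by_contra h
      exact hx.2 ⟨hx.1, by linarith⟩
    simp [hΦ x this]
  rw [setIntegral_eq_of_subset_of_forall_sdiff_eq_zero measurableSet_Ioi Ioc_subset_Ioi_self hsub]
  refine setIntegral_congr_fun measurableSet_Ioc fun x hx => ?_
  simp only [resolventKernelPlus_sub_minus hs.ne', resolventKernelPlus_eq hr.ne', logAmplitude]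
  push_cast
  field_simp
  ring

theorem norm_spectralKernel_le {Φ : ℝ → ℝ} {q : ℝ} (hΦ : ContDiff ℝ ∞ Φ)
    (hΦc : HasCompactSupport Φ) (hq : 1 ≤ q) :
    ∃ C, 0 ≤ C ∧ ∀ r s, 0 ≤ r → 0 ≤ s → ‖spectralKernel Φ r s‖ ≤
      C * (schurMajorant r s + leftMajorant q r * rightMajorant q s) := by
  obtain ⟨R₀, hR₀⟩ := hΦc.isCompact.isBounded.subset_closedBall 0
  set R := max 1 (R₀ + 1) with hRdef
  have hR : 1 ≤ R := le_max_left _ _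
  have hz : ∀ x, R₀ < x → Φ x = 0 := by
    intro x hx
    by_contra h
    have := hR₀ (subset_tsupport _ h)
    rw [mem_closedBall_zero_iff, Real.norm_eq_abs] at this
    linarith [le_abs_self x]
  have hRR : R₀ < R := by linarith [le_max_right 1 (R₀ + 1)]
  have hΦR : Φ =ᶠ[nhds R] 0 := by
    filter_upwards [Ioi_mem_nhds hRR] with x hx
    exact hz x hx
  obtain ⟨C, hC, H⟩ := norm_besselProductIntegral_le hΦ hR hΦR hq
  refine ⟨C, hC, fun r s hr hs => ?_⟩
  have hnn : 0 ≤ C * (schurMajorant r s + leftMajorant q r * rightMajorant q s) :=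
    mul_nonneg hC (add_nonneg (schurMajorant_nonneg hr s)
      (mul_nonneg (leftMajorant_nonneg q hr) (rightMajorant_nonneg q hs)))
  -- On the null sets `r = 0` and `s = 0` the spectral kernel vanishes by the convention for
  -- division by zero.
  rcases hr.eq_or_lt with rfl | hr
  · simpa [spectralKernel, resolventKernelPlus] using hnn
  rcases hs.eq_or_lt with rfl | hs
  · simpa [spectralKernel, resolventKernelPlus, resolventKernelMinus] using hnn
  rw [spectralKernel_eq (R := R) (by linarith) (fun x hx => hz x (by linarith)) hr hs, norm_mul, norm_mul,
    Complex.norm_I, one_mul, Complex.norm_real, Real.norm_of_nonneg (by positivity)]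
  refine (mul_le_of_le_one_left (norm_nonneg _) ?_).trans (H r s hr hs)
  have : 1 ≤ Real.pi ^ 4 := one_le_pow₀ (by linarith [Real.pi_gt_three])
  exact inv_le_one_of_one_le₀ (by linarith)

/-! ### Schur's test, radial integrals and convolution inequalities. -/

/-- Hölder's inequality for the measure `κ dμ`, in the form `κ f = κ^{1-1/q} (κ f^q)^{1/q}`. It is
behind both Schur's test and Young's inequality below. -/
theorem lintegral_mul_rpow_le {Ω : Type*} [MeasurableSpace Ω] {μ : Measure Ω} {κ f : Ω → ℝ≥0∞}
    (hκ : AEMeasurable κ μ) (hf : AEMeasurable f μ) {q : ℝ} (hq : 1 ≤ q) :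
    (∫⁻ ξ, κ ξ * f ξ ∂μ) ^ q ≤ (∫⁻ ξ, κ ξ ∂μ) ^ (q - 1) * ∫⁻ ξ, κ ξ * f ξ ^ q ∂μ := by
  have hq0 : 0 < q := by linarith
  have hq1 : 1 / q ≤ 1 := by rw [div_le_one hq0]; exact hq
  have hpt : ∀ ξ, κ ξ * f ξ = κ ξ ^ (1 - 1 / q) * (κ ξ * f ξ ^ q) ^ (1 / q) := by
    intro ξ
    rw [ENNReal.mul_rpow_of_nonneg _ _ (by positivity), ← ENNReal.rpow_mul,
      mul_one_div_cancel hq0.ne', ENNReal.rpow_one, ← mul_assoc,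
      ← ENNReal.rpow_add_of_nonneg _ _ (by linarith) (by positivity), sub_add_cancel,
      ENNReal.rpow_one]
  have h := ENNReal.lintegral_mul_norm_pow_le hκ (hκ.mul (hf.pow_const q))
    (p := 1 - 1 / q) (q := 1 / q) (by linarith) (by positivity) (by ring)
  simp only [Pi.mul_apply] at h
  simp_rw [← hpt] at h
  calc _ ≤ ((∫⁻ ξ, κ ξ ∂μ) ^ (1 - 1 / q) * (∫⁻ ξ, κ ξ * f ξ ^ q ∂μ) ^ (1 / q)) ^ q := by
        gcongr
    _ = _ := by
        rw [ENNReal.mul_rpow_of_nonneg _ _ hq0.le, ← ENNReal.rpow_mul, ← ENNReal.rpow_mul,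
          one_div_mul_cancel hq0.ne', ENNReal.rpow_one]
        congr 2
        field_simp

/-- Schur's test for a kernel on `X × Ω` acting on functions of `π ξ`. -/
theorem lintegral_lintegral_mul_rpow_le {X Ω : Type*} [MeasurableSpace X]
    [MeasurableSpace Ω] {μ : Measure X} {ν : Measure Ω} [SFinite μ] [SFinite ν]
    {κ : X → Ω → ℝ≥0∞} (hκ : Measurable (Function.uncurry κ)) {q : ℝ} (hq : 1 ≤ q)
    {C : ℝ≥0∞} {m : Ω → ℝ≥0∞} (h₁ : ∀ x, ∫⁻ ξ, κ x ξ ∂ν ≤ C)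
    (h₂ : ∀ ξ, ∫⁻ x, κ x ξ ∂μ ≤ m ξ) {f : Ω → ℝ≥0∞} (hf : Measurable f) :
    ∫⁻ x, (∫⁻ ξ, κ x ξ * f ξ ∂ν) ^ q ∂μ ≤ C ^ (q - 1) * ∫⁻ ξ, m ξ * f ξ ^ q ∂ν := by
  have hκx : ∀ x, Measurable (κ x) := fun x => hκ.comp measurable_prodMk_left
  have hκξ : ∀ ξ, Measurable fun x => κ x ξ := fun ξ => hκ.comp measurable_prodMk_right
  have hm : Measurable (Function.uncurry fun x ξ => κ x ξ * f ξ ^ q) :=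
    hκ.mul ((hf.pow_const q).comp measurable_snd)
  calc _ ≤ ∫⁻ x, C ^ (q - 1) * ∫⁻ ξ, κ x ξ * f ξ ^ q ∂ν ∂μ := by
        refine lintegral_mono fun x => ?_
        refine (lintegral_mul_rpow_le (hκx x).aemeasurable hf.aemeasurable hq).trans ?_
        have : 0 ≤ q - 1 := by linarith
        gcongr
        exact h₁ x
    _ = C ^ (q - 1) * ∫⁻ x, ∫⁻ ξ, κ x ξ * f ξ ^ q ∂ν ∂μ :=
        lintegral_const_mul _ hm.lintegral_prod_right
    _ = C ^ (q - 1) * ∫⁻ ξ, ∫⁻ x, κ x ξ * f ξ ^ q ∂μ ∂ν := by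
        rw [lintegral_lintegral_swap hm.aemeasurable]
    _ ≤ _ := by
        gcongr with ξ
        rw [lintegral_mul_const _ (hκξ ξ)]
        gcongr
        exact h₂ ξ

theorem finrank_R4 : Module.finrank ℝ R4 = 4 := by simp

/-- Polar coordinates in `ℝ⁴`: the Jacobian is `r³`, and the unit sphere has area four times the
volume of the unit ball. -/
theorem lintegral_radial_le {f h : ℝ → ℝ} (hf : Measurable f) (hf0 : ∀ r, 0 ≤ r → 0 ≤ f r)
    (hh : Integrable h) (hfh : ∀ r, 0 < r → r ^ 3 * f r ≤ h r) (hh0 : ∀ r, 0 ≤ h r) :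
    ∫⁻ x : R4, ENNReal.ofReal (f ‖x‖) ≤
      ENNReal.ofReal (4 * (volume : Measure R4).real (Metric.ball 0 1) * ∫ r, h r) := by
  have hInt : IntegrableOn (fun r : ℝ => r ^ 3 * f r) (Ioi 0) := by
    refine Integrable.mono' hh.integrableOn (Measurable.aestronglyMeasurable (by fun_prop)) ?_
    refine (ae_restrict_mem measurableSet_Ioi).mono fun r hr => ?_
    have hr0 : (0 : ℝ) < r := hr
    rw [Real.norm_of_nonneg (mul_nonneg (by positivity) (hf0 r hr0.le))]
    exact hfh r hr
  have hintx : Integrable (fun x : R4 => f ‖x‖) := by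
    rw [integrable_fun_norm_addHaar (volume : Measure R4) (f := f), finrank_R4]
    simpa using hInt
  rw [← ofReal_integral_eq_lintegral_ofReal hintx
    (Filter.Eventually.of_forall fun x => hf0 _ (norm_nonneg x)),
    integral_fun_norm_addHaar (volume : Measure R4) f, finrank_R4]
  refine ENNReal.ofReal_le_ofReal ?_
  simp only [nsmul_eq_mul, smul_eq_mul]
  rw [← mul_assoc]
  push_cast
  gcongr
  refine (setIntegral_mono_on hInt hh.integrableOn measurableSet_Ioi fun r hr => hfh r hr).trans ?_
  exact setIntegral_le_integral hh (Filter.Eventually.of_forall hh0)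

theorem integrable_inv_one_add_abs_sub_sq (s : ℝ) :
    Integrable fun r : ℝ => ((1 + |r - s|) ^ 2)⁻¹ := by
  have h := (integrable_one_add_norm (E := ℝ) (μ := volume) (r := 2) (by simp)).comp_sub_right s
  refine h.congr (Filter.Eventually.of_forall fun r => ?_)
  simp only [Real.norm_eq_abs]
  rw [Real.rpow_neg (by positivity)]
  norm_num

theorem integral_inv_one_add_abs_sub_sq (s : ℝ) :
    ∫ r : ℝ, ((1 + |r - s|) ^ 2)⁻¹ = ∫ r : ℝ, ((1 + |r|) ^ 2)⁻¹ :=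
  integral_sub_right_eq_self (fun r : ℝ => ((1 + |r|) ^ 2)⁻¹) s

theorem measurable_schurMajorant : Measurable (Function.uncurry schurMajorant) := by
  simp only [Function.uncurry_def, schurMajorant]
  refine Measurable.ite (measurableSet_le (by fun_prop) (by fun_prop)) ?_ measurable_const
  fun_prop

theorem measurable_leftMajorant (q : ℝ) : Measurable (leftMajorant q) := by
  unfold leftMajorant; fun_prop

theorem measurable_rightMajorant (q : ℝ) : Measurable (rightMajorant q) := by
  unfold rightMajorant; fun_prop

/-- The factor `(1+r)⁻³` absorbs the Jacobian `r³`, and also `s³` since `s ≤ 2r`, with constant `8 =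
2³`. What remains is `(1+|r-s|)⁻²`, whose integral over the line does not depend on the fixed
variable. -/
theorem schurMajorant_integral_bound :
    ∃ C : ℝ≥0∞, C ≠ ⊤ ∧
      (∀ s, ∫⁻ x : R4, ENNReal.ofReal (schurMajorant ‖x‖ s) ≤ C) ∧
      (∀ r, 0 ≤ r → ∫⁻ y : R4, ENNReal.ofReal (schurMajorant r ‖y‖) ≤ C) := by
  set I0 := ∫ r : ℝ, ((1 + |r|) ^ 2)⁻¹ with hI0
  set c := 4 * (volume : Measure R4).real (Metric.ball 0 1) with hc
  have hc0 : 0 ≤ c := by positivity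
  refine ⟨ENNReal.ofReal (c * (8 * I0)), ENNReal.ofReal_ne_top, fun s => ?_, fun r hr => ?_⟩
  · have h := lintegral_radial_le (f := fun r => schurMajorant r s)
      (h := fun r => 8 * ((1 + |r - s|) ^ 2)⁻¹)
      (measurable_schurMajorant.comp measurable_prodMk_right)
      (fun r hr => schurMajorant_nonneg hr s)
      ((integrable_inv_one_add_abs_sub_sq s).const_mul 8) (fun r hr => ?_) (fun r => by positivity)
    · rwa [integral_const_mul, integral_inv_one_add_abs_sub_sq] at h
    · unfold schurMajorant
      split_ifs
      · have : r ^ 3 * ((1 + r) ^ 3)⁻¹ ≤ 8 := by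
          rw [← div_eq_mul_inv, div_le_iff₀ (by positivity)]
          have : r ^ 3 ≤ (1 + r) ^ 3 := by gcongr; linarith
          nlinarith [pow_pos hr 3]
        rw [← mul_assoc]
        gcongr
      · rw [mul_zero]; positivity
  · have h := lintegral_radial_le (f := fun s => schurMajorant r s)
      (h := fun s => 8 * ((1 + |s - r|) ^ 2)⁻¹)
      (measurable_schurMajorant.comp measurable_prodMk_left)
      (fun s _ => schurMajorant_nonneg hr s)
      ((integrable_inv_one_add_abs_sub_sq r).const_mul 8) (fun s hs => ?_) (fun s => by positivity)
    · rwa [integral_const_mul, integral_inv_one_add_abs_sub_sq] at h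
    · unfold schurMajorant
      split_ifs with hsr
      · have : s ^ 3 * ((1 + r) ^ 3)⁻¹ ≤ 8 := by
          rw [← div_eq_mul_inv, div_le_iff₀ (by positivity)]
          calc s ^ 3 ≤ (2 * (1 + r)) ^ 3 := by gcongr; linarith
            _ = _ := by ring
        rw [← mul_assoc, abs_sub_comm s r]
        gcongr
      · rw [mul_zero]; positivity

/-- The local singularity `|x|⁻²` on the unit ball. -/
noncomputable def localInvSq (x : R4) : ℝ≥0∞ :=
  (Metric.ball (0 : R4) 1).indicator (fun x => ENNReal.ofReal ((‖x‖ ^ 2)⁻¹)) x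

theorem measurable_localInvSq : Measurable localInvSq :=
  Measurable.indicator (by fun_prop) measurableSet_ball

/-- In `ℝ⁴` the function `|x|^{-2t}` is integrable at the origin as long as `2t < 4`. -/
theorem lintegral_localInvSq_rpow_lt_top {t : ℝ} (ht0 : 0 < t) (ht : t < 2) :
    ∫⁻ x, localInvSq x ^ t < ⊤ := by
  have hInt : IntegrableOn (fun x : R4 => ((‖x‖ ^ 2)⁻¹) ^ t) (Metric.ball 0 1) := by
    refine integrableOn_ball_of_norm_le_rpow (by rw [finrank_R4]; norm_num) (C := 1)
      (α := 2 * t) (by rw [finrank_R4]; push_cast; linarith)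
      (Filter.Eventually.of_forall fun x => ?_) (Measurable.aestronglyMeasurable (by fun_prop))
    rw [one_mul, Real.norm_of_nonneg (by positivity), Real.rpow_neg (norm_nonneg x),
      Real.inv_rpow (by positivity), Real.rpow_mul (norm_nonneg x)]
    norm_num
  have h := hInt.lintegral_lt_top
  rw [← lintegral_indicator measurableSet_ball] at h
  refine lt_of_le_of_lt (lintegral_mono fun x => ?_) h
  unfold localInvSq
  by_cases hx : x ∈ Metric.ball (0 : R4) 1
  · rw [indicator_of_mem hx, indicator_of_mem hx, ENNReal.ofReal_rpow_of_nonneg (by positivity)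
      ht0.le]
  · rw [indicator_of_notMem hx, indicator_of_notMem hx, ENNReal.zero_rpow_of_pos ht0]

/-- Young's inequality `L¹ * L^q → L^q` for nonnegative functions. -/
theorem lintegral_conv_rpow_le {u b : R4 → ℝ≥0∞} (hu : Measurable u) (hb : Measurable b) {q : ℝ}
    (hq : 1 ≤ q) :
    ∫⁻ x, (∫⁻ z, u z * b (x - z)) ^ q ≤ (∫⁻ z, u z) ^ q * ∫⁻ x, b x ^ q := by
  have hm : Measurable (Function.uncurry fun x z : R4 => u z * b (x - z) ^ q) := by
    simp only [Function.uncurry_def]; fun_prop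
  calc _ ≤ ∫⁻ x, (∫⁻ z, u z) ^ (q - 1) * ∫⁻ z, u z * b (x - z) ^ q :=
        lintegral_mono fun x => lintegral_mul_rpow_le hu.aemeasurable
          (by fun_prop) hq
    _ = (∫⁻ z, u z) ^ (q - 1) * ∫⁻ z, ∫⁻ x, u z * b (x - z) ^ q := by
        rw [lintegral_const_mul _ hm.lintegral_prod_right,
          lintegral_lintegral_swap hm.aemeasurable]
    _ = (∫⁻ z, u z) ^ (q - 1) * ((∫⁻ z, u z) * ∫⁻ x, b x ^ q) := by
        congr 1
        rw [← lintegral_mul_const _ hu]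
        refine lintegral_congr fun z => ?_
        rw [lintegral_const_mul _ (by fun_prop), lintegral_sub_right_eq_self (fun x => b x ^ q) z]
    _ = _ := by
        rw [← mul_assoc]
        congr 1
        nth_rewrite 2 [← ENNReal.rpow_one (∫⁻ z, u z)]
        rw [← ENNReal.rpow_add_of_nonneg _ _ (by linarith) zero_le_one, sub_add_cancel]

/-- For `q < 2` the singularity is itself in `L^q` and Young's inequality applies. For `q ≥ 2` it is
not, and `u ∈ L²` compensates, by a case of Young's inequality with `u` in `L²`. -/
theorem lintegral_conv_localInvSq_rpow_lt_top {u : R4 → ℝ≥0∞} (hu : Measurable u)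
    (hu1 : ∫⁻ z, u z ≠ ⊤) (hu2 : ∫⁻ z, u z ^ (2 : ℝ) ≠ ⊤) {q : ℝ} (hq : 1 ≤ q) :
    ∫⁻ x, (∫⁻ z, u z * localInvSq (x - z)) ^ q < ⊤ := by
  have hb := measurable_localInvSq
  rcases lt_or_ge q 2 with h | h
  · refine (lintegral_conv_rpow_le hu hb hq).trans_lt ?_
    exact ENNReal.mul_lt_top (ENNReal.rpow_lt_top_of_nonneg (by linarith) hu1)
      (lintegral_localInvSq_rpow_lt_top (by linarith) h)
  · have hq0 : 0 < q := by linarith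
    have hqi : 1 / q ≤ 1 / 2 := by gcongr
    have hqi0 : 0 < 1 / q := by positivity
    set K := ∫⁻ x, localInvSq x ^ (2 - 2 / q) with hK
    have e2 : 2 / q = 2 * (1 / q) := by ring
    have hKt : K < ⊤ := lintegral_localInvSq_rpow_lt_top (by rw [e2]; linarith)
      (by rw [e2]; linarith)
    -- Cauchy–Schwarz after writing `u b = (b^{2-2/q})^{1/2} (u² b^{2/q})^{1/2}`. Since `2 - 2/q <
    -- 2` the first factor has finite integral. Young's inequality with exponent `q/2` handles the
    -- second, as `(b^{2/q})^{q/2} = b` is integrable.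
    have hpt : ∀ x, (∫⁻ z, u z * localInvSq (x - z)) ^ q ≤
        K ^ (q / 2) * (∫⁻ z, u z ^ (2 : ℝ) * localInvSq (x - z) ^ (2 / q)) ^ (q / 2) := by
      intro x
      have hs : ∀ z, u z * localInvSq (x - z) =
          (localInvSq (x - z) ^ (2 - 2 / q)) ^ (1 / 2 : ℝ) *
            (u z ^ (2 : ℝ) * localInvSq (x - z) ^ (2 / q)) ^ (1 / 2 : ℝ) := by
        intro z
        rw [ENNReal.mul_rpow_of_nonneg _ _ (by norm_num), ← ENNReal.rpow_mul, ← ENNReal.rpow_mul,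
          ← ENNReal.rpow_mul, mul_left_comm,
          ← ENNReal.rpow_add_of_nonneg _ _ (by rw [e2]; nlinarith) (by positivity)]
        norm_num
        ring_nf
        simp
      have hH := ENNReal.lintegral_mul_norm_pow_le (μ := (volume : Measure R4))
        (f := fun z => localInvSq (x - z) ^ (2 - 2 / q))
        (g := fun z => u z ^ (2 : ℝ) * localInvSq (x - z) ^ (2 / q)) (by fun_prop) (by fun_prop)
        (p := 1 / 2) (q := 1 / 2) (by norm_num) (by norm_num) (by norm_num)
      simp_rw [← hs] at hH
      rw [lintegral_sub_left_eq_self (fun x => localInvSq x ^ (2 - 2 / q)) x, ← hK] at hH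
      calc _ ≤ (K ^ (1 / 2 : ℝ) *
            (∫⁻ z, u z ^ (2 : ℝ) * localInvSq (x - z) ^ (2 / q)) ^ (1 / 2 : ℝ)) ^ q := by
            gcongr
        _ = _ := by
            rw [ENNReal.mul_rpow_of_nonneg _ _ hq0.le, ← ENNReal.rpow_mul, ← ENNReal.rpow_mul,
              show 1 / 2 * q = q / 2 by ring]
    refine (lintegral_mono hpt).trans_lt ?_
    have hm : Measurable (Function.uncurry fun x z : R4 =>
        u z ^ (2 : ℝ) * localInvSq (x - z) ^ (2 / q)) := by
      simp only [Function.uncurry_def]; fun_prop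
    rw [lintegral_const_mul _ (hm.lintegral_prod_right.pow_const _)]
    refine ENNReal.mul_lt_top (ENNReal.rpow_lt_top_of_nonneg (by positivity) hKt.ne) ?_
    refine (lintegral_conv_rpow_le (u := fun z => u z ^ (2 : ℝ))
      (b := fun x => localInvSq x ^ (2 / q)) (by fun_prop) (by fun_prop)
      (q := q / 2) (by linarith)).trans_lt ?_
    refine ENNReal.mul_lt_top (ENNReal.rpow_lt_top_of_nonneg (by positivity) hu2) ?_
    have : ∀ x, (localInvSq x ^ (2 / q)) ^ (q / 2) = localInvSq x ^ (1 : ℝ) := by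
      intro x
      rw [← ENNReal.rpow_mul]
      congr 1
      field_simp
    simp_rw [this]
    exact lintegral_localInvSq_rpow_lt_top (by norm_num) (by norm_num)

theorem leftMajorant_le {q : ℝ} (hq : 1 ≤ q) (x : R4) :
    ENNReal.ofReal (leftMajorant q ‖x‖) ≤
      localInvSq x + ENNReal.ofReal (4 * (1 + ‖x‖) ^ (-(2 + 3 / q))) := by
  have hn := norm_nonneg x
  by_cases hx : x ∈ Metric.ball (0 : R4) 1
  · refine le_add_right ?_
    rw [localInvSq, indicator_of_mem hx]
    refine ENNReal.ofReal_le_ofReal ?_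
    refine mul_le_of_le_one_right (by positivity) ?_
    exact Real.rpow_le_one_of_one_le_of_nonpos (by linarith) (by rw [neg_nonpos]; positivity)
  · refine le_add_left (ENNReal.ofReal_le_ofReal ?_)
    have h1 : 1 ≤ ‖x‖ := by simpa using hx
    have e : (1 + ‖x‖) ^ (-(2 + 3 / q)) = ((1 + ‖x‖) ^ 2)⁻¹ * (1 + ‖x‖) ^ (-(3 / q)) := by
      rw [neg_add, Real.rpow_add (by positivity), Real.rpow_neg (by positivity) 2]
      norm_num
    rw [leftMajorant, e, ← mul_assoc]
    gcongr
    rw [← div_eq_mul_inv, le_div_iff₀ (by positivity), inv_mul_le_iff₀ (by positivity)]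
    nlinarith

theorem lintegral_one_add_norm_rpow_lt_top {t : ℝ} (ht : 4 < t) :
    ∫⁻ x : R4, ENNReal.ofReal ((1 + ‖x‖) ^ (-t)) < ⊤ :=
  finite_integral_one_add_norm (by rw [finrank_R4]; exact_mod_cast ht)

/-- The singular part is convolved using `u ∈ L¹ ∩ L²`. The tail needs only `u ∈ L¹`, because its
`q`-th power decays with exponent `2q + 3 > 4`. -/
theorem lintegral_conv_leftMajorant_rpow_lt_top {u : R4 → ℝ≥0∞} (hu : Measurable u)
    (hu1 : ∫⁻ z, u z ≠ ⊤) (hu2 : ∫⁻ z, u z ^ (2 : ℝ) ≠ ⊤) {q : ℝ} (hq : 1 ≤ q) :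
    ∫⁻ x, (∫⁻ z, u z * ENNReal.ofReal (leftMajorant q ‖x - z‖)) ^ q < ⊤ := by
  have hb := measurable_localInvSq
  have hq0 : 0 < q := by linarith
  set b₁ : R4 → ℝ≥0∞ := fun x => ENNReal.ofReal (4 * (1 + ‖x‖) ^ (-(2 + 3 / q))) with hb₁
  have hb₁m : Measurable b₁ := by fun_prop
  have hm : ∀ b : R4 → ℝ≥0∞, Measurable b →
      Measurable (Function.uncurry fun x z : R4 => u z * b (x - z)) := by
    intro b hb
    simp only [Function.uncurry_def]; fun_prop
  calc _ ≤ ∫⁻ x, 2 ^ (q - 1) * ((∫⁻ z, u z * localInvSq (x - z)) ^ q +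
        (∫⁻ z, u z * b₁ (x - z)) ^ q) := by
        refine lintegral_mono fun x => ?_
        refine le_trans ?_ (ENNReal.rpow_add_le_mul_rpow_add_rpow _ _ hq)
        rw [← lintegral_add_left (by fun_prop)]
        gcongr with z
        rw [← mul_add]
        gcongr
        exact leftMajorant_le hq _
    _ = 2 ^ (q - 1) * ((∫⁻ x, (∫⁻ z, u z * localInvSq (x - z)) ^ q) +
        ∫⁻ x, (∫⁻ z, u z * b₁ (x - z)) ^ q) := by
        rw [lintegral_const_mul, lintegral_add_left]
        · exact (hm _ hb).lintegral_prod_right.pow_const _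
        · exact ((hm _ hb).lintegral_prod_right.pow_const _).add
            ((hm _ hb₁m).lintegral_prod_right.pow_const _)
    _ < ⊤ := by
        refine ENNReal.mul_lt_top (ENNReal.rpow_lt_top_of_nonneg (by linarith) (by simp))
          (ENNReal.add_lt_top.2 ⟨lintegral_conv_localInvSq_rpow_lt_top hu hu1 hu2 hq, ?_⟩)
        refine (lintegral_conv_rpow_le hu hb₁m hq).trans_lt ?_
        refine ENNReal.mul_lt_top (ENNReal.rpow_lt_top_of_nonneg (by linarith) hu1) ?_
        have e : ∀ x, b₁ x ^ q = ENNReal.ofReal (4 ^ q) *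
            ENNReal.ofReal ((1 + ‖x‖) ^ (-(2 * q + 3))) := by
          intro x
          rw [hb₁, ENNReal.ofReal_rpow_of_nonneg (by positivity) hq0.le,
            Real.mul_rpow (by norm_num) (by positivity), ← Real.rpow_mul (by positivity),
            ENNReal.ofReal_mul (by positivity)]
          congr 3
          field_simp
        simp_rw [e]
        rw [lintegral_const_mul _ (by fun_prop)]
        exact ENNReal.mul_lt_top ENNReal.ofReal_lt_top
          (lintegral_one_add_norm_rpow_lt_top (by linarith))

/-- Hölder's inequality with `q' = q/(q-1)`: the decay exponent `(4 - 7/(2q)) q' = (4q - 7/2)/(q -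
1)` exceeds `4`. For `q = 1` the majorant is merely bounded, with exponent `1/2`. -/
theorem lintegral_rightMajorant_mul_le {q : ℝ} (hq : 1 ≤ q) :
    ∃ C : ℝ≥0∞, C ≠ ⊤ ∧ ∀ g : R4 → ℝ≥0∞, Measurable g → ∀ w : R4,
      ∫⁻ y, ENNReal.ofReal (rightMajorant q ‖w - y‖) * g y ≤ C * (∫⁻ y, g y ^ q) ^ (1 / q) := by
  have hr := measurable_rightMajorant q
  rcases hq.eq_or_lt with rfl | hq1
  · refine ⟨1, by simp, fun g hg w => ?_⟩
    simp only [ENNReal.rpow_one, div_one, one_mul]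
    refine lintegral_mono fun y => ?_
    refine mul_le_of_le_one_left (by simp) ?_
    rw [ENNReal.ofReal_le_one]
    exact Real.rpow_le_one_of_one_le_of_nonpos (by linarith [norm_nonneg (w - y)]) (by norm_num)
  · have hq0 : 0 < q := by linarith
    have hc : (Real.conjExponent q).HolderConjugate q := (Real.HolderConjugate.conjExponent hq1).symm
    set q' := Real.conjExponent q with hq'
    have hq'0 : 0 < q' := hc.pos
    set K := ∫⁻ y : R4, ENNReal.ofReal (rightMajorant q ‖y‖) ^ q' with hK
    have hKt : K < ⊤ := by
      have e : ∀ y : R4, ENNReal.ofReal (rightMajorant q ‖y‖) ^ q' =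
          ENNReal.ofReal ((1 + ‖y‖) ^ (-((4 - 7 / (2 * q)) * q'))) := by
        intro y
        rw [rightMajorant, ENNReal.ofReal_rpow_of_nonneg (by positivity) hq'0.le,
          ← Real.rpow_mul (by positivity), neg_mul]
      simp_rw [hK, e]
      refine lintegral_one_add_norm_rpow_lt_top ?_
      have : q' = q / (q - 1) := rfl
      rw [this]
      have hq2 : 0 < q - 1 := by linarith
      rw [← mul_div_assoc, lt_div_iff₀ hq2]
      have : (4 - 7 / (2 * q)) * q = 4 * q - 7 / 2 := by field_simp
      rw [this]
      linarith
    refine ⟨K ^ (1 / q'), (ENNReal.rpow_lt_top_of_nonneg (by positivity) hKt.ne).ne,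
      fun g hg w => ?_⟩
    have h := ENNReal.lintegral_mul_le_Lp_mul_Lq (volume : Measure R4) hc
      (f := fun y => ENNReal.ofReal (rightMajorant q ‖w - y‖)) (g := g) (by fun_prop)
      hg.aemeasurable
    rwa [lintegral_sub_left_eq_self (fun y => ENNReal.ofReal (rightMajorant q ‖y‖) ^ q') w,
      ← hK] at h

/-! ### Boundedness on `L^q` of the positive operator given by the majorant. -/

/-- The majorant of the kernel of the integrated operator, as a function of the output variable `x`
and the integration variables `(z, w, y)`. -/
noncomputable def kernelMajorant (q : ℝ) (x : R4) (ξ : R4 × R4 × R4) : ℝ≥0∞ :=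
  ENNReal.ofReal (schurMajorant ‖x - ξ.1‖ ‖ξ.2.1 - ξ.2.2‖) +
    ENNReal.ofReal (leftMajorant q ‖x - ξ.1‖) * ENNReal.ofReal (rightMajorant q ‖ξ.2.1 - ξ.2.2‖)

theorem lintegral_prod_mul_snd_fst {u v : R4 → ℝ≥0∞} (hu : Measurable u) (hv : Measurable v)
    {F : R4 → R4 → R4 → ℝ≥0∞}
    (hF : Measurable fun ξ : R4 × R4 × R4 => F ξ.1 ξ.2.1 ξ.2.2) :
    ∫⁻ ξ : R4 × R4 × R4, u ξ.1 * v ξ.2.1 * F ξ.1 ξ.2.1 ξ.2.2 =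
      ∫⁻ z, u z * ∫⁻ w, v w * ∫⁻ y, F z w y := by
  rw [Measure.volume_eq_prod, lintegral_prod _ (by fun_prop)]
  refine lintegral_congr fun z => ?_
  have hFz : Measurable fun p : R4 × R4 => F z p.1 p.2 := hF.comp measurable_prodMk_left
  simp_rw [mul_assoc]
  rw [lintegral_const_mul _ (by fun_prop), Measure.volume_eq_prod,
    lintegral_prod _ (by fun_prop)]
  congr 1
  refine lintegral_congr fun w => ?_
  have hFw : Measurable fun y : R4 => F z w y := hFz.comp measurable_prodMk_left
  exact lintegral_const_mul (v w) hFw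

/-- Schur's test between `x` and the triple `(z, w, y)`. Row integrals are at most `‖u‖₁ ‖v‖₁ C`,
column integrals at most `u(z) v(w) C`, and integrating the latter in `z` and `w` leaves the norm of
`g`. -/
theorem lintegral_schur_part_rpow_le {u v : R4 → ℝ≥0∞} (hu : Measurable u) (hv : Measurable v)
    (hu1 : ∫⁻ z, u z ≠ ⊤) (hv1 : ∫⁻ z, v z ≠ ⊤) {q : ℝ} (hq : 1 ≤ q) :
    ∃ C : ℝ≥0∞, C ≠ ⊤ ∧ ∀ g : R4 → ℝ≥0∞, Measurable g →
      ∫⁻ x, (∫⁻ ξ : R4 × R4 × R4, u ξ.1 * v ξ.2.1 *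
        ENNReal.ofReal (schurMajorant ‖x - ξ.1‖ ‖ξ.2.1 - ξ.2.2‖) * g ξ.2.2) ^ q ≤
      C * ∫⁻ y, g y ^ q := by
  obtain ⟨C, hC, hC1, hC2⟩ := schurMajorant_integral_bound
  have hS : ∀ f h : R4 × R4 × R4 × R4 → ℝ, Measurable f → Measurable h →
      Measurable fun ξ => schurMajorant (f ξ) (h ξ) := fun f h hf hh =>
    measurable_schurMajorant.comp (hf.prodMk hh)
  have hmeas : Measurable (Function.uncurry fun (x : R4) (ξ : R4 × R4 × R4) => u ξ.1 * v ξ.2.1 *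
        ENNReal.ofReal (schurMajorant ‖x - ξ.1‖ ‖ξ.2.1 - ξ.2.2‖)) := by
    simp only [Function.uncurry_def]
    have := hS (fun p => ‖p.1 - p.2.1‖) (fun p => ‖p.2.2.1 - p.2.2.2‖) (by fun_prop) (by fun_prop)
    fun_prop
  refine ⟨((∫⁻ z, u z) * ((∫⁻ w, v w) * C)) ^ (q - 1) * (C * (∫⁻ z, u z) * (∫⁻ w, v w)), ?_,
    fun g hg => ?_⟩
  · refine ENNReal.mul_ne_top (ENNReal.rpow_lt_top_of_nonneg (by linarith) ?_).ne ?_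
    · exact ENNReal.mul_ne_top hu1 (ENNReal.mul_ne_top hv1 hC)
    · exact ENNReal.mul_ne_top (ENNReal.mul_ne_top hC hu1) hv1
  · refine (lintegral_lintegral_mul_rpow_le hmeas hq (C := (∫⁻ z, u z) * ((∫⁻ w, v w) * C))
      (m := fun ξ => u ξ.1 * v ξ.2.1 * C) (fun x => ?_) (fun ξ => ?_)
      (f := fun ξ => g ξ.2.2) (by fun_prop)).trans (le_of_eq ?_)
    · rw [lintegral_prod_mul_snd_fst hu hv
        (F := fun z w y => ENNReal.ofReal (schurMajorant ‖x - z‖ ‖w - y‖))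
        (measurable_schurMajorant.comp (Measurable.prodMk (by fun_prop)
          (by fun_prop))).ennreal_ofReal]
      rw [← lintegral_mul_const _ hv, ← lintegral_mul_const _ hu]
      gcongr with z w
      rw [lintegral_sub_left_eq_self
        (fun y : R4 => ENNReal.ofReal (schurMajorant ‖x - z‖ ‖y‖)) w]
      exact hC2 _ (norm_nonneg _)
    · have hx : Measurable fun x : R4 =>
          ENNReal.ofReal (schurMajorant ‖x - ξ.1‖ ‖ξ.2.1 - ξ.2.2‖) :=
        (measurable_schurMajorant.comp (Measurable.prodMk (by fun_prop)
          measurable_const)).ennreal_ofReal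
      rw [lintegral_const_mul _ hx]
      gcongr
      rw [lintegral_sub_right_eq_self
        (fun x : R4 => ENNReal.ofReal (schurMajorant ‖x‖ ‖ξ.2.1 - ξ.2.2‖)) ξ.1]
      exact hC1 _
    · rw [mul_assoc]
      congr 1
      simp_rw [mul_assoc (u _ * v _)]
      rw [lintegral_prod_mul_snd_fst hu hv (F := fun _ _ y => C * g y ^ q) (by fun_prop),
        lintegral_const_mul _ (by fun_prop), lintegral_mul_const _ hv, lintegral_mul_const _ hu]
      ring

/-- The dependence on `x` factors out as the convolution of `u` with the left majorant, an `L^q`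
function; the integral over `(w, y)` is bounded by a constant times `‖g‖_q`, uniformly in `x`. -/
theorem lintegral_rankOne_part_rpow_le {u v : R4 → ℝ≥0∞} (hu : Measurable u) (hv : Measurable v)
    (hu1 : ∫⁻ z, u z ≠ ⊤) (hu2 : ∫⁻ z, u z ^ (2 : ℝ) ≠ ⊤) (hv1 : ∫⁻ z, v z ≠ ⊤) {q : ℝ}
    (hq : 1 ≤ q) :
    ∃ C : ℝ≥0∞, C ≠ ⊤ ∧ ∀ g : R4 → ℝ≥0∞, Measurable g →
      ∫⁻ x, (∫⁻ ξ : R4 × R4 × R4, u ξ.1 * v ξ.2.1 *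
        (ENNReal.ofReal (leftMajorant q ‖x - ξ.1‖) *
          ENNReal.ofReal (rightMajorant q ‖ξ.2.1 - ξ.2.2‖)) * g ξ.2.2) ^ q ≤
      C * ∫⁻ y, g y ^ q := by
  have hq0 : 0 < q := by linarith
  obtain ⟨K, hK, hKg⟩ := lintegral_rightMajorant_mul_le hq
  have hl := measurable_leftMajorant q
  have hr := measurable_rightMajorant q
  have hfin := lintegral_conv_leftMajorant_rpow_lt_top hu hu1 hu2 hq
  set I0 := ∫⁻ x, (∫⁻ z, u z * ENNReal.ofReal (leftMajorant q ‖x - z‖)) ^ q with hI0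
  refine ⟨I0 * ((∫⁻ w, v w) * K) ^ q, ?_, fun g hg => ?_⟩
  · exact ENNReal.mul_ne_top hfin.ne
      (ENNReal.rpow_lt_top_of_nonneg hq0.le (ENNReal.mul_ne_top hv1 hK)).ne
  · set G := (∫⁻ y, g y ^ q) ^ (1 / q) with hG
    have hGq : G ^ q = ∫⁻ y, g y ^ q := by
      rw [hG, ← ENNReal.rpow_mul, one_div_mul_cancel hq0.ne', ENNReal.rpow_one]
    have hm : Measurable (Function.uncurry fun x z : R4 =>
        u z * ENNReal.ofReal (leftMajorant q ‖x - z‖)) := by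
      simp only [Function.uncurry_def]; fun_prop
    calc _ ≤ ∫⁻ x, (∫⁻ z, u z * ENNReal.ofReal (leftMajorant q ‖x - z‖)) ^ q *
          ((∫⁻ w, v w) * (K * G)) ^ q := by
          refine lintegral_mono fun x => ?_
          rw [← ENNReal.mul_rpow_of_nonneg _ _ hq0.le]
          gcongr
          simp_rw [mul_assoc (u _ * v _)]
          rw [lintegral_prod_mul_snd_fst hu hv (F := fun z w y =>
            ENNReal.ofReal (leftMajorant q ‖x - z‖) * ENNReal.ofReal (rightMajorant q ‖w - y‖) *
              g y) (by fun_prop), ← lintegral_mul_const _ (by fun_prop)]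
          refine lintegral_mono fun z => ?_
          rw [mul_assoc]
          gcongr
          rw [← lintegral_mul_const _ hv, ← lintegral_const_mul _ (by fun_prop)]
          refine lintegral_mono fun w => ?_
          simp_rw [mul_assoc]
          rw [lintegral_const_mul _ (by fun_prop), mul_left_comm]
          gcongr
          exact hKg g hg w
      _ = I0 * ((∫⁻ w, v w) * (K * G)) ^ q := by
          rw [lintegral_mul_const _ (hm.lintegral_prod_right.pow_const _)]
      _ = _ := by
          rw [← mul_assoc (∫⁻ w, v w), ENNReal.mul_rpow_of_nonneg _ _ hq0.le, hGq, mul_assoc]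

/-- The positive operator defined by the kernel majorant is bounded on `L^q`. -/
theorem lintegral_kernelMajorant_rpow_le {u v : R4 → ℝ≥0∞} (hu : Measurable u) (hv : Measurable v)
    (hu1 : ∫⁻ z, u z ≠ ⊤) (hu2 : ∫⁻ z, u z ^ (2 : ℝ) ≠ ⊤) (hv1 : ∫⁻ z, v z ≠ ⊤) {q : ℝ}
    (hq : 1 ≤ q) :
    ∃ C : ℝ≥0∞, C ≠ ⊤ ∧ ∀ g : R4 → ℝ≥0∞, Measurable g →
      ∫⁻ x, (∫⁻ ξ : R4 × R4 × R4, u ξ.1 * v ξ.2.1 * kernelMajorant q x ξ * g ξ.2.2) ^ q ≤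
      C * ∫⁻ y, g y ^ q := by
  obtain ⟨C₁, hC₁, h₁⟩ := lintegral_schur_part_rpow_le hu hv hu1 hv1 hq
  obtain ⟨C₂, hC₂, h₂⟩ := lintegral_rankOne_part_rpow_le hu hv hu1 hu2 hv1 hq
  have hl := measurable_leftMajorant q
  have hr := measurable_rightMajorant q
  refine ⟨2 ^ (q - 1) * (C₁ + C₂), ENNReal.mul_ne_top
    (ENNReal.rpow_lt_top_of_nonneg (by linarith) (by simp)).ne (ENNReal.add_ne_top.2 ⟨hC₁, hC₂⟩),
    fun g hg => ?_⟩
  have hm : Measurable (Function.uncurry fun (x : R4) (ξ : R4 × R4 × R4) => u ξ.1 * v ξ.2.1 *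
      (ENNReal.ofReal (leftMajorant q ‖x - ξ.1‖) *
          ENNReal.ofReal (rightMajorant q ‖ξ.2.1 - ξ.2.2‖)) * g ξ.2.2) := by
    simp only [Function.uncurry_def]
    fun_prop
  have hmx : ∀ x, Measurable fun ξ : R4 × R4 × R4 => u ξ.1 * v ξ.2.1 *
      (ENNReal.ofReal (leftMajorant q ‖x - ξ.1‖) *
          ENNReal.ofReal (rightMajorant q ‖ξ.2.1 - ξ.2.2‖)) * g ξ.2.2 :=
    fun x => hm.comp (measurable_prodMk_left (x := x))
  calc _ ≤ ∫⁻ x, 2 ^ (q - 1) * ((∫⁻ ξ : R4 × R4 × R4, u ξ.1 * v ξ.2.1 *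
        ENNReal.ofReal (schurMajorant ‖x - ξ.1‖ ‖ξ.2.1 - ξ.2.2‖) * g ξ.2.2) ^ q +
        (∫⁻ ξ : R4 × R4 × R4, u ξ.1 * v ξ.2.1 *
        (ENNReal.ofReal (leftMajorant q ‖x - ξ.1‖) *
          ENNReal.ofReal (rightMajorant q ‖ξ.2.1 - ξ.2.2‖)) * g ξ.2.2) ^ q) := by
        refine lintegral_mono fun x => ?_
        refine le_trans ?_ (ENNReal.rpow_add_le_mul_rpow_add_rpow _ _ hq)
        rw [← lintegral_add_right _ (hmx x)]
        gcongr with ξ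
        rw [← add_mul, ← mul_add, kernelMajorant]
    _ ≤ 2 ^ (q - 1) * ((C₁ * ∫⁻ y, g y ^ q) + C₂ * ∫⁻ y, g y ^ q) := by
        rw [lintegral_const_mul' _ _
          (ENNReal.rpow_lt_top_of_nonneg (by linarith) (by simp)).ne,
          lintegral_add_right _ (hm.lintegral_prod_right.pow_const _)]
        gcongr
        · exact h₁ g hg
        · exact h₂ g hg
    _ = _ := by ring

/-! ### Integral operators on `L^p` with an absolutely bounded kernel. -/

/-- Null sets in `y` pull back to null sets in `(z, w, y)`, so the choice of representative of `f`
does not affect `f ξ.2.2` almost everywhere. -/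
theorem quasiMeasurePreserving_snd_snd :
    Measure.QuasiMeasurePreserving (fun ξ : R4 × R4 × R4 => ξ.2.2) volume volume :=
  Measure.quasiMeasurePreserving_snd.comp Measure.quasiMeasurePreserving_snd

/-- A kernel whose absolute value defines a bounded positive operator on `L^p` defines a bounded
operator on `L^p`. -/
theorem exists_continuousLinearMap_of_lintegral_kernel_le {p : ℝ≥0∞} [Fact (1 ≤ p)] (hp : p ≠ ⊤)
    {k : R4 → R4 × R4 × R4 → ℂ} (hk : Measurable (Function.uncurry k)) {C : ℝ≥0∞} (hC : C ≠ ⊤)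
    (hkC : ∀ g : R4 → ℝ≥0∞, Measurable g →
      ∫⁻ x, (∫⁻ ξ, ‖k x ξ‖ₑ * g ξ.2.2) ^ p.toReal ≤ C * ∫⁻ y, g y ^ p.toReal) :
    ∃ T : Lp ℂ p (volume : Measure R4) →L[ℂ] Lp ℂ p (volume : Measure R4),
      ∀ f : Lp ℂ p (volume : Measure R4), T f =ᵐ[volume] fun x => ∫ ξ, k x ξ * f ξ.2.2 := by
  have hp1 : 1 ≤ p := Fact.out
  have hp0 : p ≠ 0 := (zero_lt_one.trans_le hp1).ne'
  have hq0 : 0 < p.toReal := ENNReal.toReal_pos hp0 hp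
  have hfm : ∀ f : Lp ℂ p (volume : Measure R4), Measurable f :=
    fun f => (Lp.stronglyMeasurable f).measurable
  have hint_meas : ∀ f : Lp ℂ p (volume : Measure R4),
      Measurable (Function.uncurry fun x ξ => k x ξ * f ξ.2.2) := fun f =>
    hk.mul ((hfm f).comp (measurable_snd.comp (measurable_snd.comp measurable_snd)))
  have hmeas : ∀ f : Lp ℂ p (volume : Measure R4),
      StronglyMeasurable fun x => ∫ ξ, k x ξ * f ξ.2.2 := fun f =>
    (hint_meas f).stronglyMeasurable.integral_prod_right
  have hfin : ∀ f : Lp ℂ p (volume : Measure R4), ∫⁻ y, ‖f y‖ₑ ^ p.toReal ≠ ⊤ := fun f =>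
    (lintegral_rpow_enorm_lt_top_of_eLpNorm_lt_top hp0 hp (Lp.memLp f).2).ne
  have hpos_meas : ∀ f : Lp ℂ p (volume : Measure R4),
      Measurable fun x => ∫⁻ ξ, ‖k x ξ‖ₑ * ‖f ξ.2.2‖ₑ := fun f =>
    (hk.enorm.mul ((hfm f).enorm.comp
      (measurable_snd.comp (measurable_snd.comp measurable_snd)))).lintegral_prod_right'
  have hnorm : ∀ f : Lp ℂ p (volume : Measure R4),
      eLpNorm (fun x => ∫ ξ, k x ξ * f ξ.2.2) p volume ≤
        C ^ (1 / p.toReal) * eLpNorm f p volume := by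
    intro f
    rw [eLpNorm_eq_lintegral_rpow_enorm_toReal hp0 hp, eLpNorm_eq_lintegral_rpow_enorm_toReal hp0 hp,
      ← ENNReal.mul_rpow_of_nonneg _ _ (by positivity)]
    gcongr
    refine le_trans (lintegral_mono fun x => ?_) (hkC (fun y => ‖f y‖ₑ) (hfm f).enorm)
    gcongr
    refine (enorm_integral_le_lintegral_enorm _).trans (le_of_eq ?_)
    simp_rw [enorm_mul]
  have hCq : C ^ (1 / p.toReal) ≠ ⊤ := (ENNReal.rpow_lt_top_of_nonneg (by positivity) hC).ne
  have hmem : ∀ f : Lp ℂ p (volume : Measure R4),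
      MemLp (fun x => ∫ ξ, k x ξ * f ξ.2.2) p volume := fun f =>
    ⟨(hmeas f).aestronglyMeasurable,
      (hnorm f).trans_lt (ENNReal.mul_lt_top hCq.lt_top (Lp.memLp f).2)⟩
  -- Additivity of the Bochner integral needs actual integrability; it holds for almost every `x`
  -- because the positive operator has finite `L^p` norm.
  have hinteg : ∀ f : Lp ℂ p (volume : Measure R4), ∀ᵐ x, Integrable fun ξ => k x ξ * f ξ.2.2 := by
    intro f
    have h := (hkC (fun y => ‖f y‖ₑ) (hfm f).enorm).trans_lt
      (ENNReal.mul_lt_top hC.lt_top (hfin f).lt_top)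
    filter_upwards [ae_lt_top ((hpos_meas f).pow_const _) h.ne] with x hx
    refine ⟨((hint_meas f).comp (measurable_prodMk_left (x := x))).aestronglyMeasurable, ?_⟩
    rw [hasFiniteIntegral_iff_enorm]
    simp_rw [enorm_mul]
    exact (ENNReal.rpow_lt_top_iff_of_pos hq0).1 hx
  let T₀ : Lp ℂ p (volume : Measure R4) →ₗ[ℂ] Lp ℂ p (volume : Measure R4) :=
    { toFun := fun f => (hmem f).toLp _
      map_add' := by
        intro f g
        rw [← MemLp.toLp_add, MemLp.toLp_eq_toLp_iff]
        filter_upwards [hinteg f, hinteg g] with x hf hg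
        rw [Pi.add_apply, ← integral_add hf hg]
        refine integral_congr_ae ?_
        filter_upwards [quasiMeasurePreserving_snd_snd.ae_eq_comp (Lp.coeFn_add f g)] with ξ hξ
        simp only [Function.comp_apply, Pi.add_apply] at hξ
        rw [hξ]
        ring
      map_smul' := by
        intro c f
        rw [RingHom.id_apply, ← MemLp.toLp_const_smul, MemLp.toLp_eq_toLp_iff]
        refine Filter.Eventually.of_forall fun x => ?_
        simp only [Pi.smul_apply, smul_eq_mul]
        rw [← integral_const_mul]
        refine integral_congr_ae ?_
        filter_upwards [quasiMeasurePreserving_snd_snd.ae_eq_comp (Lp.coeFn_smul c f)] with ξ hξ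
        simp only [Function.comp_apply, Pi.smul_apply, smul_eq_mul] at hξ
        rw [hξ]
        ring }
  refine ⟨T₀.mkContinuous (C ^ (1 / p.toReal)).toReal fun f => ?_, fun f => ?_⟩
  · change ‖(hmem f).toLp _‖ ≤ _
    rw [Lp.norm_toLp, Lp.norm_def, ← ENNReal.toReal_mul]
    exact ENNReal.toReal_mono (ENNReal.mul_ne_top hCq (Lp.memLp f).2.ne) (hnorm f)
  · exact (hmem f).coeFn_toLp

/-! ### Measurability and size of the resolvent kernels. -/

theorem resolventKernelMinus_eq_conj (lam r : ℝ) :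
    resolventKernelMinus lam r = (starRingEnd ℂ) (resolventKernelPlus lam r) := by
  simp only [resolventKernelMinus, resolventKernelPlus, map_mul, map_neg, map_sub,
    Complex.conj_ofReal, Complex.conj_I]
  ring

theorem measurable_resolventKernelPlus :
    Measurable (Function.uncurry resolventKernelPlus) := by
  have h : Function.uncurry resolventKernelPlus = fun q : ℝ × ℝ => if q.2 = 0 then 0 else
      ((q.1 ^ 2 / (4 * Real.pi ^ 2) : ℝ) : ℂ) * hankelB (q.1 * q.2) := by
    ext q
    rcases eq_or_ne q.2 0 with hq | hq
    · simp [Function.uncurry_def, hq, resolventKernelPlus]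
    · rw [if_neg hq]
      exact resolventKernelPlus_eq hq
  rw [h]
  have := measurable_hankelB
  exact Measurable.ite (measurable_snd (measurableSet_singleton 0)) measurable_const (by fun_prop)

/-- The kernel of `R₀⁺(lam²) - R₀⁻(lam²)`. -/
noncomputable def resolventKernelDiff (lam r : ℝ) : ℂ :=
  resolventKernelPlus lam r - resolventKernelMinus lam r

theorem measurable_resolventKernelDiff :
    Measurable (Function.uncurry resolventKernelDiff) := by
  have h : Function.uncurry resolventKernelDiff = fun q : ℝ × ℝ =>
      Function.uncurry resolventKernelPlus q -
        (starRingEnd ℂ) (Function.uncurry resolventKernelPlus q) := by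
    ext q
    exact congrArg _ (resolventKernelMinus_eq_conj q.1 q.2)
  rw [h]
  exact measurable_resolventKernelPlus.sub
    (Complex.continuous_conj.measurable.comp measurable_resolventKernelPlus)

/-- From `t + t² ≤ 1 + 2t²` with `t = 1/(lam r)`. Decoupling `lam` from `r` in this way makes
convergence at a point a condition that does not involve `lam`. -/
theorem enorm_resolventKernelPlus_le {lam r : ℝ} (hlam : 0 < lam) (hr : 0 ≤ r) :
    ‖resolventKernelPlus lam r‖ₑ ≤ ENNReal.ofReal (lam ^ 2) + 2 * ENNReal.ofReal ((r ^ 2)⁻¹) := by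
  have e2 : (2 : ℝ≥0∞) = ENNReal.ofReal 2 := by simp
  rw [e2, ← ENNReal.ofReal_mul zero_le_two, ← ENNReal.ofReal_add (by positivity) (by positivity),
    ← ofReal_norm]
  refine ENNReal.ofReal_le_ofReal ?_
  rcases hr.eq_or_lt with rfl | hr
  · simp [resolventKernelPlus]
    positivity
  · rw [resolventKernelPlus_eq hr.ne', norm_mul, Complex.norm_real,
      Real.norm_of_nonneg (by positivity)]
    have hb := norm_hankelB_le (mul_pos hlam hr)
    have hpi : 1 ≤ Real.pi ^ 2 := one_le_pow₀ (by linarith [Real.pi_gt_three])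
    set t := (lam * r)⁻¹ with ht
    have h1 : lam ^ 2 / (4 * Real.pi ^ 2) ≤ lam ^ 2 / 4 := by
      gcongr
      linarith
    have h2 : ((lam * r) ^ 2)⁻¹ = t ^ 2 := by rw [ht, inv_pow]
    rw [h2] at hb
    have h3 : lam ^ 2 * t ^ 2 = (r ^ 2)⁻¹ := by rw [ht]; field_simp
    calc _ ≤ lam ^ 2 / 4 * (4 * (t + t ^ 2)) := by gcongr
      _ = lam ^ 2 * (t + t ^ 2) := by ring
      _ ≤ lam ^ 2 * (1 + 2 * t ^ 2) :=
          mul_le_mul_of_nonneg_left (by nlinarith [sq_nonneg (t - 1)]) (by positivity)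
      _ = _ := by rw [← h3]; ring

theorem enorm_resolventKernelMinus (lam r : ℝ) :
    ‖resolventKernelMinus lam r‖ₑ = ‖resolventKernelPlus lam r‖ₑ := by
  rw [resolventKernelMinus_eq_conj, ← ofReal_norm, RCLike.norm_conj, ofReal_norm]

/-- The singular `Y₁` terms cancel, leaving a kernel bounded in `r`; it sends `L¹` into `L^∞`. -/
theorem enorm_resolventKernelDiff_le (lam : ℝ) (r : ℝ) :
    ‖resolventKernelDiff lam r‖ₑ ≤ ENNReal.ofReal (lam ^ 2) := by
  rw [← ofReal_norm]
  refine ENNReal.ofReal_le_ofReal ?_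
  rcases eq_or_ne r 0 with rfl | hr
  · simp [resolventKernelDiff, resolventKernelPlus, resolventKernelMinus]
    positivity
  · rw [resolventKernelDiff, resolventKernelPlus_sub_minus hr, norm_mul, Complex.norm_I, one_mul,
      Complex.norm_real, norm_mul, Real.norm_of_nonneg (by positivity), Real.norm_eq_abs]
    have hpi : 1 ≤ Real.pi ^ 2 := one_le_pow₀ (by linarith [Real.pi_gt_three])
    calc _ ≤ lam ^ 2 / (2 * Real.pi ^ 2) * 1 := by gcongr; exact abs_poissonJ_le _
      _ ≤ lam ^ 2 := by
          rw [mul_one]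
          exact div_le_self (by positivity) (by linarith)

theorem measurable_spectralKernel {Φ : ℝ → ℝ} (hΦ : Measurable Φ) :
    Measurable (Function.uncurry (spectralKernel Φ)) := by
  have hP := measurable_resolventKernelPlus
  have hD := measurable_resolventKernelDiff
  have h : Measurable (Function.uncurry fun (q : ℝ × ℝ) (lam : ℝ) =>
      Function.uncurry resolventKernelPlus (lam, q.1) *
        Function.uncurry resolventKernelDiff (lam, q.2) *
        ((Φ lam * lam * Real.log lam : ℝ) : ℂ)) := by
    simp only [Function.uncurry_def] at hP hD ⊢
    fun_prop
  exact (h.stronglyMeasurable.integral_prod_right (ν := volume.restrict (Ioi 0))).measurable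

/-- The singularity is locally integrable and bounded elsewhere, so the convolution with an `L¹`
function is finite almost everywhere. The exceptional null set is the same for all frequencies. -/
theorem ae_lintegral_mul_inv_sq_lt_top {F : R4 → ℝ≥0∞} (hF : Measurable F)
    (hF1 : ∫⁻ z, F z ≠ ⊤) :
    ∀ᵐ x : R4, ∫⁻ z, F z * ENNReal.ofReal ((‖x - z‖ ^ 2)⁻¹) < ⊤ := by
  have hb := measurable_localInvSq
  have hm : Measurable (Function.uncurry fun x z : R4 => F z * localInvSq (x - z)) := by
    simp only [Function.uncurry_def]; fun_prop
  have hfin : ∫⁻ x, ∫⁻ z, F z * localInvSq (x - z) ≠ ⊤ := by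
    have h := lintegral_conv_rpow_le hF hb le_rfl
    simp only [ENNReal.rpow_one] at h
    have h1 := lintegral_localInvSq_rpow_lt_top (t := 1) (by norm_num) (by norm_num)
    simp only [ENNReal.rpow_one] at h1
    exact (h.trans_lt (ENNReal.mul_lt_top hF1.lt_top h1)).ne
  filter_upwards [ae_lt_top hm.lintegral_prod_right hfin] with x hx
  calc _ ≤ ∫⁻ z, (F z * localInvSq (x - z) + F z) := by
        refine lintegral_mono fun z => ?_
        have : ENNReal.ofReal ((‖x - z‖ ^ 2)⁻¹) ≤ localInvSq (x - z) + 1 := by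
          by_cases hxz : x - z ∈ Metric.ball (0 : R4) 1
          · rw [localInvSq, indicator_of_mem hxz]
            exact le_self_add
          · refine le_add_left ?_
            rw [ENNReal.ofReal_le_one]
            have h1 : 1 ≤ ‖x - z‖ := by simpa using hxz
            exact inv_le_one_of_one_le₀ (one_le_pow₀ h1)
        calc _ ≤ F z * (localInvSq (x - z) + 1) := by gcongr
          _ = _ := by rw [mul_add, mul_one]
    _ = (∫⁻ z, F z * localInvSq (x - z)) + ∫⁻ z, F z := lintegral_add_right _ hF
    _ < ⊤ := ENNReal.add_lt_top.2 ⟨hx, hF1.lt_top⟩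

/-! ### Absolute convergence of the iterated integrals and Fubini. -/

section Convergence

variable {f : R4 → ℂ}

theorem lintegral_enorm_resolventKernelPlus_mul_lt_top {F : R4 → ℝ≥0∞} (hF : Measurable F)
    (hF1 : ∫⁻ z, F z ≠ ⊤) {w : R4}
    (hw : ∫⁻ y, F y * ENNReal.ofReal ((‖w - y‖ ^ 2)⁻¹) < ⊤) {lam : ℝ} (hlam : 0 < lam) :
    ∫⁻ y, ‖resolventKernelPlus lam ‖w - y‖‖ₑ * F y < ⊤ := by
  calc _ ≤ ∫⁻ y, (ENNReal.ofReal (lam ^ 2) * F y +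
        2 * (F y * ENNReal.ofReal ((‖w - y‖ ^ 2)⁻¹))) := by
        refine lintegral_mono fun y => ?_
        refine (mul_le_mul_left (enorm_resolventKernelPlus_le hlam (norm_nonneg _)) _).trans
          (le_of_eq ?_)
        ring
    _ = ENNReal.ofReal (lam ^ 2) * (∫⁻ y, F y) +
        2 * ∫⁻ y, F y * ENNReal.ofReal ((‖w - y‖ ^ 2)⁻¹) := by
        rw [lintegral_add_left (by fun_prop), lintegral_const_mul _ hF,
          lintegral_const_mul _ (by fun_prop)]
    _ < ⊤ := ENNReal.add_lt_top.2 ⟨ENNReal.mul_lt_top ENNReal.ofReal_lt_top hF1.lt_top,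
        ENNReal.mul_lt_top (by simp) hw⟩

theorem measurable_resolventKernelPlus_norm_sub (lam : ℝ) (w : R4) :
    Measurable fun y : R4 => resolventKernelPlus lam ‖w - y‖ :=
  measurable_resolventKernelPlus.comp (Measurable.prodMk measurable_const (by fun_prop))

theorem integrable_resolventKernelPlus_mul (hf : Measurable f) (hf1 : ∫⁻ y, ‖f y‖ₑ ≠ ⊤) {w : R4}
    (hw : ∫⁻ y, ‖f y‖ₑ * ENNReal.ofReal ((‖w - y‖ ^ 2)⁻¹) < ⊤) {lam : ℝ} (hlam : 0 < lam) :
    Integrable fun y => resolventKernelPlus lam ‖w - y‖ * f y := by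
  refine ⟨((measurable_resolventKernelPlus_norm_sub lam w).mul hf).aestronglyMeasurable, ?_⟩
  rw [hasFiniteIntegral_iff_enorm]
  simp_rw [enorm_mul]
  exact lintegral_enorm_resolventKernelPlus_mul_lt_top hf.enorm hf1 hw hlam

theorem integrable_resolventKernelMinus_mul (hf : Measurable f) (hf1 : ∫⁻ y, ‖f y‖ₑ ≠ ⊤)
    {w : R4} (hw : ∫⁻ y, ‖f y‖ₑ * ENNReal.ofReal ((‖w - y‖ ^ 2)⁻¹) < ⊤) {lam : ℝ}
    (hlam : 0 < lam) :
    Integrable fun y => resolventKernelMinus lam ‖w - y‖ * f y := by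
  refine ⟨?_, ?_⟩
  · simp_rw [resolventKernelMinus_eq_conj]
    exact ((Complex.continuous_conj.measurable.comp
      (measurable_resolventKernelPlus_norm_sub lam w)).mul hf).aestronglyMeasurable
  · rw [hasFiniteIntegral_iff_enorm]
    simp_rw [enorm_mul, enorm_resolventKernelMinus]
    exact lintegral_enorm_resolventKernelPlus_mul_lt_top hf.enorm hf1 hw hlam

/-- The operator with kernel `R₀⁺(lam²) - R₀⁻(lam²)`. -/
noncomputable def resolventDiffIntegral (lam : ℝ) (f : R4 → ℂ) (w : R4) : ℂ :=
  ∫ y, resolventKernelDiff lam ‖w - y‖ * f y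

/-- The two resolvent integrals can be subtracted under the integral sign only where both converge,
hence only for almost every `w`. -/
theorem resolventDiff_ae_eq (hf : Measurable f) (hf1 : ∫⁻ y, ‖f y‖ₑ ≠ ⊤) {lam : ℝ}
    (hlam : 0 < lam) : resolventDiff lam f =ᵐ[volume] resolventDiffIntegral lam f := by
  filter_upwards [ae_lintegral_mul_inv_sq_lt_top hf.enorm hf1] with w hw
  rw [resolventDiff, freeResolventPlus, freeResolventMinus,
    ← integral_sub (integrable_resolventKernelPlus_mul hf hf1 hw hlam)
      (integrable_resolventKernelMinus_mul hf hf1 hw hlam), resolventDiffIntegral]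
  simp_rw [resolventKernelDiff, sub_mul]

theorem measurable_resolventDiffIntegral (hf : Measurable f) (lam : ℝ) :
    Measurable (resolventDiffIntegral lam f) := by
  have h : Measurable (Function.uncurry fun w y : R4 => resolventKernelDiff lam ‖w - y‖ * f y) :=
    (measurable_resolventKernelDiff.comp
      (Measurable.prodMk measurable_const (by fun_prop))).mul (hf.comp measurable_snd)
  exact h.stronglyMeasurable.integral_prod_right.measurable

theorem enorm_resolventDiffIntegral_le (hf : Measurable f) (lam : ℝ) (w : R4) :
    ‖resolventDiffIntegral lam f w‖ₑ ≤ ENNReal.ofReal (lam ^ 2) * ∫⁻ y, ‖f y‖ₑ := by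
  refine (enorm_integral_le_lintegral_enorm _).trans ?_
  rw [← lintegral_const_mul _ hf.enorm]
  refine lintegral_mono fun y => ?_
  rw [enorm_mul]
  gcongr
  exact enorm_resolventKernelDiff_le _ _

variable {L : R4 → R4 → ℂ} {U : R4 → ℝ} {A : ℝ≥0∞}

theorem integrable_kernel_mul_resolventDiffIntegral (hL : Measurable (Function.uncurry L))
    (hU : Measurable U) (hA : A ≠ ⊤) (hLU : ∀ z w, ‖L z w‖ₑ ≤ A * ‖U z‖ₑ * ‖U w‖ₑ)
    (hU1 : ∫⁻ z, ‖U z‖ₑ ≠ ⊤) (hf : Measurable f) (hf1 : ∫⁻ y, ‖f y‖ₑ ≠ ⊤) (lam : ℝ) (z : R4) :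
    (∫⁻ w, ‖L z w * resolventDiffIntegral lam f w‖ₑ ≤
      A * ‖U z‖ₑ * ((∫⁻ w, ‖U w‖ₑ) * (ENNReal.ofReal (lam ^ 2) * ∫⁻ y, ‖f y‖ₑ))) ∧
    Integrable fun w => L z w * resolventDiffIntegral lam f w := by
  have hle : ∫⁻ w, ‖L z w * resolventDiffIntegral lam f w‖ₑ ≤
      A * ‖U z‖ₑ * ((∫⁻ w, ‖U w‖ₑ) * (ENNReal.ofReal (lam ^ 2) * ∫⁻ y, ‖f y‖ₑ)) := by
    rw [← lintegral_mul_const _ hU.enorm, ← lintegral_const_mul _ (by fun_prop)]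
    refine lintegral_mono fun w => ?_
    rw [enorm_mul, ← mul_assoc]
    gcongr
    · exact hLU z w
    · exact enorm_resolventDiffIntegral_le hf lam w
  refine ⟨hle, ((hL.comp measurable_prodMk_left).mul
    (measurable_resolventDiffIntegral hf lam)).aestronglyMeasurable, ?_⟩
  rw [hasFiniteIntegral_iff_enorm]
  refine hle.trans_lt ?_
  exact ENNReal.mul_lt_top (ENNReal.mul_lt_top hA.lt_top enorm_lt_top)
    (ENNReal.mul_lt_top hU1.lt_top (ENNReal.mul_lt_top ENNReal.ofReal_lt_top hf1.lt_top))

theorem integrable_resolventKernelPlus_mul_kernel (hL : Measurable (Function.uncurry L))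
    (hU : Measurable U) (hA : A ≠ ⊤) (hLU : ∀ z w, ‖L z w‖ₑ ≤ A * ‖U z‖ₑ * ‖U w‖ₑ)
    (hU1 : ∫⁻ z, ‖U z‖ₑ ≠ ⊤) (hf : Measurable f) (hf1 : ∫⁻ y, ‖f y‖ₑ ≠ ⊤) {x : R4}
    (hx : ∫⁻ z, ‖U z‖ₑ * ENNReal.ofReal ((‖x - z‖ ^ 2)⁻¹) < ⊤) {lam : ℝ} (hlam : 0 < lam) :
    Integrable fun z => resolventKernelPlus lam ‖x - z‖ *
      ∫ w, L z w * resolventDiffIntegral lam f w := by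
  have hm : Measurable (Function.uncurry fun z w => L z w * resolventDiffIntegral lam f w) :=
    hL.mul ((measurable_resolventDiffIntegral hf lam).comp measurable_snd)
  refine ⟨((measurable_resolventKernelPlus_norm_sub lam x).mul
    hm.stronglyMeasurable.integral_prod_right.measurable).aestronglyMeasurable, ?_⟩
  rw [hasFiniteIntegral_iff_enorm]
  set B := (∫⁻ w, ‖U w‖ₑ) * (ENNReal.ofReal (lam ^ 2) * ∫⁻ y, ‖f y‖ₑ) with hB
  have hBt : B < ⊤ :=
    ENNReal.mul_lt_top hU1.lt_top (ENNReal.mul_lt_top ENNReal.ofReal_lt_top hf1.lt_top)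
  calc _ ≤ ∫⁻ z, (A * B) * (‖resolventKernelPlus lam ‖x - z‖‖ₑ * ‖U z‖ₑ) := by
        refine lintegral_mono fun z => ?_
        rw [enorm_mul]
        refine (mul_le_mul_right ((enorm_integral_le_lintegral_enorm _).trans
          (integrable_kernel_mul_resolventDiffIntegral hL hU hA hLU hU1 hf hf1 lam z).1) _).trans
          (le_of_eq ?_)
        ring
    _ < ⊤ := by
        have := measurable_resolventKernelPlus_norm_sub lam x
        rw [lintegral_const_mul _ (by fun_prop)]
        exact ENNReal.mul_lt_top (ENNReal.mul_lt_top hA.lt_top hBt)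
          (lintegral_enorm_resolventKernelPlus_mul_lt_top hU.enorm hU1 hx hlam)

/-- The integrand in all variables of the iterated integral at the frequency `lam`. -/
noncomputable def fullIntegrand (L : R4 → R4 → ℂ) (f : R4 → ℂ) (x : R4) (lam : ℝ)
    (ξ : R4 × R4 × R4) : ℂ :=
  resolventKernelPlus lam ‖x - ξ.1‖ *
    (L ξ.1 ξ.2.1 * (resolventKernelDiff lam ‖ξ.2.1 - ξ.2.2‖ * f ξ.2.2))

set_option maxHeartbeats 1000000 in
theorem measurable_fullIntegrand (hL : Measurable (Function.uncurry L)) (hf : Measurable f)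
    (x : R4) : Measurable (Function.uncurry (fullIntegrand L f x)) := by
  have h1 : Measurable fun q : ℝ × R4 × R4 × R4 => resolventKernelPlus q.1 ‖x - q.2.1‖ :=
    measurable_resolventKernelPlus.comp (Measurable.prodMk measurable_fst (by fun_prop))
  have h2 : Measurable fun q : ℝ × R4 × R4 × R4 =>
      resolventKernelDiff q.1 ‖q.2.2.1 - q.2.2.2‖ :=
    measurable_resolventKernelDiff.comp (Measurable.prodMk measurable_fst (by fun_prop))
  have h3 : Measurable fun q : ℝ × R4 × R4 × R4 => L q.2.1 q.2.2.1 :=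
    hL.comp (Measurable.prodMk (by fun_prop) (by fun_prop))
  have h4 : Measurable fun q : ℝ × R4 × R4 × R4 => f q.2.2.2 := by fun_prop
  have h : Function.uncurry (fullIntegrand L f x) = fun q : ℝ × R4 × R4 × R4 =>
      resolventKernelPlus q.1 ‖x - q.2.1‖ *
        (L q.2.1 q.2.2.1 * (resolventKernelDiff q.1 ‖q.2.2.1 - q.2.2.2‖ * f q.2.2.2)) := rfl
  rw [h]
  fun_prop

theorem lintegral_enorm_fullIntegrand_le (hU : Measurable U)
    (hLU : ∀ z w, ‖L z w‖ₑ ≤ A * ‖U z‖ₑ * ‖U w‖ₑ) (hf : Measurable f) (x : R4) {lam : ℝ}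
    (hlam : 0 < lam) :
    ∫⁻ ξ, ‖fullIntegrand L f x lam ξ‖ₑ ≤
      (A * (∫⁻ w, ‖U w‖ₑ) * ∫⁻ y, ‖f y‖ₑ) *
        ((∫⁻ z, ‖U z‖ₑ) * ENNReal.ofReal (lam ^ 4) +
          2 * (∫⁻ z, ‖U z‖ₑ * ENNReal.ofReal ((‖x - z‖ ^ 2)⁻¹)) * ENNReal.ofReal (lam ^ 2)) := by
  calc _ ≤ ∫⁻ ξ : R4 × R4 × R4, (ENNReal.ofReal (lam ^ 2) * ‖U ξ.1‖ₑ +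
        2 * (‖U ξ.1‖ₑ * ENNReal.ofReal ((‖x - ξ.1‖ ^ 2)⁻¹))) * ‖U ξ.2.1‖ₑ *
        (A * ENNReal.ofReal (lam ^ 2) * ‖f ξ.2.2‖ₑ) := by
        refine lintegral_mono fun ξ => ?_
        rw [fullIntegrand, enorm_mul, enorm_mul, enorm_mul]
        calc _ ≤ (ENNReal.ofReal (lam ^ 2) + 2 * ENNReal.ofReal ((‖x - ξ.1‖ ^ 2)⁻¹)) *
              ((A * ‖U ξ.1‖ₑ * ‖U ξ.2.1‖ₑ) * (ENNReal.ofReal (lam ^ 2) * ‖f ξ.2.2‖ₑ)) := by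
              gcongr
              · exact enorm_resolventKernelPlus_le hlam (norm_nonneg _)
              · exact hLU _ _
              · exact enorm_resolventKernelDiff_le _ _
          _ = _ := by ring
    _ = _ := by
        rw [lintegral_prod_mul_snd_fst
          (u := fun z => ENNReal.ofReal (lam ^ 2) * ‖U z‖ₑ +
            2 * (‖U z‖ₑ * ENNReal.ofReal ((‖x - z‖ ^ 2)⁻¹))) (v := fun w => ‖U w‖ₑ)
          (by fun_prop) hU.enorm (F := fun _ _ y => A * ENNReal.ofReal (lam ^ 2) * ‖f y‖ₑ)
          (by fun_prop), lintegral_const_mul _ hf.enorm, lintegral_mul_const _ hU.enorm,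
          lintegral_mul_const _ (by fun_prop), lintegral_add_left (by fun_prop),
          lintegral_const_mul _ hU.enorm, lintegral_const_mul _ (by fun_prop),
          show lam ^ 4 = lam ^ 2 * lam ^ 2 by ring, ENNReal.ofReal_mul (by positivity)]
        ring

theorem integrable_fullIntegrand (hL : Measurable (Function.uncurry L))
    (hU : Measurable U) (hA : A ≠ ⊤) (hLU : ∀ z w, ‖L z w‖ₑ ≤ A * ‖U z‖ₑ * ‖U w‖ₑ)
    (hU1 : ∫⁻ z, ‖U z‖ₑ ≠ ⊤) (hf : Measurable f) (hf1 : ∫⁻ y, ‖f y‖ₑ ≠ ⊤) {x : R4}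
    (hx : ∫⁻ z, ‖U z‖ₑ * ENNReal.ofReal ((‖x - z‖ ^ 2)⁻¹) < ⊤) {lam : ℝ} (hlam : 0 < lam) :
    Integrable (fullIntegrand L f x lam) := by
  refine ⟨((measurable_fullIntegrand hL hf x).comp measurable_prodMk_left).aestronglyMeasurable, ?_⟩
  rw [hasFiniteIntegral_iff_enorm]
  refine (lintegral_enorm_fullIntegrand_le hU hLU hf x hlam).trans_lt ?_
  refine ENNReal.mul_lt_top (ENNReal.mul_lt_top (ENNReal.mul_lt_top hA.lt_top hU1.lt_top)
    hf1.lt_top) (ENNReal.add_lt_top.2 ⟨?_, ?_⟩)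
  · exact ENNReal.mul_lt_top hU1.lt_top ENNReal.ofReal_lt_top
  · exact ENNReal.mul_lt_top (ENNReal.mul_lt_top (by simp) hx) ENNReal.ofReal_lt_top

theorem integral_fullIntegrand (hL : Measurable (Function.uncurry L))
    (hU : Measurable U) (hA : A ≠ ⊤) (hLU : ∀ z w, ‖L z w‖ₑ ≤ A * ‖U z‖ₑ * ‖U w‖ₑ)
    (hU1 : ∫⁻ z, ‖U z‖ₑ ≠ ⊤) (hf : Measurable f) (hf1 : ∫⁻ y, ‖f y‖ₑ ≠ ⊤) {x : R4}
    (hx : ∫⁻ z, ‖U z‖ₑ * ENNReal.ofReal ((‖x - z‖ ^ 2)⁻¹) < ⊤) {lam : ℝ} (hlam : 0 < lam) :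
    ∫ ξ, fullIntegrand L f x lam ξ = ∫ z, resolventKernelPlus lam ‖x - z‖ *
      ∫ w, L z w * resolventDiffIntegral lam f w := by
  have hInt := integrable_fullIntegrand hL hU hA hLU hU1 hf hf1 hx hlam
  rw [Measure.volume_eq_prod] at hInt ⊢
  rw [integral_prod _ hInt]
  refine integral_congr_ae ?_
  filter_upwards [hInt.prod_right_ae] with z hz
  rw [Measure.volume_eq_prod] at hz ⊢
  rw [integral_prod _ hz]
  simp only [fullIntegrand]
  simp_rw [integral_const_mul]
  rfl

set_option maxHeartbeats 1000000 in
theorem integrable_fullIntegrand_mul (hL : Measurable (Function.uncurry L))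
    (hU : Measurable U) (hA : A ≠ ⊤) (hLU : ∀ z w, ‖L z w‖ₑ ≤ A * ‖U z‖ₑ * ‖U w‖ₑ)
    (hU1 : ∫⁻ z, ‖U z‖ₑ ≠ ⊤) (hf : Measurable f) (hf1 : ∫⁻ y, ‖f y‖ₑ ≠ ⊤) {x : R4}
    (hx : ∫⁻ z, ‖U z‖ₑ * ENNReal.ofReal ((‖x - z‖ ^ 2)⁻¹) < ⊤) {Φ : ℝ → ℝ} (hΦ : Continuous Φ)
    (hΦc : HasCompactSupport Φ) :
    Integrable (Function.uncurry fun (lam : ℝ) (ξ : R4 × R4 × R4) =>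
      fullIntegrand L f x lam ξ * ((Φ lam * lam * Real.log lam : ℝ) : ℂ))
      ((volume.restrict (Ioi 0)).prod volume) := by
  have hm : Measurable (Function.uncurry fun (lam : ℝ) (ξ : R4 × R4 × R4) =>
      fullIntegrand L f x lam ξ * ((Φ lam * lam * Real.log lam : ℝ) : ℂ)) := by
    have h1 := measurable_fullIntegrand hL hf x
    have h2 := hΦ.measurable
    have h3 : Measurable fun lam : ℝ => ((Φ lam * lam * Real.log lam : ℝ) : ℂ) := by fun_prop
    exact h1.mul (h3.comp measurable_fst)
  refine ⟨hm.aestronglyMeasurable, ?_⟩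
  rw [hasFiniteIntegral_iff_enorm, lintegral_prod _ hm.enorm.aemeasurable]
  -- `lam log lam` is continuous on the whole line and `Φ` has compact support, so all these moments
  -- are finite; `n = 4` and `n = 2` are used.
  have hmom : ∀ n : ℕ, ∫⁻ lam in Ioi (0 : ℝ), ENNReal.ofReal (lam ^ n) *
      ‖Φ lam * lam * Real.log lam‖ₑ < ⊤ := by
    intro n
    have hc : Continuous fun lam : ℝ => Φ lam * (lam ^ n * (lam * Real.log lam)) := by
      have := Real.continuous_mul_log
      fun_prop
    have hi : Integrable fun lam : ℝ => Φ lam * (lam ^ n * (lam * Real.log lam)) :=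
      hc.integrable_of_hasCompactSupport hΦc.mul_right
    refine lt_of_le_of_lt (setLIntegral_mono' measurableSet_Ioi fun lam hlam => ?_)
      hi.integrableOn.2
    have h0 : (0 : ℝ) < lam := hlam
    rw [← ofReal_norm, ← ofReal_norm, ← ENNReal.ofReal_mul (by positivity)]
    refine ENNReal.ofReal_le_ofReal (le_of_eq ?_)
    simp only [norm_mul, norm_pow, Real.norm_of_nonneg h0.le]
    ring
  set P := A * (∫⁻ w, ‖U w‖ₑ) * ∫⁻ y, ‖f y‖ₑ with hP
  set Q₁ := ∫⁻ z, ‖U z‖ₑ with hQ₁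
  set Q₂ := 2 * ∫⁻ z, ‖U z‖ₑ * ENNReal.ofReal ((‖x - z‖ ^ 2)⁻¹) with hQ₂
  have hPt : P < ⊤ := ENNReal.mul_lt_top (ENNReal.mul_lt_top hA.lt_top hU1.lt_top) hf1.lt_top
  have hQ₂t : Q₂ < ⊤ := ENNReal.mul_lt_top (by simp) hx
  have hφm : Measurable fun lam : ℝ => ‖Φ lam * lam * Real.log lam‖ₑ := by
    have := hΦ.measurable
    fun_prop
  calc _ ≤ ∫⁻ lam in Ioi (0 : ℝ), P * (Q₁ * (ENNReal.ofReal (lam ^ 4) *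
        ‖Φ lam * lam * Real.log lam‖ₑ) + Q₂ * (ENNReal.ofReal (lam ^ 2) *
        ‖Φ lam * lam * Real.log lam‖ₑ)) := by
        refine setLIntegral_mono' measurableSet_Ioi fun lam hlam => ?_
        simp only [Function.uncurry_apply_pair, enorm_mul (fullIntegrand L f x lam _)]
        have hmx : Measurable (fullIntegrand L f x lam) :=
          (measurable_fullIntegrand hL hf x).comp measurable_prodMk_left
        rw [lintegral_mul_const _ hmx.enorm]
        refine (mul_le_mul_left (lintegral_enorm_fullIntegrand_le hU hLU hf x hlam) _).trans
          (le_of_eq ?_)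
        have e : ‖((Φ lam * lam * Real.log lam : ℝ) : ℂ)‖ₑ = ‖Φ lam * lam * Real.log lam‖ₑ := by
          rw [← ofReal_norm, Complex.norm_real, ofReal_norm]
        rw [e]
        ring
    _ = P * (Q₁ * (∫⁻ lam in Ioi (0 : ℝ), ENNReal.ofReal (lam ^ 4) *
        ‖Φ lam * lam * Real.log lam‖ₑ) + Q₂ * ∫⁻ lam in Ioi (0 : ℝ), ENNReal.ofReal (lam ^ 2) *
        ‖Φ lam * lam * Real.log lam‖ₑ) := by
        rw [lintegral_const_mul _ (by fun_prop), lintegral_add_left (by fun_prop),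
          lintegral_const_mul _ (by fun_prop), lintegral_const_mul _ (by fun_prop)]
    _ < ⊤ := ENNReal.mul_lt_top hPt (ENNReal.add_lt_top.2
        ⟨ENNReal.mul_lt_top hU1.lt_top (hmom 4), ENNReal.mul_lt_top hQ₂t (hmom 2)⟩)

end Convergence

/-! ### The functions `V ψ_j` and the kernel `L₁`. -/

section Potential

variable {V : R4 → ℝ} {d : ℕ} {ψ : Fin d → Lp ℂ 2 (volume : Measure R4)}

/-- The sum of the absolute values of the functions `V ψ_j`. -/
noncomputable def eigenWeight (V : R4 → ℝ) {d : ℕ} (ψ : Fin d → Lp ℂ 2 (volume : Measure R4))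
    (z : R4) : ℝ :=
  ∑ j, ‖(V z : ℂ) * ψ j z‖

theorem measurable_potential_mul (hV : Measurable V) (j : Fin d) :
    Measurable fun z => (V z : ℂ) * ψ j z :=
  (Complex.measurable_ofReal.comp hV).mul (Lp.stronglyMeasurable (ψ j)).measurable

theorem measurable_eigenWeight (hV : Measurable V) : Measurable (eigenWeight V ψ) :=
  Finset.measurable_fun_sum _ fun j _ => (measurable_potential_mul hV j).norm

theorem measurable_kernelL1 (hV : Measurable V) (a : Fin d → Fin d → ℝ) :
    Measurable (Function.uncurry (kernelL1 V ψ a)) := by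
  have h : Function.uncurry (kernelL1 V ψ a) = fun q : R4 × R4 =>
      ∑ j, ∑ k, (a j k : ℂ) * ((V q.1 : ℂ) * ψ j q.1) * ((V q.2 : ℂ) * ψ k q.2) := rfl
  rw [h]
  refine Finset.measurable_fun_sum _ fun j _ => Finset.measurable_fun_sum _ fun k _ => ?_
  exact (measurable_const.mul ((measurable_potential_mul hV j).comp measurable_fst)).mul
    ((measurable_potential_mul hV k).comp measurable_snd)

theorem enorm_kernelL1_le (a : Fin d → Fin d → ℝ) (z w : R4) :
    ‖kernelL1 V ψ a z w‖ₑ ≤ ENNReal.ofReal (∑ j, ∑ k, |a j k|) * ‖eigenWeight V ψ z‖ₑ *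
      ‖eigenWeight V ψ w‖ₑ := by
  have hnn : ∀ x, 0 ≤ eigenWeight V ψ x := fun x => Finset.sum_nonneg fun _ _ => norm_nonneg _
  have hle : ∀ j x, ‖(V x : ℂ) * ψ j x‖ ≤ eigenWeight V ψ x := fun j x =>
    Finset.single_le_sum (f := fun j => ‖(V x : ℂ) * ψ j x‖) (fun _ _ => norm_nonneg _)
      (Finset.mem_univ j)
  have hA : 0 ≤ ∑ j, ∑ k, |a j k| :=
    Finset.sum_nonneg fun _ _ => Finset.sum_nonneg fun _ _ => abs_nonneg _
  rw [← ofReal_norm, ← ofReal_norm, ← ofReal_norm, ← ENNReal.ofReal_mul hA,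
    ← ENNReal.ofReal_mul (by positivity)]
  refine ENNReal.ofReal_le_ofReal ?_
  rw [Real.norm_of_nonneg (hnn z), Real.norm_of_nonneg (hnn w), kernelL1, Finset.sum_mul,
    Finset.sum_mul]
  refine norm_sum_le_of_le _ fun j _ => ?_
  rw [Finset.sum_mul, Finset.sum_mul]
  refine norm_sum_le_of_le _ fun k _ => ?_
  rw [norm_mul, norm_mul, Complex.norm_real, Real.norm_eq_abs]
  have h1 := hle j z
  have h2 := hle k w
  have h3 := hnn z
  gcongr

/-- `V` is bounded, so `V ψ_j ∈ L²`; it is also in `L²` because `2δ > 4`, so `V ψ_j ∈ L¹` by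
Cauchy–Schwarz. -/
theorem eigenWeight_memLp (hV : Measurable V)
    (hdecay : ∃ δ > (4 : ℝ), ∃ C : ℝ, ∀ z, |V z| ≤ C * japaneseBracket z ^ (-δ)) :
    MemLp (eigenWeight V ψ) 1 ∧ MemLp (eigenWeight V ψ) 2 := by
  obtain ⟨δ, hδ, C, hC⟩ := hdecay
  have hJ : ∀ z : R4, 1 ≤ japaneseBracket z := fun z => by
    rw [japaneseBracket, Real.one_le_sqrt]; nlinarith [sq_nonneg ‖z‖]
  have hC0 : 0 ≤ C := by
    have h := (abs_nonneg _).trans (hC 0)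
    have : 0 < japaneseBracket (0 : R4) ^ (-δ) :=
      Real.rpow_pos_of_pos (by linarith [hJ 0]) _
    exact nonneg_of_mul_nonneg_left h this
  have hbd : ∀ z, |V z| ≤ C := fun z => (hC z).trans
    (mul_le_of_le_one_right hC0 (Real.rpow_le_one_of_one_le_of_nonpos (hJ z) (by linarith)))
  have hVc : Measurable fun z => (V z : ℂ) := Complex.measurable_ofReal.comp hV
  have hV2 : MemLp (fun z => (V z : ℂ)) 2 := by
    rw [memLp_two_iff_integrable_sq_norm hVc.aestronglyMeasurable]
    have hInt := (integrable_rpow_neg_one_add_norm_sq (E := R4) (μ := volume) (r := 2 * δ)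
      (by rw [finrank_R4]; push_cast; linarith)).const_mul (C ^ 2)
    refine hInt.mono' (by fun_prop) (Filter.Eventually.of_forall fun z => ?_)
    rw [Real.norm_of_nonneg (by positivity), Complex.norm_real, Real.norm_eq_abs]
    have hb : japaneseBracket z ^ (-δ) = (1 + ‖z‖ ^ 2) ^ (-δ / 2) := by
      rw [japaneseBracket, Real.sqrt_eq_rpow, ← Real.rpow_mul (by positivity)]
      congr 1; ring
    calc |V z| ^ 2 ≤ (C * japaneseBracket z ^ (-δ)) ^ 2 := by gcongr; exact hC z
      _ = C ^ 2 * (1 + ‖z‖ ^ 2) ^ (-(2 * δ) / 2) := by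
          rw [hb, mul_pow, ← Real.rpow_natCast ((1 + ‖z‖ ^ 2) ^ (-δ / 2)),
            ← Real.rpow_mul (by positivity),
            show -δ / 2 * ((2 : ℕ) : ℝ) = -(2 * δ) / 2 by push_cast; ring]
  have h2 : ∀ j, MemLp (fun z => (V z : ℂ) * ψ j z) 2 := fun j =>
    (Lp.memLp (ψ j)).of_le_mul (c := C) (measurable_potential_mul hV j).aestronglyMeasurable
      (Filter.Eventually.of_forall fun z => by
        rw [norm_mul, Complex.norm_real, Real.norm_eq_abs]
        gcongr
        exact hbd z)
  have h1 : ∀ j, MemLp (fun z => (V z : ℂ) * ψ j z) 1 := fun j =>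
    memLp_one_iff_integrable.2 (hV2.integrable_mul (Lp.memLp (ψ j)))
  exact ⟨memLp_finsetSum _ fun j _ => (h1 j).norm, memLp_finsetSum _ fun j _ => (h2 j).norm⟩

end Potential

/-! ### The kernel of the integrated operator and its `L^q` bound. -/

theorem lintegral_enorm_ne_top_of_memLp_one {E : Type*} [NormedAddCommGroup E] {f : R4 → E}
    (hf : MemLp f 1) : ∫⁻ z, ‖f z‖ₑ ≠ ⊤ := by
  rw [← eLpNorm_one_eq_lintegral_enorm]
  exact hf.2.ne

/-- The kernel of the integrated operator `W_log` in all variables. -/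
noncomputable def wlogKernel (L : R4 → R4 → ℂ) (Φ : ℝ → ℝ) (x : R4) (ξ : R4 × R4 × R4) : ℂ :=
  1 / ((Real.pi : ℂ) * Complex.I) *
    (L ξ.1 ξ.2.1 * spectralKernel Φ ‖x - ξ.1‖ ‖ξ.2.1 - ξ.2.2‖)

theorem measurable_const_mul_kernel_mul_radial {L : R4 → R4 → ℂ} {S : ℝ → ℝ → ℂ}
    (hL : Measurable (Function.uncurry L)) (hS : Measurable (Function.uncurry S)) (c : ℂ) :
    Measurable fun q : R4 × R4 × R4 × R4 =>
      c * (L q.2.1 q.2.2.1 * S ‖q.1 - q.2.1‖ ‖q.2.2.1 - q.2.2.2‖) := by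
  have h1 : Measurable fun q : R4 × R4 × R4 × R4 => L q.2.1 q.2.2.1 :=
    hL.comp (measurable_snd.fst.prodMk measurable_snd.snd.fst)
  have h2 : Measurable fun q : R4 × R4 × R4 × R4 => S ‖q.1 - q.2.1‖ ‖q.2.2.1 - q.2.2.2‖ :=
    hS.comp ((measurable_fst.sub measurable_snd.fst).norm.prodMk
      (measurable_snd.snd.fst.sub measurable_snd.snd.snd).norm)
  exact (h1.mul h2).const_mul c

theorem measurable_wlogKernel {L : R4 → R4 → ℂ} (hL : Measurable (Function.uncurry L))
    {Φ : ℝ → ℝ} (hΦ : Measurable Φ) : Measurable (Function.uncurry (wlogKernel L Φ)) :=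
  measurable_const_mul_kernel_mul_radial hL (measurable_spectralKernel hΦ) _

theorem lintegral_wlogKernel_rpow_le {L : R4 → R4 → ℂ} {U : R4 → ℝ} {A : ℝ≥0∞} {Φ : ℝ → ℝ}
    (hU : Measurable U) (hA : A ≠ ⊤) (hLU : ∀ z w, ‖L z w‖ₑ ≤ A * ‖U z‖ₑ * ‖U w‖ₑ)
    (hU1 : MemLp U 1) (hU2 : MemLp U 2) (hΦ : ContDiff ℝ ∞ Φ)
    (hΦc : HasCompactSupport Φ) {q : ℝ} (hq : 1 ≤ q) :
    ∃ C : ℝ≥0∞, C ≠ ⊤ ∧ ∀ g : R4 → ℝ≥0∞, Measurable g →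
      ∫⁻ x, (∫⁻ ξ, ‖wlogKernel L Φ x ξ‖ₑ * g ξ.2.2) ^ q ≤ C * ∫⁻ y, g y ^ q := by
  have hq0 : 0 ≤ q := by linarith
  obtain ⟨K, hK0, hK⟩ := norm_spectralKernel_le hΦ hΦc hq
  have hu1 := lintegral_enorm_ne_top_of_memLp_one hU1
  have hu2 : ∫⁻ z, ‖U z‖ₑ ^ (2 : ℝ) ≠ ⊤ := by
    have := lintegral_rpow_enorm_lt_top_of_eLpNorm_lt_top (by simp) (by simp) hU2.2
    simpa using this.ne
  obtain ⟨C, hC, H⟩ := lintegral_kernelMajorant_rpow_le hU.enorm hU.enorm hu1 hu2 hu1 hq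
  have hc : ENNReal.ofReal K * A ≠ ⊤ := ENNReal.mul_ne_top ENNReal.ofReal_ne_top hA
  have hcq : (ENNReal.ofReal K * A) ^ q ≠ ⊤ := (ENNReal.rpow_lt_top_of_nonneg hq0 hc).ne
  refine ⟨(ENNReal.ofReal K * A) ^ q * C, ENNReal.mul_ne_top hcq hC, fun g hg => ?_⟩
  have hpi : ‖1 / ((Real.pi : ℂ) * Complex.I)‖ₑ ≤ 1 := by
    rw [← ofReal_norm, ENNReal.ofReal_le_one, norm_div, norm_mul, Complex.norm_I, mul_one,
      Complex.norm_real, norm_one, Real.norm_of_nonneg Real.pi_pos.le, div_le_one Real.pi_pos]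
    linarith [Real.pi_gt_three]
  have hpt : ∀ x (ξ : R4 × R4 × R4), ‖wlogKernel L Φ x ξ‖ₑ ≤ (ENNReal.ofReal K * A) *
      (‖U ξ.1‖ₑ * ‖U ξ.2.1‖ₑ * kernelMajorant q x ξ) := by
    intro x ξ
    have hs : ‖spectralKernel Φ ‖x - ξ.1‖ ‖ξ.2.1 - ξ.2.2‖‖ₑ ≤
        ENNReal.ofReal K * kernelMajorant q x ξ := by
      have hn1 := norm_nonneg (x - ξ.1)
      have hn2 := norm_nonneg (ξ.2.1 - ξ.2.2)
      rw [kernelMajorant, ← ENNReal.ofReal_mul (leftMajorant_nonneg q hn1),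
        ← ENNReal.ofReal_add (schurMajorant_nonneg hn1 _)
          (mul_nonneg (leftMajorant_nonneg q hn1) (rightMajorant_nonneg q hn2)),
        ← ENNReal.ofReal_mul hK0, ← ofReal_norm]
      exact ENNReal.ofReal_le_ofReal (hK _ _ hn1 hn2)
    rw [wlogKernel, enorm_mul, enorm_mul]
    calc _ ≤ 1 * ((A * ‖U ξ.1‖ₑ * ‖U ξ.2.1‖ₑ) * (ENNReal.ofReal K * kernelMajorant q x ξ)) := by
          gcongr
          exact hLU _ _
      _ = _ := by ring
  calc _ ≤ ∫⁻ x, (ENNReal.ofReal K * A) ^ q *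
        (∫⁻ ξ : R4 × R4 × R4, ‖U ξ.1‖ₑ * ‖U ξ.2.1‖ₑ * kernelMajorant q x ξ * g ξ.2.2) ^ q := by
        refine lintegral_mono fun x => ?_
        rw [← ENNReal.mul_rpow_of_nonneg _ _ hq0, ← lintegral_const_mul' _ _ hc]
        refine ENNReal.rpow_le_rpow (lintegral_mono fun ξ => ?_) hq0
        rw [← mul_assoc]
        exact mul_le_mul_left (hpt x ξ) _
    _ = (ENNReal.ofReal K * A) ^ q * ∫⁻ x, (∫⁻ ξ : R4 × R4 × R4,
        ‖U ξ.1‖ₑ * ‖U ξ.2.1‖ₑ * kernelMajorant q x ξ * g ξ.2.2) ^ q :=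
        lintegral_const_mul' _ _ hcq
    _ ≤ _ := by
        rw [mul_assoc]
        gcongr
        exact H g hg

/-! ### Identification of `W_log` with the operator of that kernel. -/

section Main

variable {V : R4 → ℝ} {d : ℕ} {ψ : Fin d → Lp ℂ 2 (volume : Measure R4)}
  {a : Fin d → Fin d → ℝ} {Φ : ℝ → ℝ} {f : R4 → ℂ}

theorem operatorL1_resolventDiff (hf : Measurable f) (hf1 : ∫⁻ y, ‖f y‖ₑ ≠ ⊤) {lam : ℝ}
    (hlam : 0 < lam) (z : R4) :
    operatorL1 V ψ a (resolventDiff lam f) z =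
      ∫ w, kernelL1 V ψ a z w * resolventDiffIntegral lam f w := by
  refine integral_congr_ae ?_
  filter_upwards [resolventDiff_ae_eq hf hf1 hlam] with w hw
  rw [hw]

/-- The set of good `x` is where the convolution of `eigenWeight V ψ` with `|x|⁻²` is finite. There
the integrand in all variables, frequency included, is absolutely integrable, so the `lam` integral
may be done first and produces `spectralKernel`. -/
theorem wlog_converges_and_eq (hV : Measurable V) (hU1 : MemLp (eigenWeight V ψ) 1)
    (hΦ : Continuous Φ) (hΦc : HasCompactSupport Φ) (hf : Measurable f)
    (hf1 : ∫⁻ y, ‖f y‖ₑ ≠ ⊤) :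
    ∀ᵐ x, WlogConvergesAt V ψ a Φ f x ∧
      Wlog V ψ a Φ f x = ∫ ξ, wlogKernel (kernelL1 V ψ a) Φ x ξ * f ξ.2.2 := by
  have hU := measurable_eigenWeight (ψ := ψ) hV
  have hL := measurable_kernelL1 (ψ := ψ) hV a
  have hLU := enorm_kernelL1_le (V := V) (ψ := ψ) a
  have hu1 := lintegral_enorm_ne_top_of_memLp_one hU1
  have hA : ENNReal.ofReal (∑ j, ∑ k, |a j k|) ≠ ⊤ := ENNReal.ofReal_ne_top
  filter_upwards [ae_lintegral_mul_inv_sq_lt_top hU.enorm hu1] with x hx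
  have hH := integrable_fullIntegrand_mul hL hU hA hLU hu1 hf hf1 hx hΦ hΦc
  have hinner : ∀ lam ∈ Ioi (0 : ℝ), integrandWlog V ψ a Φ f x lam =
      ∫ ξ, fullIntegrand (kernelL1 V ψ a) f x lam ξ *
        ((Φ lam * lam * Real.log lam : ℝ) : ℂ) := by
    intro lam hlam
    rw [integral_mul_const, integral_fullIntegrand hL hU hA hLU hu1 hf hf1 hx hlam, integrandWlog,
      freeResolventPlus]
    simp_rw [operatorL1_resolventDiff hf hf1 hlam]
  refine ⟨⟨fun lam hlam => ?_, fun lam hlam => ?_, fun lam hlam z => ?_, fun lam hlam => ?_, ?_⟩, ?_⟩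
  · filter_upwards [ae_lintegral_mul_inv_sq_lt_top hf.enorm hf1] with w hw
    exact integrable_resolventKernelPlus_mul hf hf1 hw hlam
  · filter_upwards [ae_lintegral_mul_inv_sq_lt_top hf.enorm hf1] with w hw
    exact integrable_resolventKernelMinus_mul hf hf1 hw hlam
  · refine (integrable_kernel_mul_resolventDiffIntegral hL hU hA hLU hu1 hf hf1 lam z).2.congr ?_
    filter_upwards [resolventDiff_ae_eq hf hf1 hlam] with w hw
    rw [hw]
  · simp_rw [operatorL1_resolventDiff hf hf1 hlam]
    exact integrable_resolventKernelPlus_mul_kernel hL hU hA hLU hu1 hf hf1 hx hlam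
  · refine hH.integral_prod_left.congr ?_
    exact (ae_restrict_mem measurableSet_Ioi).mono fun lam hlam => (hinner lam hlam).symm
  · rw [Wlog, setIntegral_congr_fun measurableSet_Ioi hinner, integral_integral_swap hH,
      ← integral_const_mul]
    congr 1
    ext ξ
    have hcomm : ∀ lam : ℝ, fullIntegrand (kernelL1 V ψ a) f x lam ξ *
        ((Φ lam * lam * Real.log lam : ℝ) : ℂ) = (kernelL1 V ψ a ξ.1 ξ.2.1 * f ξ.2.2) *
        (resolventKernelPlus lam ‖x - ξ.1‖ * (resolventKernelPlus lam ‖ξ.2.1 - ξ.2.2‖ -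
          resolventKernelMinus lam ‖ξ.2.1 - ξ.2.2‖) * ((Φ lam * lam * Real.log lam : ℝ) : ℂ)) := by
      intro lam
      rw [fullIntegrand, resolventKernelDiff]
      ring
    simp_rw [hcomm]
    rw [integral_const_mul, wlogKernel, spectralKernel]
    ring

/-- The data enter only under integrals, so functions equal almost everywhere give identical values
at every point. This permits replacing `f` by the measurable representative of its `L^p` class. -/
theorem resolventDiff_congr_ae {g : R4 → ℂ} (h : f =ᵐ[volume] g) (lam : ℝ) :
    resolventDiff lam f = resolventDiff lam g := by
  ext x
  rw [resolventDiff, resolventDiff, freeResolventPlus, freeResolventPlus, freeResolventMinus,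
    freeResolventMinus]
  congr 1
  · exact integral_congr_ae (h.mono fun y hy => by simp only [hy])
  · exact integral_congr_ae (h.mono fun y hy => by simp only [hy])

theorem integrandWlog_congr_ae {g : R4 → ℂ} (h : f =ᵐ[volume] g) (x : R4) :
    integrandWlog V ψ a Φ f x = integrandWlog V ψ a Φ g x := by
  ext lam
  rw [integrandWlog, integrandWlog, resolventDiff_congr_ae h]

theorem WlogConvergesAt.congr_ae {g : R4 → ℂ} (h : f =ᵐ[volume] g) {x : R4}
    (hf : WlogConvergesAt V ψ a Φ f x) : WlogConvergesAt V ψ a Φ g x where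
  plus lam hlam := (hf.plus lam hlam).mono fun w hw =>
    hw.congr (h.mono fun y hy => by simp only [hy])
  minus lam hlam := (hf.minus lam hlam).mono fun w hw =>
    hw.congr (h.mono fun y hy => by simp only [hy])
  middle lam hlam z := by
    rw [← resolventDiff_congr_ae h]
    exact hf.middle lam hlam z
  outer lam hlam := by
    rw [← resolventDiff_congr_ae h]
    exact hf.outer lam hlam
  spectral := by
    rw [← integrandWlog_congr_ae h]
    exact hf.spectral

end Main

theorem proposition3p1 (V : R4 → ℝ) (hV : Measurable V)
    (hdecay : ∃ δ > (4 : ℝ), ∃ C : ℝ, ∀ z, |V z| ≤ C * japaneseBracket z ^ (-δ))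
    (d : ℕ) (ψ : Fin d → Lp ℂ 2 (volume : Measure R4)) (hψ : IsZeroEnergyEigenbasis V ψ)
    (a : Fin d → Fin d → ℝ)
    (Φ : ℝ → ℝ) (hΦ : ContDiff ℝ ∞ Φ) (hΦc : HasCompactSupport Φ)
    (p : ℝ≥0∞) [Fact (1 ≤ p)] (hp : p ≠ ⊤) :
    ∃ T : Lp ℂ p (volume : Measure R4) →L[ℂ] Lp ℂ p (volume : Measure R4),
      ∀ f : R4 → ℂ, MemLp f 1 → ∀ hf : MemLp f p,
        (∀ᵐ x, WlogConvergesAt V ψ a Φ f x) ∧ T (hf.toLp f) =ᵐ[volume] Wlog V ψ a Φ f := by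
  obtain ⟨hU1, hU2⟩ := eigenWeight_memLp (ψ := ψ) hV hdecay
  have hp1 : 1 ≤ p.toReal := by
    have := ENNReal.toReal_mono hp (Fact.out : 1 ≤ p)
    simpa using this
  obtain ⟨C, hC, hbound⟩ := lintegral_wlogKernel_rpow_le (measurable_eigenWeight hV)
    ENNReal.ofReal_ne_top (enorm_kernelL1_le (V := V) (ψ := ψ) a) hU1 hU2 hΦ hΦc hp1
  obtain ⟨T, hT⟩ := exists_continuousLinearMap_of_lintegral_kernel_le hp
    (measurable_wlogKernel (measurable_kernelL1 (ψ := ψ) hV a) hΦ.continuous.measurable) hC hbound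
  refine ⟨T, fun f hf1 hf => ?_⟩
  have hae : (hf.toLp f : R4 → ℂ) =ᵐ[volume] f := hf.coeFn_toLp
  have h1 := lintegral_enorm_ne_top_of_memLp_one ((memLp_congr_ae hae).2 hf1)
  have hmain := wlog_converges_and_eq (a := a) hV hU1 hΦ.continuous hΦc
    (Lp.stronglyMeasurable (hf.toLp f)).measurable h1
  refine ⟨hmain.mono fun x hx => hx.1.congr_ae hae, ?_⟩
  filter_upwards [hT (hf.toLp f), hmain] with x hTx hx
  rw [hTx, ← hx.2, Wlog, Wlog, integrandWlog_congr_ae hae]
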